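/- Let $x_1,\dots,x_n$, $y_1,\dots,y_n$, $q_1,\dots,q_{n-1}$ be variables. For $0\le k\le n$ let $\Delta_k(t\,|\,X_k)=\Delta_k(t\,|\,x_1,\dots,x_k)$ be the determinant of the tridiagonal $k\times k$ matrix with diagonal entries $x_i+t$, entries $q_1,\dots,q_{k-1}$ directly above the diagonal and entries $-1$ directly below it. Let $w_0$ be the longest element of the symmetric group $S_n$, and let $$\widetilde{\mathfrak S}_{w_0}(x,y)=\prod_{i=1}^{n-1}\Delta_i(y_{n-i}\,|\,X_i),\qquad \widetilde{\mathfrak S}_w(x,y)=\partial^{(y)}_{ww_0}\widetilde{\mathfrak S}_{w_0}(x,y),\qquad \widetilde{\mathfrak S}_w(x)=\widetilde{\mathfrak S}_w(x,0)\qquad(w\in S_n),$$ where $\partial^{(y)}_v=\partial_{a_1}\cdots\partial_{a_p}$ for a reduced word $v=s_{a_1}\cdots s_{a_p}$ and $\partial_a f=(f-s_af)/(y_a-y_{a+1})$; the $\widetilde{\mathfrak S}_w(x)$ are the quantum Schubert polynomials. Let $\widetilde e_1,\dots,\widetilde e_n$ be defined by $\Delta_n(t\,|\,X_n)=t^n+\sum_{i=1}^n\widetilde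 e_i\,t^{n-i}$, and let $\widetilde I_n=(\widetilde e_1,\dots,\widetilde e_n)\subset\mathbb Z[x_1,\dots,x_n,q_1,\dots,q_{n-1}]$. The quantum Schubert structure constants $\widetilde c_{uv}^w(q)\in\mathbb Z[q_1,\dots,q_{n-1}]$ are defined by $$\widetilde{\mathfrak S}_u\widetilde{\mathfrak S}_v\equiv\sum_{w\in S_n}\widetilde c_{uv}^w(q)\,\widetilde{\mathfrak S}_w\pmod{\widetilde I_n}.$$ Let $t=(t_w)_{w\in S_n}$ be variables. Let $K(x,t)=\bigl[\exp\bigl(\sum_{w\in S_n}t_w\widetilde{\mathfrak S}_w(x)\bigr)\bigr]$, where $[\,\cdot\,]$ is the projection modulo $\widetilde I_n$ (with rational coefficients, applied to the coefficient of each monomial in $t$) onto the span over $\mathbb Q[q]$ of the monomials $x_1^{i_1}\cdots x_n^{i_n}$ with $0\le i_j\le n-j$. Let $$\mathcal F(t)=\langle K(x,t)\rangle_{\widetilde I_n}$$ be the toy Gromov--Witten potential, a power series in $t$ with coefficients in $\mathbb Q[q]$; here $\langle f\rangle_{\widetilde I_n}=\operatorname{Res}\left[\begin{smallmatrix}f\,dx_1\wedge\cdots\wedge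 dx_n\\ \widetilde e_1,\dots,\widetilde e_n\end{smallmatrix}\right]$ is the Grothendieck residue over $\mathbb Q[q]$, applied to the coefficient of each monomial in $t$. For all $u,w\in S_n$ let $$\Delta_{u,w}=\frac{\partial}{\partial t_u}\frac{\partial}{\partial t_w}-\sum_{\tau\in S_n}\widetilde c_{w,\,w_0\tau}^{\,w_0u}(q)\,\frac{\partial}{\partial t_\tau}.$$ Then $\Delta_{u,w}\mathcal F=0$. -/

import Mathlib

noncomputable section

namespace FlagPotential

open MvPolynomial

/-! ### Rings of polynomials -/

/-- The ring `k[q₁, …, q_{n-1}]` of quantum parameters. -/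
abbrev QRing (k : Type*) [CommRing k] (n : ℕ) := MvPolynomial (Fin (n - 1)) k

/-- The ring `k[q₁, …, q_{n-1}][x₁, …, x_n]`. -/
abbrev XRing (k : Type*) [CommRing k] (n : ℕ) := MvPolynomial (Fin n) (QRing k n)

/-- The ring `k[q₁, …, q_{n-1}][x₁, …, x_n][y₁, …, y_n]`: the inner variables are the `x`'s,
the outer ones the `y`'s. -/
abbrev XYRing (k : Type*) [CommRing k] (n : ℕ) := MvPolynomial (Fin n) (XRing k n)

/-! ### Divided differences -/

/-- Polynomial values at congruent points are congruent. -/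
theorem dvd_aeval_sub_aeval {σ R B : Type*} [CommRing R] [CommRing B] [Algebra R B]
    (a b : σ → B) (v : B) (h : ∀ i, v ∣ a i - b i) (f : MvPolynomial σ R) :
    v ∣ aeval a f - aeval b f := by
  induction f using MvPolynomial.induction_on with
  | C r => simp
  | add p q hp hq =>
    have := dvd_add hp hq
    simpa [add_sub_add_comm] using this
  | mul_X p i hp =>
    have h1 : aeval a (p * X i) - aeval b (p * X i)
        = (aeval a p - aeval b p) * a i + aeval b p * (a i - b i) := by
      simp only [map_mul, aeval_X]; ring
    rw [h1]
    exact dvd_add (Dvd.dvd.mul_right hp _) (Dvd.dvd.mul_left (h i) _)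

/-- `X i - X j` divides the difference of `f` and of `f` with `X i`, `X j` interchanged. -/
theorem dvd_sub_swap {σ S : Type*} [DecidableEq σ] [CommRing S] (i j : σ)
    (f : MvPolynomial σ S) : (X i - X j : MvPolynomial σ S) ∣ f - rename (Equiv.swap i j) f := by
  have h := dvd_aeval_sub_aeval (R := S) (X : σ → MvPolynomial σ S)
    (fun l => X (Equiv.swap i j l)) (X i - X j) (by
      intro l
      by_cases hi : l = i
      · subst hi; simp
      · by_cases hj : l = j
        · subst hj
          rw [Equiv.swap_apply_right, ← neg_sub, neg_dvd]
        · simp [Equiv.swap_apply_of_ne_of_ne hi hj]) f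
  have h2 : rename (Equiv.swap i j) f = aeval (fun l => X (Equiv.swap i j l)) f := by
    rw [rename_eq_aeval]; rfl
  rw [h2]
  simpa using h

/-- The divided difference `(f - s_{ij} f) / (X i - X j)`. -/
def divDiff {σ S : Type*} [DecidableEq σ] [CommRing S] (i j : σ) (f : MvPolynomial σ S) :
    MvPolynomial σ S :=
  (dvd_sub_swap i j f).choose

theorem mul_divDiff {σ S : Type*} [DecidableEq σ] [CommRing S] (i j : σ)
    (f : MvPolynomial σ S) : (X i - X j) * divDiff i j f = f - rename (Equiv.swap i j) f :=
  (dvd_sub_swap i j f).choose_spec.symm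

/-! ### Reduced words in the symmetric group -/

/-- The smaller of the two letters moved by the `a`-th simple transposition. -/
def lo {n : ℕ} (a : Fin (n - 1)) : Fin n := ⟨a, by omega⟩

/-- The larger of the two letters moved by the `a`-th simple transposition. -/
def hi {n : ℕ} (a : Fin (n - 1)) : Fin n := ⟨a + 1, by omega⟩

/-- The simple transpositions of the symmetric group on `n` letters. -/
def simpleTransposition {n : ℕ} (a : Fin (n - 1)) : Equiv.Perm (Fin n) := Equiv.swap (lo a) (hi a)

/-- `l = [a₁, …, a_p]` is a reduced word of `w`: `w = s_{a₁} ⋯ s_{a_p}` with `p` minimal. -/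
def IsReducedWord {n : ℕ} (l : List (Fin (n - 1))) (w : Equiv.Perm (Fin n)) : Prop :=
  (l.map simpleTransposition).prod = w ∧
    ∀ l' : List (Fin (n - 1)), (l'.map simpleTransposition).prod = w → l.length ≤ l'.length

theorem exists_word {n : ℕ} (w : Equiv.Perm (Fin n)) :
    ∃ l : List (Fin (n - 1)), (l.map simpleTransposition).prod = w := by
  cases n with
  | zero => exact ⟨[], Subsingleton.elim _ _⟩
  | succ m =>
    have hw : w ∈ Submonoid.closure
        (Set.range fun i : Fin m ↦ Equiv.swap i.castSucc i.succ) := by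
      rw [Equiv.Perm.mclosure_swap_castSucc_succ]; trivial
    induction hw using Submonoid.closure_induction with
    | mem x hx =>
      obtain ⟨i, rfl⟩ := hx
      refine ⟨[i], ?_⟩
      simp only [List.map_cons, List.map_nil, List.prod_cons, List.prod_nil, mul_one]
      rfl
    | one => exact ⟨[], rfl⟩
    | mul x y _ _ hx hy =>
      obtain ⟨l, rfl⟩ := hx
      obtain ⟨l', rfl⟩ := hy
      exact ⟨l ++ l', by simp⟩

theorem exists_isReducedWord {n : ℕ} (w : Equiv.Perm (Fin n)) :
    ∃ l : List (Fin (n - 1)), IsReducedWord l w := by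
  obtain ⟨l, hl, hmin⟩ := (measure (List.length (α := Fin (n - 1)))).wf.has_min
    {l | (l.map simpleTransposition).prod = w} (exists_word w)
  exact ⟨l, hl, fun l' hl' => not_lt.mp (hmin l' hl')⟩

/-- The divided difference operator `∂_w = ∂_{a₁} ∘ ⋯ ∘ ∂_{a_p}`, where `a₁ ⋯ a_p` is a reduced
word of `w`. -/
def divDiffPerm {n : ℕ} {S : Type*} [CommRing S] (w : Equiv.Perm (Fin n))
    (f : MvPolynomial (Fin n) S) : MvPolynomial (Fin n) S :=
  (exists_isReducedWord w).choose.foldr (fun a g => divDiff (lo a) (hi a) g) f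

/-! ### Quantum Schubert polynomials -/

/-- The tridiagonal determinant `Δ_k(t | x₁, …, x_k)`: diagonal entries `x_i + t`, entries
`q₁, …, q_{k-1}` above and `-1` below the diagonal. -/
def quantumDelta {S : Type*} [CommRing S] (k : ℕ) (x : Fin k → S) (q : Fin (k - 1) → S) (t : S) :
    S :=
  Matrix.det (Matrix.of fun i j : Fin k =>
    if i = j then x i + t
    else if h : (i : ℕ) + 1 = j then q ⟨i, by omega⟩
    else if (j : ℕ) + 1 = i then -1
    else 0)

/-- The top quantum double Schubert polynomial
`S̃_{w₀}(x, y) = ∏_{i=1}^{n-1} Δ_i(y_{n-i} | x₁, …, x_i)`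
(the factor with index `a : Fin (n - 1)` is the one for `i = a + 1`). -/
def topQuantumDoubleSchubert (k : Type*) [CommRing k] (n : ℕ) : XYRing k n :=
  ∏ a : Fin (n - 1), quantumDelta (S := XYRing k n) ((a : ℕ) + 1)
    (fun i => C (X ⟨i, by omega⟩))
    (fun i => C (C (X ⟨i, by omega⟩)))
    (X ⟨n - 2 - (a : ℕ), by omega⟩)

/-- The quantum double Schubert polynomial `S̃_w(x, y) = ∂_{w w₀}^{(y)} S̃_{w₀}(x, y)`;
`Fin.revPerm` is the longest permutation `w₀`. -/
def quantumDoubleSchubert (k : Type*) [CommRing k] {n : ℕ} (w : Equiv.Perm (Fin n)) :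
    XYRing k n :=
  divDiffPerm (w * Fin.revPerm) (topQuantumDoubleSchubert k n)

/-- The quantum Schubert polynomial `S̃_w(x) = S̃_w(x, 0)`. -/
def quantumSchubert (k : Type*) [CommRing k] {n : ℕ} (w : Equiv.Perm (Fin n)) : XRing k n :=
  MvPolynomial.eval (fun _ => 0) (quantumDoubleSchubert k w)

/-! ### The quantum ideal and the structure constants -/

/-- The quantum elementary symmetric polynomial `ẽ_{i+1}` (`i = 0, …, n-1`): the coefficient of
`t^{n-(i+1)}` in `Δ_n(t | x₁, …, x_n)`. -/
def quantumElem (k : Type*) [CommRing k] (n : ℕ) (i : Fin n) : XRing k n :=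
  (quantumDelta (S := Polynomial (XRing k n)) n
    (fun j => Polynomial.C (X j)) (fun j => Polynomial.C (C (X j))) Polynomial.X).coeff
    (n - 1 - (i : ℕ))

/-- The ideal `Ĩ_n` generated by the quantum elementary symmetric polynomials. -/
def quantumIdeal (k : Type*) [CommRing k] (n : ℕ) : Ideal (XRing k n) :=
  Ideal.span (Set.range (quantumElem k n))

open Classical in
/-- The structure constants `c̃_{uv}^w(q) ∈ ℤ[q₁, …, q_{n-1}]` of the quantum Schubert polynomials,
i.e. the coefficients in `S̃_u S̃_v ≡ ∑_w c̃_{uv}^w(q) S̃_w mod Ĩ_n`. -/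
def structureConstant {n : ℕ} (u v w : Equiv.Perm (Fin n)) : QRing ℤ n :=
  if h : ∃ c : Equiv.Perm (Fin n) → QRing ℤ n,
      quantumSchubert ℤ u * quantumSchubert ℤ v - ∑ w, C (c w) * quantumSchubert ℤ w
        ∈ quantumIdeal ℤ n
  then h.choose w else 0

/-! ### The Grothendieck residue -/

/-- The point `(y₁, …, y_m, x_{m+1}, …, x_n)`. -/
def mixedPoint (k : Type*) [CommRing k] (n m : ℕ) (l : Fin n) : XYRing k n :=
  if (l : ℕ) < m then X l else C (X l)

theorem dvd_aeval_mixedPoint {k : Type*} [CommRing k] {n : ℕ} (f : XRing k n) (j : Fin n) :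
    (C (X j) - X j : XYRing k n) ∣
      aeval (mixedPoint k n j) f - aeval (mixedPoint k n ((j : ℕ) + 1)) f := by
  refine dvd_aeval_sub_aeval (R := QRing k n) (B := XYRing k n) (mixedPoint k n j)
    (mixedPoint k n ((j : ℕ) + 1)) (C (X j) - X j) (fun l => ?_) f
  unfold mixedPoint
  rcases lt_trichotomy (l : ℕ) j with h | h | h
  · rw [if_pos h, if_pos (by omega)]; simp
  · obtain rfl := Fin.ext h
    simp
  · rw [if_neg (by omega), if_neg (by omega)]; simp

/-- The discrete partial derivative
`(f(y₁, …, y_{j-1}, x_j, …, x_n) - f(y₁, …, y_j, x_{j+1}, …, x_n)) / (x_j - y_j)`. -/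
def discretePartial {k : Type*} [CommRing k] {n : ℕ} (f : XRing k n) (j : Fin n) : XYRing k n :=
  (dvd_aeval_mixedPoint f j).choose

theorem mul_discretePartial {k : Type*} [CommRing k] {n : ℕ} (f : XRing k n) (j : Fin n) :
    (C (X j) - X j) * discretePartial f j =
      aeval (mixedPoint k n j) f - aeval (mixedPoint k n ((j : ℕ) + 1)) f :=
  (dvd_aeval_mixedPoint f j).choose_spec.symm

/-- The Bezoutian (discrete Jacobian) in `x` and `y` of the sequence `ẽ₁, …, ẽ_n`. -/
def bezoutian (k : Type*) [CommRing k] (n : ℕ) : XYRing k n :=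
  Matrix.det (Matrix.of fun i j : Fin n => discretePartial (quantumElem k n i) j)

/-- Apply a `k[q]`-linear functional to the variables `x`; the result is a polynomial in `y`, whose
variables are renamed to `x`. -/
def contract {k : Type*} [CommRing k] {n : ℕ} (r : XRing k n →ₗ[QRing k n] QRing k n)
    (B : XYRing k n) : XRing k n :=
  ∑ m ∈ B.support, monomial m (r (B.coeff m))

/-- The algebraic (Scheja-Storch) description of the Grothendieck residue
`f ↦ Res [f dx₁ ∧ ⋯ ∧ dx_n / ẽ₁, …, ẽ_n]`: the linear functional over `k[q]` that vanishes on `Ĩ_n`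
and is dual to the Bezoutian, i.e. sends it to `1` modulo `Ĩ_n`. -/
def IsGrothendieckResidue {k : Type*} [CommRing k] {n : ℕ}
    (r : XRing k n →ₗ[QRing k n] QRing k n) : Prop :=
  (∀ f ∈ quantumIdeal k n, r f = 0) ∧ contract r (bezoutian k n) - 1 ∈ quantumIdeal k n

open Classical in
/-- The Grothendieck residue `⟨f⟩_{Ĩ_n}`. -/
def grothendieckResidue (k : Type*) [CommRing k] (n : ℕ) : XRing k n →ₗ[QRing k n] QRing k n :=
  if h : ∃ r : XRing k n →ₗ[QRing k n] QRing k n, IsGrothendieckResidue r then h.choose else 0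

/-! ### The kernel and the potential -/

/-- The `k[q]`-span `H_n[q]` of the monomials `x₁^{i₁} ⋯ x_n^{i_n}` with `i_j ≤ n - j`. -/
def staircaseSpan (k : Type*) [CommRing k] (n : ℕ) : Submodule (QRing k n) (XRing k n) :=
  Submodule.span (QRing k n)
    {f | ∃ m : Fin n →₀ ℕ, (∀ j : Fin n, m j ≤ n - 1 - (j : ℕ)) ∧ f = monomial m 1}

open Classical in
/-- The projection of `f` to `H_n[q]` along `Ĩ_n`: the element of `H_n[q]` that is congruent to `f`
modulo `Ĩ_n`. -/
def staircaseProj {k : Type*} [CommRing k] {n : ℕ} (f : XRing k n) : XRing k n :=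
  if h : ∃ g ∈ staircaseSpan k n, f - g ∈ quantumIdeal k n then h.choose else 0

/-- The series `∑_w t_w S̃_w(x)` in the variables `t_w`. -/
def schubertSum (n : ℕ) : MvPowerSeries (Equiv.Perm (Fin n)) (XRing ℚ n) :=
  ∑ w : Equiv.Perm (Fin n), MvPowerSeries.C (quantumSchubert ℚ w) * MvPowerSeries.X w

/-- The substitution of `schubertSum` into a power series is legitimate. -/
theorem hasSubst_schubertSum (n : ℕ) : PowerSeries.HasSubst (schubertSum n) :=
  PowerSeries.HasSubst.of_constantCoeff_zero (by simp [schubertSum])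

/-- The series `exp(∑_w t_w S̃_w(x))`. -/
def expSchubert (n : ℕ) : MvPowerSeries (Equiv.Perm (Fin n)) (XRing ℚ n) :=
  (PowerSeries.exp ℚ).subst (schubertSum n)

/-- The kernel `K(x, t) = [exp(∑_w t_w S̃_w(x))]`; the projection is applied to the coefficients of
the monomials in `t`. -/
def kernel (n : ℕ) : MvPowerSeries (Equiv.Perm (Fin n)) (XRing ℚ n) :=
  fun m => staircaseProj (MvPowerSeries.coeff m (expSchubert n))

/-- The toy Gromov-Witten potential `F(t) = ⟨K(x, t)⟩_{Ĩ_n}`; the residue is applied to the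
coefficients of the monomials in `t`. -/
def potential (n : ℕ) : MvPowerSeries (Equiv.Perm (Fin n)) (QRing ℚ n) :=
  fun m => grothendieckResidue ℚ n (MvPowerSeries.coeff m (kernel n))

/-- The operator
`Δ_{u,w} = ∂/∂t_u ∂/∂t_w - ∑_τ c̃_{w, w₀τ}^{w₀u}(q) ∂/∂t_τ`
on power series in the variables `t` with coefficients in `ℚ[q]`. -/
def quantumOperator {n : ℕ} (u w : Equiv.Perm (Fin n))
    (G : MvPowerSeries (Equiv.Perm (Fin n)) (QRing ℚ n)) :
    MvPowerSeries (Equiv.Perm (Fin n)) (QRing ℚ n) :=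
  MvPowerSeries.pderiv (QRing ℚ n) u (MvPowerSeries.pderiv (QRing ℚ n) w G)
    - ∑ τ : Equiv.Perm (Fin n),
      MvPowerSeries.C (MvPolynomial.map (Int.castRingHom ℚ)
        (structureConstant w (Fin.revPerm * τ) (Fin.revPerm * u)))
      * MvPowerSeries.pderiv (QRing ℚ n) τ G

end FlagPotential

end

noncomputable section

namespace FlagPotential

open MvPolynomial

/-! ### Filtration of polynomials by total degree -/

section Degree

variable {σ τ R S : Type*} [CommRing R] [CommRing S]

/-- The polynomials all of whose monomials have total degree less than `d`. -/
def degLT (σ R : Type*) [CommRing R] (d : ℕ) : Submodule R (MvPolynomial σ R) :=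
  restrictSupport R {m | m.degree < d}

theorem mem_degLT {d : ℕ} {f : MvPolynomial σ R} :
    f ∈ degLT σ R d ↔ ∀ m, coeff m f ≠ 0 → m.degree < d := by
  rw [degLT, mem_restrictSupport_iff]
  constructor
  · intro h m hm
    exact h (mem_coe_support_iff_aux hm)
  · intro h m hm
    exact h m (by simpa using hm)
where
  mem_coe_support_iff_aux {m : σ →₀ ℕ} {f : MvPolynomial σ R} (hm : coeff m f ≠ 0) :
      m ∈ (↑f.support : Set (σ →₀ ℕ)) := by simpa using hm

theorem degLT_mono {d e : ℕ} (h : d ≤ e) : degLT σ R d ≤ degLT σ R e := fun _ hf =>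
  mem_degLT.2 fun m hm => (mem_degLT.1 hf m hm).trans_le h

theorem degLT_zero {f : MvPolynomial σ R} (hf : f ∈ degLT σ R 0) : f = 0 := by
  ext m
  by_contra h
  exact absurd (mem_degLT.1 hf m h) (Nat.not_lt_zero _)

theorem exists_mem_degLT (f : MvPolynomial σ R) : ∃ d, f ∈ degLT σ R d :=
  ⟨f.totalDegree + 1, mem_degLT.2 fun _ hm =>
    Nat.lt_succ_of_le (le_totalDegree (mem_support_iff.2 hm))⟩

theorem monomial_mem_degLT (m : σ →₀ ℕ) (r : R) {d : ℕ} (h : m.degree < d) :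
    monomial m r ∈ degLT σ R d := by
  classical
  refine mem_degLT.2 fun m' hm' => ?_
  rw [coeff_monomial] at hm'
  by_cases e : m = m'
  · exact e ▸ h
  · simp [e] at hm'

theorem C_mem_degLT (r : R) {d : ℕ} (h : 0 < d) : (C r : MvPolynomial σ R) ∈ degLT σ R d :=
  monomial_mem_degLT 0 r (by simpa using h)

theorem X_mem_degLT (i : σ) {d : ℕ} (h : 1 < d) : (X i : MvPolynomial σ R) ∈ degLT σ R d :=
  monomial_mem_degLT _ 1 (by simpa using h)

theorem mul_mem_degLT {d e : ℕ} {f g : MvPolynomial σ R} (hf : f ∈ degLT σ R (d + 1))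
    (hg : g ∈ degLT σ R e) : f * g ∈ degLT σ R (d + e) := by
  classical
  refine mem_degLT.2 fun m hm => ?_
  rw [coeff_mul] at hm
  obtain ⟨⟨a, b⟩, hab, h⟩ := Finset.exists_ne_zero_of_sum_ne_zero hm
  have ha := mem_degLT.1 hf a (left_ne_zero_of_mul h)
  have hb := mem_degLT.1 hg b (right_ne_zero_of_mul h)
  rw [Finset.HasAntidiagonal.mem_antidiagonal] at hab
  have : m.degree = a.degree + b.degree := by rw [← hab]; simp
  omega

theorem C_mul_mem_degLT {d : ℕ} (r : R) {f : MvPolynomial σ R} (hf : f ∈ degLT σ R d) :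
    C r * f ∈ degLT σ R d := by
  simpa using mul_mem_degLT (d := 0) (C_mem_degLT r one_pos) hf

theorem mul_mem_degLT' {d e : ℕ} {f g : MvPolynomial σ R} (hf : f ∈ degLT σ R d)
    (hg : g ∈ degLT σ R (e + 1)) : f * g ∈ degLT σ R (d + e) := by
  rw [mul_comm, add_comm]
  exact mul_mem_degLT hg hf

theorem prod_mem_degLT {ι : Type*} (s : Finset ι) (d : ι → ℕ) (f : ι → MvPolynomial σ R)
    (hf : ∀ i ∈ s, f i ∈ degLT σ R (d i + 1)) :
    ∏ i ∈ s, f i ∈ degLT σ R (∑ i ∈ s, d i + 1) := by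
  classical
  induction s using Finset.induction_on with
  | empty => simpa using C_mem_degLT (σ := σ) (1 : R) one_pos
  | insert a s ha ih =>
    rw [Finset.prod_insert ha, Finset.sum_insert ha, add_assoc]
    exact mul_mem_degLT (hf a (Finset.mem_insert_self a s))
      (ih fun i hi => hf i (Finset.mem_insert_of_mem hi))

theorem mul_sub_mul_mem_degLT {d e : ℕ} {f f' g g' : MvPolynomial σ R}
    (hf : f ∈ degLT σ R (d + 1)) (hff : f - f' ∈ degLT σ R d)
    (hg' : g' ∈ degLT σ R (e + 1)) (hgg : g - g' ∈ degLT σ R e) :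
    f * g - f' * g' ∈ degLT σ R (d + e) := by
  have h : f * g - f' * g' = f * (g - g') + (f - f') * g' := by ring
  rw [h]
  exact add_mem (mul_mem_degLT hf hgg) (mul_mem_degLT' hff hg')

theorem prod_sub_prod_mem_degLT {ι : Type*} (s : Finset ι) (d : ι → ℕ)
    (f g : ι → MvPolynomial σ R)
    (hf : ∀ i ∈ s, f i ∈ degLT σ R (d i + 1)) (hg : ∀ i ∈ s, g i ∈ degLT σ R (d i + 1))
    (hfg : ∀ i ∈ s, f i - g i ∈ degLT σ R (d i)) :
    ∏ i ∈ s, f i - ∏ i ∈ s, g i ∈ degLT σ R (∑ i ∈ s, d i) := by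
  classical
  induction s using Finset.induction_on with
  | empty => simp
  | insert a s ha ih =>
    rw [Finset.prod_insert ha, Finset.prod_insert ha, Finset.sum_insert ha]
    refine mul_sub_mul_mem_degLT (hf a (Finset.mem_insert_self a s))
      (hfg a (Finset.mem_insert_self a s))
      (prod_mem_degLT _ _ _ fun i hi => hg i (Finset.mem_insert_of_mem hi))
      (ih (fun i hi => hf i (Finset.mem_insert_of_mem hi))
        (fun i hi => hg i (Finset.mem_insert_of_mem hi))
        (fun i hi => hfg i (Finset.mem_insert_of_mem hi)))

theorem pow_mem_degLT {d : ℕ} {f : MvPolynomial σ R} (hf : f ∈ degLT σ R (d + 1)) (k : ℕ) :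
    f ^ k ∈ degLT σ R (k * d + 1) := by
  simpa using prod_mem_degLT (Finset.range k) (fun _ => d) (fun _ => f) (fun _ _ => hf)

theorem pow_sub_pow_mem_degLT {d : ℕ} {f g : MvPolynomial σ R} (hf : f ∈ degLT σ R (d + 1))
    (hg : g ∈ degLT σ R (d + 1)) (hfg : f - g ∈ degLT σ R d) (k : ℕ) :
    f ^ k - g ^ k ∈ degLT σ R (k * d) := by
  simpa using prod_sub_prod_mem_degLT (Finset.range k) (fun _ => d) (fun _ => f) (fun _ => g)
    (fun _ _ => hf) (fun _ _ => hg) (fun _ _ => hfg)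

theorem degLT_induction {d : ℕ} {p : MvPolynomial σ R → Prop} (h0 : p 0)
    (hadd : ∀ f g, p f → p g → p (f + g)) (hmon : ∀ m r, m.degree < d → p (monomial m r))
    {f : MvPolynomial σ R} (hf : f ∈ degLT σ R d) : p f := by
  rw [f.as_sum]
  exact Finset.sum_induction _ p hadd h0 fun m hm =>
    hmon m _ (mem_degLT.1 hf m (mem_support_iff.1 hm))

theorem eval₂_mem_degLT {φ : R →+* S} {a : σ → MvPolynomial τ S}
    (ha : ∀ i, a i ∈ degLT τ S 2) {d : ℕ} {f : MvPolynomial σ R} (hf : f ∈ degLT σ R d) :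
    eval₂ (C.comp φ) a f ∈ degLT τ S d := by
  refine degLT_induction (p := fun f => eval₂ (C.comp φ) a f ∈ degLT τ S d) (by simp)
    (fun f g hf hg => by simpa using add_mem hf hg) (fun m r hm => ?_) hf
  rw [eval₂_monomial]
  refine C_mul_mem_degLT _ (degLT_mono hm ?_)
  exact prod_mem_degLT m.support (fun i => m i) (fun i => a i ^ m i)
    (fun i _ => by simpa using pow_mem_degLT (ha i) (m i))

theorem coeff_zero_of_mem_degLT {d : ℕ} {f : MvPolynomial σ R} (hf : f ∈ degLT σ R d)
    {m : σ →₀ ℕ} (hm : d ≤ m.degree) : coeff m f = 0 := by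
  by_contra h
  exact absurd (mem_degLT.1 hf m h) (by omega)

theorem mem_degLT_of_linear_mul [IsDomain R] {l : MvPolynomial σ R} (hl : l.totalDegree = 1)
    {d : ℕ} {g : MvPolynomial σ R} (h : l * g ∈ degLT σ R (d + 1)) : g ∈ degLT σ R d := by
  by_cases hg : g = 0
  · rw [hg]; exact zero_mem _
  have hl0 : l ≠ 0 := by rintro rfl; simp at hl
  have h1 := totalDegree_mul_of_isDomain hl0 hg
  have h2 : (l * g).totalDegree < d + 1 := by
    obtain ⟨m, hm, hm'⟩ := exists_mem_support_totalDegree_eq hl0 hg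
    rw [← hm']
    exact mem_degLT.1 h m (mem_support_iff.1 hm)
  refine mem_degLT.2 fun m hm => ?_
  have := le_totalDegree (mem_support_iff.2 hm)
  change m.degree ≤ _ at this
  omega
where
  exists_mem_support_totalDegree_eq {l g : MvPolynomial σ R} (hl : l ≠ 0) (hg : g ≠ 0) :
      ∃ m ∈ (l * g).support, m.degree = (l * g).totalDegree := by
    obtain ⟨m, hm, h⟩ := Finset.exists_mem_eq_sup (l * g).support
      (support_nonempty.2 (mul_ne_zero hl hg)) (fun m => m.degree)
    exact ⟨m, hm, h.symm⟩

instance [Finite σ] (d : ℕ) : Module.Finite R (degLT σ R d) := by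
  have : Finite {m : σ →₀ ℕ | m.degree < d} := by
    cases nonempty_fintype σ
    refine Set.Finite.to_subtype (((Set.Finite.pi' fun _ => Set.finite_le_nat d).preimage
      DFunLike.coe_injective.injOn).subset fun m hm i => ?_)
    exact (Finsupp.le_degree i m).trans (le_of_lt hm)
  exact Module.Finite.of_basis (basisRestrictSupport R _)

/-! Divided differences lower degrees by one. -/

theorem homogeneousComponent_mul_of_isHomogeneous {l : MvPolynomial σ R} {e : ℕ}
    (hl : l.IsHomogeneous e) (g : MvPolynomial σ R) (d : ℕ) :
    homogeneousComponent (e + d) (l * g) = l * homogeneousComponent d g := by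
  conv_lhs => rw [← sum_homogeneousComponent g]
  rw [Finset.mul_sum, map_sum]
  have h : ∀ i, homogeneousComponent (e + d) (l * homogeneousComponent i g)
      = if i = d then l * homogeneousComponent d g else 0 := by
    intro i
    have hi : l * homogeneousComponent i g ∈ homogeneousSubmodule σ R (e + i) :=
      hl.mul (homogeneousComponent_isHomogeneous i g)
    rw [homogeneousComponent_of_mem hi]
    by_cases hid : i = d
    · simp [hid]
    · simp [hid, Ne.symm hid]
  simp only [h, Finset.sum_ite_eq', Finset.mem_range]
  split_ifs with hd
  · rfl
  · rw [homogeneousComponent_eq_zero _ _ (by omega), mul_zero]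

theorem X_sub_X_ne_zero [Nontrivial R] {i j : σ} (h : i ≠ j) :
    (X i - X j : MvPolynomial σ R) ≠ 0 :=
  sub_ne_zero.2 fun e => h (X_injective e)

theorem homogeneousComponent_divDiff [DecidableEq σ] [IsDomain R] {i j : σ} (h : i ≠ j)
    (f : MvPolynomial σ R) (d : ℕ) :
    homogeneousComponent d (divDiff i j f) = divDiff i j (homogeneousComponent (d + 1) f) := by
  apply mul_left_cancel₀ (X_sub_X_ne_zero (R := R) h)
  rw [mul_divDiff, ← homogeneousComponent_mul_of_isHomogeneous
    ((isHomogeneous_X R i).sub (isHomogeneous_X R j)), mul_divDiff, map_sub, add_comm 1 d,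
    rename_homogeneousComponent]

end Degree

/-! ### Algebra of divided differences -/

section DivDiff

variable {σ R S : Type*} [DecidableEq σ] [CommRing R] [CommRing S] [IsDomain R] [IsDomain S]
  {i j : σ}

theorem divDiff_eq_of_mul_eq (h : i ≠ j) {f g : MvPolynomial σ R}
    (hg : (X i - X j) * g = f - rename (Equiv.swap i j) f) : divDiff i j f = g :=
  mul_left_cancel₀ (X_sub_X_ne_zero (R := R) h) ((mul_divDiff i j f).trans hg.symm)

theorem divDiff_add (h : i ≠ j) (f g : MvPolynomial σ R) :
    divDiff i j (f + g) = divDiff i j f + divDiff i j g :=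
  divDiff_eq_of_mul_eq h (by rw [mul_add, mul_divDiff, mul_divDiff, map_add]; ring)

theorem divDiff_mul_of_rename_eq (h : i ≠ j) {s : MvPolynomial σ R}
    (hs : rename (Equiv.swap i j) s = s) (f : MvPolynomial σ R) :
    divDiff i j (s * f) = s * divDiff i j f :=
  divDiff_eq_of_mul_eq h (by rw [mul_left_comm, mul_divDiff, map_mul, hs]; ring)

theorem divDiff_of_rename_eq (h : i ≠ j) {f : MvPolynomial σ R}
    (hf : rename (Equiv.swap i j) f = f) : divDiff i j f = 0 :=
  divDiff_eq_of_mul_eq h (by rw [hf]; ring)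

theorem divDiff_C_mul (h : i ≠ j) (r : R) (f : MvPolynomial σ R) :
    divDiff i j (C r * f) = C r * divDiff i j f :=
  divDiff_mul_of_rename_eq h (by simp) f

/-- The divided difference as a linear map. -/
def divDiffLin (h : i ≠ j) : MvPolynomial σ R →ₗ[R] MvPolynomial σ R where
  toFun := divDiff i j
  map_add' := divDiff_add h
  map_smul' r f := by simp only [smul_eq_C_mul, divDiff_C_mul h, RingHom.id_apply]

theorem divDiff_zero (h : i ≠ j) : divDiff i j (0 : MvPolynomial σ R) = 0 :=
  (divDiffLin h).map_zero

theorem divDiff_sub (h : i ≠ j) (f g : MvPolynomial σ R) :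
    divDiff i j (f - g) = divDiff i j f - divDiff i j g :=
  (divDiffLin h).map_sub f g

omit [IsDomain R] in
theorem map_divDiff (h : i ≠ j) (φ : R →+* S) (f : MvPolynomial σ R) :
    map φ (divDiff i j f) = divDiff i j (map φ f) := by
  refine (divDiff_eq_of_mul_eq h ?_).symm
  have := congrArg (map φ) (mul_divDiff i j f)
  simpa [map_rename] using this

theorem divDiff_mem_degLT (h : i ≠ j) {d : ℕ} {f : MvPolynomial σ R}
    (hf : f ∈ degLT σ R (d + 1)) : divDiff i j f ∈ degLT σ R d := by
  refine mem_degLT_of_linear_mul (l := X i - X j) ?_ (d := d) ?_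
  · refine le_antisymm ?_ (Nat.one_le_iff_ne_zero.2 fun h0 => ?_)
    · exact ((isHomogeneous_X R i).sub (isHomogeneous_X R j)).totalDegree_le
    · rw [((isHomogeneous_X R i).sub (isHomogeneous_X R j)).totalDegree (X_sub_X_ne_zero h)] at h0
      exact one_ne_zero h0
  · rw [mul_divDiff]
    refine sub_mem hf ?_
    rw [rename_eq_eval₂]
    exact eval₂_mem_degLT (φ := RingHom.id R) (fun k => X_mem_degLT _ (by omega)) hf
where
  rename_eq_eval₂ {τ : Type _} {e : σ → τ} {f : MvPolynomial σ R} :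
      rename e f = eval₂ ((C : R →+* MvPolynomial τ R).comp (RingHom.id R)) (fun k => X (e k)) f := by
    rw [rename_eq_aeval]; rfl

end DivDiff

/-! ### The three-term recursion -/

section Recursion

variable {S : Type*} [CommRing S]

/-- The tridiagonal determinants for sequences indexed by all natural numbers, defined by their
three-term recursion. -/
def qDelta (x q : ℕ → S) : ℕ → S → S
  | 0, _ => 1
  | 1, t => x 0 + t
  | k + 2, t => (x (k + 1) + t) * qDelta x q (k + 1) t + q k * qDelta x q k t

/-- The tridiagonal matrix entry. -/
def triEntry (x q : ℕ → S) (t : S) (i j : ℕ) : S :=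
  if i = j then x i + t else if i + 1 = j then q i else if j + 1 = i then -1 else 0

/-- The leading principal `k × k` block of the tridiagonal matrix. -/
def triMatrix (x q : ℕ → S) (t : S) (k : ℕ) : Matrix (Fin k) (Fin k) S :=
  Matrix.of fun i j => triEntry x q t i j

theorem det_triMatrix_add_two (x q : ℕ → S) (t : S) (k : ℕ) :
    (triMatrix x q t (k + 2)).det =
      (x (k + 1) + t) * (triMatrix x q t (k + 1)).det + q k * (triMatrix x q t k).det := by
  have hlast : ∀ i : Fin (k + 1), (((Fin.last (k + 1)).succAbove i : Fin (k + 2)) : ℕ) = i := by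
    intro i; simp
  have hpen1 : ∀ i : Fin k, (((Fin.last k).castSucc.succAbove i.castSucc : Fin (k + 2)) : ℕ) = i := by
    intro i
    rw [Fin.succAbove_of_castSucc_lt _ _ (by simp [Fin.lt_def])]
    simp
  have hpen2 : (((Fin.last k).castSucc.succAbove (Fin.last k) : Fin (k + 2)) : ℕ) = k + 1 := by
    rw [Fin.succAbove_of_le_castSucc _ _ (by simp)]
    simp
  have hminor : ((triMatrix x q t (k + 2)).submatrix (Fin.last (k + 1)).succAbove
      (Fin.last k).castSucc.succAbove).det = q k * (triMatrix x q t k).det := by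
    rw [Matrix.det_succ_column _ (Fin.last k), Fin.sum_univ_castSucc, Finset.sum_eq_zero, zero_add]
    · have hsub : (((triMatrix x q t (k + 2)).submatrix (Fin.last (k + 1)).succAbove
          (Fin.last k).castSucc.succAbove).submatrix (Fin.last k).succAbove
          (Fin.last k).succAbove) = triMatrix x q t k := by
        ext i j
        simp only [Matrix.submatrix_apply, triMatrix, Matrix.of_apply,
          Fin.succAbove_last, hpen1, Fin.val_castSucc]
      rw [hsub]
      simp only [Matrix.submatrix_apply, triMatrix, Matrix.of_apply, hlast, hpen2, Fin.val_last]
      rw [← two_mul, pow_mul]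
      simp [triEntry]
    · intro i _
      simp only [Matrix.submatrix_apply, triMatrix, Matrix.of_apply, hlast, hpen2,
        Fin.val_castSucc]
      have hi := i.2
      rw [triEntry, if_neg (by omega), if_neg (by omega), if_neg (by omega)]
      simp
  rw [Matrix.det_succ_row _ (Fin.last (k + 1)), Fin.sum_univ_castSucc, Fin.sum_univ_castSucc,
    Finset.sum_eq_zero, zero_add, hminor]
  · have hsub : ((triMatrix x q t (k + 2)).submatrix (Fin.last (k + 1)).succAbove
        (Fin.last (k + 1)).succAbove) = triMatrix x q t (k + 1) := by
      ext i j
      simp only [Matrix.submatrix_apply, triMatrix, Matrix.of_apply, hlast]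
    rw [hsub]
    simp only [triMatrix, Matrix.of_apply, Fin.val_last, Fin.val_castSucc]
    have h1 : triEntry x q t (k + 1) k = -1 := by
      rw [triEntry, if_neg (by omega), if_neg (by omega), if_pos rfl]
    have h2 : triEntry x q t (k + 1) (k + 1) = x (k + 1) + t := by
      rw [triEntry, if_pos rfl]
    have h3 : ((-1 : S)) ^ (k + 1 + k) = -1 := Odd.neg_one_pow ⟨k, by ring⟩
    have h4 : ((-1 : S)) ^ (k + 1 + (k + 1)) = 1 := Even.neg_one_pow ⟨k + 1, rfl⟩
    rw [h1, h2, h3, h4]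
    ring
  · intro j _
    have hj := j.2
    simp only [triMatrix, Matrix.of_apply, Fin.val_last, Fin.val_castSucc]
    rw [triEntry, if_neg (by omega), if_neg (by omega), if_neg (by omega)]
    simp

theorem det_triMatrix (x q : ℕ → S) (t : S) :
    ∀ k, (triMatrix x q t k).det = qDelta x q k t
  | 0 => by simp [qDelta]
  | 1 => by simp [qDelta, triMatrix, triEntry]
  | k + 2 => by
    rw [det_triMatrix_add_two, det_triMatrix x q t (k + 1), det_triMatrix x q t k, qDelta]

theorem quantumDelta_eq (x q : ℕ → S) (k : ℕ) (t : S) :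
    quantumDelta k (fun i => x i) (fun i => q i) t = qDelta x q k t := by
  rw [← det_triMatrix]
  refine congrArg Matrix.det ?_
  ext i j
  simp only [triMatrix, triEntry, Matrix.of_apply, Fin.ext_iff]
  split_ifs <;> rfl

theorem map_qDelta {S' : Type*} [CommRing S'] (φ : S →+* S') (x q : ℕ → S) (t : S) :
    ∀ k, φ (qDelta x q k t) = qDelta (fun i => φ (x i)) (fun i => φ (q i)) k (φ t)
  | 0 => by simp [qDelta]
  | 1 => by simp [qDelta]
  | k + 2 => by simp [qDelta, map_qDelta φ x q t (k + 1), map_qDelta φ x q t k]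

end Recursion

/-! ### The variables as sequences, and leading terms -/

section Leading

variable {σ R : Type*} [CommRing R]

theorem qDelta_C_mem_degLT {x : ℕ → MvPolynomial σ R} (q : ℕ → R) (t : R)
    (hx : ∀ i, x i ∈ degLT σ R 2) :
    ∀ k, qDelta x (fun i => C (q i)) k (C t) ∈ degLT σ R (k + 1)
  | 0 => C_mem_degLT 1 one_pos
  | 1 => add_mem (hx 0) (C_mem_degLT t two_pos)
  | k + 2 => by
    rw [qDelta]
    refine add_mem ?_ (C_mul_mem_degLT _ (degLT_mono (by omega) (qDelta_C_mem_degLT q t hx k)))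
    exact degLT_mono (by omega) (mul_mem_degLT (d := 1)
      (add_mem (hx _) (C_mem_degLT t two_pos)) (qDelta_C_mem_degLT q t hx (k + 1)))

theorem qDelta_C_sub_prod_mem_degLT {x : ℕ → MvPolynomial σ R} (q : ℕ → R) (t : R)
    (hx : ∀ i, x i ∈ degLT σ R 2) :
    ∀ k, qDelta x (fun i => C (q i)) k (C t) - ∏ j ∈ Finset.range k, x j ∈ degLT σ R k
  | 0 => by simp [qDelta]
  | 1 => by simpa [qDelta] using C_mem_degLT (σ := σ) t one_pos
  | k + 2 => by
    rw [qDelta, Finset.prod_range_succ, mul_comm _ (x (k + 1)), add_sub_right_comm]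
    refine add_mem ?_ (C_mul_mem_degLT _ (degLT_mono (by omega) (qDelta_C_mem_degLT q t hx k)))
    rw [show k + 2 = 1 + (k + 1) by omega]
    refine mul_sub_mul_mem_degLT (add_mem (hx _) (C_mem_degLT t two_pos)) ?_ ?_
      (qDelta_C_sub_prod_mem_degLT q t hx (k + 1))
    · simpa using C_mem_degLT (σ := σ) t one_pos
    · simpa using prod_mem_degLT (Finset.range (k + 1)) (fun _ => 1) x (fun i _ => hx i)

/-- The polynomials in `t` over `R[x]` of joint degree less than `d`. -/
def jointLT (σ R : Type*) [CommRing R] (d : ℕ) :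
    AddSubgroup (Polynomial (MvPolynomial σ R)) where
  carrier := {f | ∀ c, f.coeff c ∈ degLT σ R (d - c)}
  add_mem' hf hg c := by rw [Polynomial.coeff_add]; exact add_mem (hf c) (hg c)
  zero_mem' c := by simp
  neg_mem' hf c := by rw [Polynomial.coeff_neg]; exact neg_mem (hf c)

theorem jointLT_mono {d e : ℕ} (h : d ≤ e) : jointLT σ R d ≤ jointLT σ R e :=
  fun _ hf c => degLT_mono (Nat.sub_le_sub_right h c) (hf c)

theorem C_add_X_mul_mem_jointLT {a : MvPolynomial σ R} (ha : a ∈ degLT σ R 2) {d : ℕ}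
    {f : Polynomial (MvPolynomial σ R)} (hf : f ∈ jointLT σ R d) :
    (Polynomial.C a + Polynomial.X) * f ∈ jointLT σ R (d + 1) := by
  intro c
  rw [add_mul, Polynomial.coeff_add, Polynomial.coeff_C_mul]
  refine add_mem ?_ ?_
  · by_cases hc : c ≤ d
    · exact degLT_mono (by omega) (mul_mem_degLT (d := 1) ha (hf c))
    · have := hf c
      rw [Nat.sub_eq_zero_of_le (by omega)] at this
      rw [degLT_zero this, mul_zero]
      exact zero_mem _
  · cases c with
    | zero => simp
    | succ c =>
      rw [Polynomial.coeff_X_mul]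
      exact degLT_mono (by omega) (hf c)

theorem C_C_mul_mem_jointLT (a : R) {d : ℕ}
    {f : Polynomial (MvPolynomial σ R)} (hf : f ∈ jointLT σ R d) :
    Polynomial.C (C a) * f ∈ jointLT σ R d := by
  intro c
  rw [Polynomial.coeff_C_mul]
  exact C_mul_mem_degLT a (hf c)

theorem one_mem_jointLT : (1 : Polynomial (MvPolynomial σ R)) ∈ jointLT σ R 1 := by
  intro c
  cases c with
  | zero => simpa using C_mem_degLT (σ := σ) (1 : R) one_pos
  | succ c => simp [Polynomial.coeff_one]

theorem qDelta_X_mem_jointLT {x : ℕ → MvPolynomial σ R} (q : ℕ → R)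
    (hx : ∀ i, x i ∈ degLT σ R 2) :
    ∀ k, qDelta (fun i => Polynomial.C (x i)) (fun i => Polynomial.C (C (q i))) k Polynomial.X
      ∈ jointLT σ R (k + 1)
  | 0 => one_mem_jointLT
  | 1 => by simpa [qDelta] using C_add_X_mul_mem_jointLT (hx 0) one_mem_jointLT
  | k + 2 => by
    rw [qDelta]
    exact add_mem (C_add_X_mul_mem_jointLT (hx _) (qDelta_X_mem_jointLT q hx (k + 1)))
      (C_C_mul_mem_jointLT _ (jointLT_mono (by omega) (qDelta_X_mem_jointLT q hx k)))

theorem qDelta_X_sub_prod_mem_jointLT {x : ℕ → MvPolynomial σ R} (q : ℕ → R)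
    (hx : ∀ i, x i ∈ degLT σ R 2) :
    ∀ k, qDelta (fun i => Polynomial.C (x i)) (fun i => Polynomial.C (C (q i))) k Polynomial.X
      - ∏ j ∈ Finset.range k, (Polynomial.X + Polynomial.C (x j)) ∈ jointLT σ R k
  | 0 => by simp [qDelta]
  | 1 => by simp [qDelta, add_comm]
  | k + 2 => by
    rw [qDelta, Finset.prod_range_succ, mul_comm _ (Polynomial.X + _), add_sub_right_comm,
      add_comm Polynomial.X, ← mul_sub]
    exact add_mem (C_add_X_mul_mem_jointLT (hx _) (qDelta_X_sub_prod_mem_jointLT q hx (k + 1)))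
      (C_C_mul_mem_jointLT _ (jointLT_mono (by omega) (qDelta_X_mem_jointLT q hx k)))

end Leading

section Variables

variable (k : Type*) [CommRing k] (n : ℕ)

/-- The variables `x₁, …, x_n`, continued by zeros. -/
def xSeq (i : ℕ) : XRing k n := if h : i < n then X ⟨i, h⟩ else 0

/-- The variables `q₁, …, q_{n-1}`, continued by zeros. -/
def qSeq (i : ℕ) : QRing k n := if h : i < n - 1 then X ⟨i, h⟩ else 0

theorem xSeq_of_lt {i : ℕ} (h : i < n) : xSeq k n i = X ⟨i, h⟩ := dif_pos h

theorem xSeq_mem_degLT (i : ℕ) : xSeq k n i ∈ degLT (Fin n) (QRing k n) 2 := by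
  unfold xSeq
  split_ifs
  · exact X_mem_degLT _ one_lt_two
  · exact zero_mem _

/-- The polynomial `Δ_k(t | x₁, …, x_k)` over `k[q]`. -/
def xDelta (m : ℕ) (t : XRing k n) : XRing k n :=
  qDelta (xSeq k n) (fun i => C (qSeq k n i)) m t

/-- The polynomial `Δ_k(u | x₁, …, x_k)` in the outer variables `u`. -/
def xyDelta (m : ℕ) (t : XYRing k n) : XYRing k n :=
  qDelta (fun i => C (xSeq k n i)) (fun i => C (C (qSeq k n i))) m t

/-- The polynomial `Δ_n(t | x₁, …, x_n)` in the variable `t`. -/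
def charDelta : Polynomial (XRing k n) :=
  qDelta (fun i => Polynomial.C (xSeq k n i)) (fun i => Polynomial.C (C (qSeq k n i))) n
    Polynomial.X

variable {k n}

theorem quantumElem_eq (i : Fin n) :
    quantumElem k n i = (charDelta k n).coeff (n - 1 - (i : ℕ)) := by
  rw [quantumElem, charDelta, ← quantumDelta_eq]
  congr 2
  · funext j
    rw [xSeq_of_lt k n j.2]
  · funext j
    rw [qSeq, dif_pos j.2]

theorem topQuantumDoubleSchubert_eq :
    topQuantumDoubleSchubert k n =
      ∏ a : Fin (n - 1), xyDelta k n (a + 1) (X ⟨n - 2 - (a : ℕ), by omega⟩) := by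
  refine Finset.prod_congr rfl fun a _ => ?_
  rw [xyDelta, ← quantumDelta_eq]
  congr 1
  · funext j
    rw [xSeq_of_lt k n (by omega)]
  · funext j
    rw [qSeq, dif_pos (by omega)]

theorem xDelta_C_mem_degLT (m : ℕ) (t : QRing k n) :
    xDelta k n m (C t) ∈ degLT (Fin n) (QRing k n) (m + 1) :=
  qDelta_C_mem_degLT _ _ (xSeq_mem_degLT k n) _

theorem xDelta_C_sub_mem_degLT (m : ℕ) (t : QRing k n) :
    xDelta k n m (C t) - ∏ j ∈ Finset.range m, xSeq k n j ∈ degLT (Fin n) (QRing k n) m :=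
  qDelta_C_sub_prod_mem_degLT _ _ (xSeq_mem_degLT k n) _

theorem prod_X_add_C_xSeq :
    ∏ j ∈ Finset.range n, (Polynomial.X + Polynomial.C (xSeq k n j))
      = ∏ j : Fin n, (Polynomial.X + Polynomial.C (X j : XRing k n)) := by
  rw [Finset.prod_range]
  refine Finset.prod_congr rfl fun j _ => ?_
  rw [xSeq_of_lt k n j.2]

theorem esymm_eq_coeff (i : Fin n) :
    esymm (Fin n) (QRing k n) (i + 1) =
      (∏ j ∈ Finset.range n, (Polynomial.X + Polynomial.C (xSeq k n j))).coeff
        (n - 1 - (i : ℕ)) := by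
  rw [prod_X_add_C_xSeq, MvPolynomial.prod_X_add_C_coeff _ _ _ (by simp; omega)]
  congr 1
  rw [Fintype.card_fin]
  omega

theorem quantumElem_mem_degLT (i : Fin n) :
    quantumElem k n i ∈ degLT (Fin n) (QRing k n) (i + 1 + 1) := by
  rw [quantumElem_eq]
  exact degLT_mono (by omega) (qDelta_X_mem_jointLT (qSeq k n) (xSeq_mem_degLT k n) n _)

theorem quantumElem_sub_esymm_mem_degLT (i : Fin n) :
    quantumElem k n i - esymm (Fin n) (QRing k n) (i + 1) ∈ degLT (Fin n) (QRing k n) (i + 1) := by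
  rw [quantumElem_eq, esymm_eq_coeff, ← Polynomial.coeff_sub]
  exact degLT_mono (by omega) (qDelta_X_sub_prod_mem_jointLT (qSeq k n) (xSeq_mem_degLT k n) n _)

theorem esymm_mem_degLT (i : Fin n) :
    esymm (Fin n) (QRing k n) (i + 1) ∈ degLT (Fin n) (QRing k n) (i + 1 + 1) := by
  have h := sub_mem (quantumElem_mem_degLT i)
    (degLT_mono (Nat.le_succ _) (quantumElem_sub_esymm_mem_degLT (k := k) i))
  simpa using h

theorem charDelta_sub_X_pow_coeff_mem (c : ℕ) :
    (charDelta k n).coeff c - (Polynomial.X ^ n : Polynomial (XRing k n)).coeff c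
      ∈ quantumIdeal k n := by
  rcases lt_trichotomy c n with h | h | h
  · rw [Polynomial.coeff_X_pow, if_neg h.ne, sub_zero]
    have := quantumElem_eq (k := k) (⟨n - 1 - c, by omega⟩ : Fin n)
    rw [show n - 1 - (n - 1 - c) = c by omega] at this
    rw [← this]
    exact Ideal.subset_span ⟨_, rfl⟩
  · have h1 := qDelta_X_sub_prod_mem_jointLT (qSeq k n) (xSeq_mem_degLT k n) n c
    rw [h, Nat.sub_self] at h1
    have h2 := degLT_zero h1
    rw [Polynomial.coeff_sub, sub_eq_zero] at h2
    rw [h, charDelta, h2, prod_X_add_C_xSeq, Polynomial.coeff_X_pow, if_pos rfl]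
    rw [MvPolynomial.prod_X_add_C_coeff _ _ _ (by simp)]
    simp
  · have h1 := qDelta_X_mem_jointLT (qSeq k n) (xSeq_mem_degLT k n) n c
    rw [Nat.sub_eq_zero_of_le (show n + 1 ≤ c by omega)] at h1
    rw [charDelta, degLT_zero h1, Polynomial.coeff_X_pow, if_neg (by omega), sub_zero]
    exact zero_mem _

end Variables

/-! ### Staircase monomials span the polynomials over the symmetric polynomials -/

section Staircase

variable {n : ℕ} {R : Type*} [CommRing R]

/-- The largest staircase exponent `(n-1, n-2, …, 0)`. -/
def staircase (n : ℕ) : Fin n →₀ ℕ := Finsupp.equivFunOnFinite.symm fun j => n - 1 - (j : ℕ)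

@[simp]
theorem staircase_apply (j : Fin n) : staircase n j = n - 1 - (j : ℕ) := rfl

/-- The exponent of the remainder monomial of `x^α` under division by the `x_j^{n-j}`. -/
def remExp (α : Fin n →₀ ℕ) : Fin n →₀ ℕ :=
  Finsupp.equivFunOnFinite.symm fun j => α j % (n - (j : ℕ))

@[simp]
theorem remExp_apply (α : Fin n →₀ ℕ) (j : Fin n) : remExp α j = α j % (n - (j : ℕ)) := rfl

/-- The product of a staircase monomial and a monomial in `e`, indexed by an exponent via division
with remainder. -/
def stairProd (e : Fin n → MvPolynomial (Fin n) R) (α : Fin n →₀ ℕ) : MvPolynomial (Fin n) R :=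
  monomial (remExp α) 1 * ∏ j, e j.rev ^ (α j / (n - (j : ℕ)))

/-- The linear endomorphism `x^α ↦ stairProd e α`. -/
def stairMap (e : Fin n → MvPolynomial (Fin n) R) :
    MvPolynomial (Fin n) R →ₗ[R] MvPolynomial (Fin n) R :=
  (basisMonomials (Fin n) R).constr R (stairProd e)

theorem stairMap_monomial (e : Fin n → MvPolynomial (Fin n) R) (α : Fin n →₀ ℕ) (r : R) :
    stairMap e (monomial α r) = C r * stairProd e α := by
  have h : stairMap e (monomial α 1) = stairProd e α := by
    have := (basisMonomials (Fin n) R).constr_basis R (stairProd e) α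
    rwa [coe_basisMonomials] at this
  rw [← h, ← smul_eq_C_mul, ← map_smul, smul_monomial, smul_eq_mul, mul_one]

theorem degree_eq_remExp_add (α : Fin n →₀ ℕ) :
    α.degree = (remExp α).degree + ∑ j : Fin n, (α j / (n - (j : ℕ))) * ((j.rev : ℕ) + 1) := by
  rw [Finsupp.degree_eq_sum, Finsupp.degree_eq_sum, ← Finset.sum_add_distrib]
  refine Finset.sum_congr rfl fun j _ => ?_
  have : (j.rev : ℕ) + 1 = n - j := by rw [Fin.val_rev]; omega
  rw [this, remExp_apply, mul_comm]
  exact (Nat.mod_add_div _ _).symm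

theorem prod_pow_mem_degLT {e : Fin n → MvPolynomial (Fin n) R}
    (he : ∀ i : Fin n, e i ∈ degLT (Fin n) R (i + 1 + 1)) (a : Fin n → ℕ) :
    ∏ j : Fin n, e j.rev ^ a j ∈ degLT (Fin n) R (∑ j : Fin n, a j * ((j.rev : ℕ) + 1) + 1) :=
  prod_mem_degLT _ _ _ fun _ _ => pow_mem_degLT (he _) _

theorem stairProd_mem_degLT {e : Fin n → MvPolynomial (Fin n) R}
    (he : ∀ i : Fin n, e i ∈ degLT (Fin n) R (i + 1 + 1)) (α : Fin n →₀ ℕ) :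
    stairProd e α ∈ degLT (Fin n) R (α.degree + 1) := by
  rw [degree_eq_remExp_add, add_assoc]
  exact mul_mem_degLT (monomial_mem_degLT _ _ (Nat.lt_succ_self _)) (prod_pow_mem_degLT he _)

theorem stairMap_mem_degLT {e : Fin n → MvPolynomial (Fin n) R}
    (he : ∀ i : Fin n, e i ∈ degLT (Fin n) R (i + 1 + 1)) {d : ℕ} {f : MvPolynomial (Fin n) R}
    (hf : f ∈ degLT (Fin n) R d) : stairMap e f ∈ degLT (Fin n) R d := by
  refine degLT_induction (p := fun f => stairMap e f ∈ degLT (Fin n) R d) (by simp)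
    (fun f g hf hg => by simpa using add_mem hf hg) (fun m r hm => ?_) hf
  rw [stairMap_monomial]
  exact C_mul_mem_degLT _ (degLT_mono hm (stairProd_mem_degLT he m))

theorem stairMap_sub_mem_degLT {e e' : Fin n → MvPolynomial (Fin n) R}
    (he : ∀ i : Fin n, e i ∈ degLT (Fin n) R (i + 1 + 1)) (he' : ∀ i : Fin n, e' i ∈ degLT (Fin n) R (i + 1 + 1))
    (hee : ∀ i : Fin n, e i - e' i ∈ degLT (Fin n) R (i + 1)) {d : ℕ} {f : MvPolynomial (Fin n) R}
    (hf : f ∈ degLT (Fin n) R (d + 1)) :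
    stairMap e f - stairMap e' f ∈ degLT (Fin n) R d := by
  refine degLT_induction (p := fun f => stairMap e f - stairMap e' f ∈ degLT (Fin n) R d) (by simp)
    (fun f g hf hg => by
      rw [map_add, map_add, add_sub_add_comm]; exact add_mem hf hg) (fun m r hm => ?_) hf
  rw [stairMap_monomial, stairMap_monomial, ← mul_sub]
  refine C_mul_mem_degLT _ (degLT_mono (Nat.lt_succ_iff.1 hm) ?_)
  rw [degree_eq_remExp_add]
  refine mul_sub_mul_mem_degLT (monomial_mem_degLT _ _ (Nat.lt_succ_self _)) (by simp)
    (prod_pow_mem_degLT he' _) ?_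
  exact prod_sub_prod_mem_degLT _ _ _ _ (fun j _ => pow_mem_degLT (he _) _)
    (fun j _ => pow_mem_degLT (he' _) _) (fun j _ => pow_sub_pow_mem_degLT (he _) (he' _) (hee _) _)

/-- The elementary symmetric polynomials `e₁, …, e_n`. -/
def elemSym (n : ℕ) (R : Type*) [CommRing R] (i : Fin n) : MvPolynomial (Fin n) R :=
  esymm (Fin n) R (i + 1)

theorem isHomogeneous_stairProd_elemSym (α : Fin n →₀ ℕ) :
    (stairProd (elemSym n R) α).IsHomogeneous α.degree := by
  rw [degree_eq_remExp_add]
  refine (isHomogeneous_monomial _ rfl).mul (IsHomogeneous.prod _ _ _ fun j _ => ?_)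
  rw [mul_comm]
  exact (isHomogeneous_esymm' _).pow _
where
  isHomogeneous_esymm' (i : ℕ) : (esymm (Fin n) R i).IsHomogeneous i := by
    rw [esymm]
    refine IsHomogeneous.sum _ _ _ fun s hs => ?_
    have h := IsHomogeneous.prod s (fun i => (X i : MvPolynomial (Fin n) R)) (fun _ => 1)
      (fun i _ => isHomogeneous_X R i)
    rw [Finset.mem_powersetCard] at hs
    simpa [hs.2] using h

theorem homogeneousComponent_stairMap (d : ℕ) (f : MvPolynomial (Fin n) R) :
    homogeneousComponent d (stairMap (elemSym n R) f) =
      stairMap (elemSym n R) (homogeneousComponent d f) := by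
  induction f using MvPolynomial.induction_on' with
  | monomial α r =>
    have h1 : monomial α r ∈ homogeneousSubmodule (Fin n) R α.degree :=
      isHomogeneous_monomial r rfl
    have h2 : C r * stairProd (elemSym n R) α ∈ homogeneousSubmodule (Fin n) R α.degree :=
      (isHomogeneous_stairProd_elemSym α).C_mul r
    rw [stairMap_monomial, homogeneousComponent_of_mem h1, homogeneousComponent_of_mem h2]
    split_ifs
    · rw [stairMap_monomial]
    · simp
  | add p q hp hq => simp only [map_add, hp, hq]

/-- The subalgebra generated by the elementary symmetric polynomials and the first `j`
variables. -/
def symAdjoin (n : ℕ) (R : Type*) [CommRing R] (j : ℕ) : Subalgebra R (MvPolynomial (Fin n) R) :=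
  Algebra.adjoin R (Set.range (elemSym n R) ∪ {f | ∃ i : Fin n, (i : ℕ) < j ∧ f = X i})

theorem symAdjoin_mono {i j : ℕ} (h : i ≤ j) : symAdjoin n R i ≤ symAdjoin n R j :=
  Algebra.adjoin_mono (Set.union_subset_union_right _ fun _ ⟨i, hi, hf⟩ => ⟨i, hi.trans_le h, hf⟩)

/-- The polynomial `∏_{i ≥ j} (t + x_i)`. -/
def tailPoly (n : ℕ) (R : Type*) [CommRing R] (j : ℕ) : Polynomial (MvPolynomial (Fin n) R) :=
  ∏ i ∈ Finset.univ.filter (fun i : Fin n => j ≤ (i : ℕ)), (Polynomial.X + Polynomial.C (X i))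

theorem tailPoly_monic (j : ℕ) : (tailPoly n R j).Monic :=
  Polynomial.monic_prod_of_monic _ _ fun _ _ => Polynomial.monic_X_add_C _

theorem tailPoly_eq_mul {j : ℕ} (hj : j < n) :
    tailPoly n R j = (Polynomial.X + Polynomial.C (X ⟨j, hj⟩)) * tailPoly n R (j + 1) := by
  have h : Finset.univ.filter (fun i : Fin n => j ≤ (i : ℕ)) =
      insert ⟨j, hj⟩ (Finset.univ.filter fun i : Fin n => j + 1 ≤ (i : ℕ)) := by
    ext i
    simp only [Finset.mem_filter, Finset.mem_univ, true_and, Finset.mem_insert, Fin.ext_iff]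
    omega
  rw [tailPoly, tailPoly, h, Finset.prod_insert (by simp)]

theorem natDegree_tailPoly [Nontrivial R] (j : ℕ) : (tailPoly n R j).natDegree = n - j := by
  rw [tailPoly, Polynomial.natDegree_prod_of_monic _ _ fun _ _ => Polynomial.monic_X_add_C _]
  simp only [Polynomial.natDegree_X_add_C, Finset.sum_const, smul_eq_mul, mul_one]
  rw [Fin.card_filter_val_ge_aux]
where
  Fin.card_filter_val_ge_aux : (Finset.univ.filter fun i : Fin n => j ≤ (i : ℕ)).card = n - j := by
    rw [← Finset.card_map Fin.valEmbedding, ← Nat.card_Ico j n]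
    congr 1
    ext i
    simp only [Finset.mem_map, Finset.mem_filter, Finset.mem_univ, true_and,
      Fin.valEmbedding_apply, Finset.mem_Ico]
    exact ⟨fun ⟨a, ha, e⟩ => ⟨e ▸ ha, e ▸ a.2⟩, fun h => ⟨⟨i, h.2⟩, h.1, rfl⟩⟩

theorem coeff_tailPoly_mem (j : ℕ) (hj : j ≤ n) (c : ℕ) :
    (tailPoly n R j).coeff c ∈ symAdjoin n R j := by
  induction j generalizing c with
  | zero =>
    have h0 : tailPoly n R 0 = ∏ i : Fin n, (Polynomial.X + Polynomial.C (X i)) := by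
      simp [tailPoly]
    rw [h0]
    by_cases hc : c ≤ n
    · rw [MvPolynomial.prod_X_add_C_coeff _ _ _ (by simpa using hc), Fintype.card_fin]
      rcases hc.eq_or_lt with rfl | hc
      · simp
      · refine Algebra.subset_adjoin (Or.inl ⟨⟨n - c - 1, by omega⟩, ?_⟩)
        rw [elemSym]
        congr 1
        simp only
        omega
    · rw [Polynomial.coeff_eq_zero_of_natDegree_lt]
      · exact zero_mem _
      · refine ((Polynomial.natDegree_prod_le _ _).trans
          (Finset.sum_le_card_nsmul _ _ 1 fun i _ => ?_)).trans_lt (by simpa using hc)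
        compute_degree
  | succ j ih =>
    have hj' : j < n := hj
    have key : ∀ m c, (tailPoly n R (j + 1)).natDegree + 1 ≤ c + m →
        (tailPoly n R (j + 1)).coeff c ∈ symAdjoin n R (j + 1) := by
      intro m
      induction m with
      | zero =>
        intro c hc
        rw [Polynomial.coeff_eq_zero_of_natDegree_lt (by omega)]
        exact zero_mem _
      | succ m ihm =>
        intro c hc
        have h1 : (tailPoly n R (j + 1)).coeff c =
            (tailPoly n R j).coeff (c + 1) - X ⟨j, hj'⟩ * (tailPoly n R (j + 1)).coeff (c + 1) := by
          rw [tailPoly_eq_mul hj', add_mul, Polynomial.coeff_add, Polynomial.coeff_X_mul,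
            Polynomial.coeff_C_mul]
          ring
        rw [h1]
        refine sub_mem (symAdjoin_mono (Nat.le_succ j) (ih hj'.le _)) (mul_mem ?_ (ihm _ (by omega)))
        exact Algebra.subset_adjoin (Or.inr ⟨⟨j, hj'⟩, Nat.lt_succ_self j, rfl⟩)
    exact key _ c (Nat.le_add_left _ _)
theorem exists_eq_sum_of_mem_symAdjoin [Nontrivial R] {j : ℕ} (hj : j < n)
    {f : MvPolynomial (Fin n) R} (hf : f ∈ symAdjoin n R (j + 1)) :
    ∃ c : ℕ → MvPolynomial (Fin n) R, (∀ i, c i ∈ symAdjoin n R j) ∧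
      f = ∑ i ∈ Finset.range (n - j), c i * X ⟨j, hj⟩ ^ i := by
  set x : MvPolynomial (Fin n) R := X ⟨j, hj⟩ with hx
  have hle : symAdjoin n R (j + 1) ≤
      ((Polynomial.aeval (R := symAdjoin n R j) (-x)).range).restrictScalars R := by
    refine Algebra.adjoin_le ?_
    have hB : ∀ b ∈ symAdjoin n R j,
        b ∈ (Polynomial.aeval (R := symAdjoin n R j) (-x)).range := fun b hb =>
      ⟨Polynomial.C ⟨b, hb⟩, by simp⟩
    rintro _ (⟨i, rfl⟩ | ⟨i, hi, rfl⟩)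
    · exact hB _ (Algebra.subset_adjoin (Or.inl ⟨i, rfl⟩))
    · rcases Nat.lt_succ_iff_lt_or_eq.1 hi with h | h
      · exact hB _ (Algebra.subset_adjoin (Or.inr ⟨i, h, rfl⟩))
      · refine ⟨-Polynomial.X, ?_⟩
        have : i = ⟨j, hj⟩ := Fin.ext h
        simp [hx, this]
  obtain ⟨g, rfl⟩ := hle hf
  have hlift : tailPoly n R j ∈ Polynomial.lifts (algebraMap (symAdjoin n R j) _) := by
    rw [Polynomial.lifts_iff_coeff_lifts]
    intro c
    exact ⟨⟨_, coeff_tailPoly_mem j hj.le c⟩, rfl⟩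
  obtain ⟨p, hp, hdeg, hmonic⟩ :=
    Polynomial.lifts_and_natDegree_eq_and_monic hlift (tailPoly_monic j)
  have hroot : Polynomial.aeval (-x) p = 0 := by
    rw [Polynomial.aeval_def, ← Polynomial.eval_map, hp, tailPoly_eq_mul hj]
    simp [hx]
  have hmod : Polynomial.aeval (-x) g = Polynomial.aeval (-x) (g %ₘ p) := by
    conv_lhs => rw [← Polynomial.modByMonic_add_div g p]
    simp [hroot]
  have hlt : (g %ₘ p).natDegree < n - j := by
    rw [← natDegree_tailPoly (R := R) (n := n) j, ← hdeg]
    refine Polynomial.natDegree_modByMonic_lt g hmonic ?_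
    rintro rfl
    have := natDegree_tailPoly (R := R) (n := n) j
    rw [← hdeg, Polynomial.natDegree_one] at this
    omega
  refine ⟨fun i => (-1) ^ i * ((g %ₘ p).coeff i : MvPolynomial (Fin n) R), fun i => ?_, ?_⟩
  · exact mul_mem (pow_mem (neg_mem (one_mem _)) _) ((g %ₘ p).coeff i).2
  · change Polynomial.aeval (-x) g = _
    rw [hmod, Polynomial.aeval_eq_sum_range' hlt]
    refine Finset.sum_congr rfl fun i _ => ?_
    rw [neg_pow, Algebra.smul_def]
    change (_ : MvPolynomial (Fin n) R) * _ = _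
    rw [← mul_assoc, mul_comm _ ((-1) ^ i)]
    rfl

/-- The span over the symmetric polynomials of the staircase monomials in the first `j`
variables. -/
def stairSpan (n : ℕ) (R : Type*) [CommRing R] (j : ℕ) : Submodule R (MvPolynomial (Fin n) R) :=
  Submodule.span R {g | ∃ m : Fin n →₀ ℕ, (∀ i, m i < n - (i : ℕ)) ∧
    (∀ i : Fin n, j ≤ (i : ℕ) → m i = 0) ∧ ∃ s ∈ symAdjoin n R 0, g = monomial m 1 * s}

theorem mem_stairSpan_of_mem_symAdjoin [Nontrivial R] (j : ℕ) (hj : j ≤ n)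
    {f : MvPolynomial (Fin n) R} (hf : f ∈ symAdjoin n R j) : f ∈ stairSpan n R j := by
  induction j generalizing f with
  | zero =>
    refine Submodule.subset_span ⟨0, fun i => by simp, fun _ _ => rfl, f, hf, ?_⟩
    simp
  | succ j ih =>
    obtain ⟨c, hc, rfl⟩ := exists_eq_sum_of_mem_symAdjoin hj hf
    refine sum_mem fun i hi => ?_
    rw [Finset.mem_range] at hi
    have key : stairSpan n R j ≤ (stairSpan n R (j + 1)).comap
        (LinearMap.mulRight R (X ⟨j, hj⟩ ^ i)) := by
      refine Submodule.span_le.2 ?_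
      rintro _ ⟨m, hm, hm0, s, hs, rfl⟩
      refine Submodule.subset_span ⟨m + Finsupp.single ⟨j, hj⟩ i, ?_, ?_, s, hs, ?_⟩
      · intro l
        by_cases hl : l = ⟨j, hj⟩
        · subst hl
          rw [Finsupp.add_apply, hm0 _ le_rfl, Finsupp.single_eq_same, zero_add]
          exact hi
        · rw [Finsupp.add_apply, Finsupp.single_eq_of_ne hl]
          exact hm l
      · intro l hl
        have hl' : l ≠ ⟨j, hj⟩ := fun e => by rw [e] at hl; simp at hl
        rw [Finsupp.add_apply, Finsupp.single_eq_of_ne hl', add_zero]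
        exact hm0 l (Nat.le_of_succ_le hl)
      · rw [LinearMap.mulRight_apply, mul_right_comm, X_pow_eq_monomial, monomial_mul, one_mul]
    exact key (ih (Nat.le_of_succ_le hj) (hc i))

theorem stairMap_elemSym_surjective [Nontrivial R] :
    Function.Surjective (stairMap (elemSym n R)) := by
  rw [← LinearMap.range_eq_top, eq_top_iff]
  intro f _
  have htop : f ∈ symAdjoin n R n := by
    have : (⊤ : Subalgebra R (MvPolynomial (Fin n) R)) ≤ symAdjoin n R n := by
      rw [← adjoin_range_X]
      refine Algebra.adjoin_le ?_
      rintro _ ⟨i, rfl⟩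
      exact Algebra.subset_adjoin (Or.inr ⟨i, i.2, rfl⟩)
    exact this trivial
  refine Submodule.span_le.2 ?_ (mem_stairSpan_of_mem_symAdjoin n le_rfl htop)
  rintro _ ⟨m, hm, -, s, hs, rfl⟩
  have hs' : s ∈ (aeval (elemSym n R) : MvPolynomial (Fin n) R →ₐ[R] _).range := by
    rw [← Algebra.adjoin_range_eq_range_aeval]
    refine Algebra.adjoin_mono ?_ hs
    rintro _ (h | ⟨i, hi, -⟩)
    · exact h
    · exact absurd hi (Nat.not_lt_zero _)
  obtain ⟨p, rfl⟩ := hs'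
  clear hs
  change monomial m 1 * aeval (elemSym n R) p ∈ LinearMap.range (stairMap (elemSym n R))
  induction p using MvPolynomial.induction_on' with
  | monomial a r =>
    let α : Fin n →₀ ℕ := Finsupp.equivFunOnFinite.symm fun j => m j + (n - (j : ℕ)) * a j.rev
    have hα : ∀ j, α j = m j + (n - (j : ℕ)) * a j.rev := fun _ => rfl
    refine ⟨monomial α r, ?_⟩
    have h1 : remExp α = m := by
      ext j
      rw [remExp_apply, hα, Nat.add_mul_mod_self_left, Nat.mod_eq_of_lt (hm j)]
    rw [stairMap_monomial, stairProd, h1, aeval_monomial, Finsupp.prod_fintype _ _ (by simp)]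
    have h2 : ∏ j, elemSym n R (Fin.rev j) ^ (α j / (n - (j : ℕ))) = ∏ j, elemSym n R j ^ a j := by
      rw [← Equiv.prod_comp Fin.revPerm]
      refine Finset.prod_congr rfl fun j _ => ?_
      have hj := (j.rev).2
      rw [hα, Fin.revPerm_apply, Fin.rev_rev, Nat.add_mul_div_left _ _ (by omega),
        Nat.div_eq_of_lt (hm _), zero_add]
    rw [h2, algebraMap_eq]
    ring
  | add p q hp hq =>
    rw [map_add, mul_add]
    exact add_mem hp hq

theorem exists_stairMap_eq [Nontrivial R] {e : Fin n → MvPolynomial (Fin n) R}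
    (he : ∀ i : Fin n, e i ∈ degLT (Fin n) R (i + 1 + 1))
    (hs : ∀ i : Fin n, elemSym n R i ∈ degLT (Fin n) R (i + 1 + 1))
    (hes : ∀ i : Fin n, e i - elemSym n R i ∈ degLT (Fin n) R (i + 1)) (d : ℕ)
    {f : MvPolynomial (Fin n) R} (hf : f ∈ degLT (Fin n) R d) :
    ∃ g ∈ degLT (Fin n) R d, stairMap e g = f := by
  induction d generalizing f with
  | zero => exact ⟨0, zero_mem _, by rw [degLT_zero hf, map_zero]⟩
  | succ d ih =>
    obtain ⟨g₀, hg₀⟩ := stairMap_elemSym_surjective f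
    have hmem : ∀ h : MvPolynomial (Fin n) R, homogeneousComponent d h ∈ degLT (Fin n) R (d + 1) := by
      refine fun h => mem_degLT.2 fun m hm => ?_
      rw [coeff_homogeneousComponent] at hm
      by_contra hlt
      rw [if_neg (by omega)] at hm
      exact hm rfl
    have hf' : f - homogeneousComponent d f ∈ degLT (Fin n) R d := by
      refine mem_degLT.2 fun m hm => ?_
      by_contra hlt
      rw [coeff_sub, coeff_homogeneousComponent] at hm
      by_cases hd : m.degree = d
      · rw [if_pos hd, sub_self] at hm
        exact hm rfl
      · rw [if_neg hd, sub_zero] at hm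
        have := mem_degLT.1 hf m hm
        omega
    have h1 : stairMap (elemSym n R) (homogeneousComponent d g₀) = homogeneousComponent d f := by
      rw [← homogeneousComponent_stairMap, hg₀]
    obtain ⟨g₁, hg₁, h2⟩ := ih (f := f - stairMap e (homogeneousComponent d g₀)) (by
      have h3 := sub_mem hf' (stairMap_sub_mem_degLT he hs hes (hmem g₀))
      rw [h1] at h3
      simpa using h3)
    refine ⟨g₁ + homogeneousComponent d g₀, add_mem (degLT_mono (Nat.le_succ d) hg₁) (hmem _), ?_⟩
    rw [map_add, h2]
    ring

theorem stairMap_injective [Nontrivial R] {e : Fin n → MvPolynomial (Fin n) R}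
    (he : ∀ i : Fin n, e i ∈ degLT (Fin n) R (i + 1 + 1))
    (hs : ∀ i : Fin n, elemSym n R i ∈ degLT (Fin n) R (i + 1 + 1))
    (hes : ∀ i : Fin n, e i - elemSym n R i ∈ degLT (Fin n) R (i + 1)) :
    Function.Injective (stairMap e) := by
  rw [injective_iff_map_eq_zero]
  intro f hf
  obtain ⟨d, hd⟩ := exists_mem_degLT f
  let φ : degLT (Fin n) R d →ₗ[R] degLT (Fin n) R d :=
    (stairMap e).restrict fun _ h => stairMap_mem_degLT he h
  have hφ : Function.Surjective φ := by
    rintro ⟨g, hg⟩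
    obtain ⟨g', hg', h⟩ := exists_stairMap_eq he hs hes d hg
    exact ⟨⟨g', hg'⟩, Subtype.ext h⟩
  have hinj := OrzechProperty.injective_of_surjective_endomorphism φ hφ
  have h0 : φ ⟨f, hd⟩ = φ 0 := by
    rw [map_zero]
    exact Subtype.ext hf
  exact congrArg Subtype.val (hinj h0)

theorem stairMap_mul_X_pow (e : Fin n → MvPolynomial (Fin n) R) (j : Fin n)
    (f : MvPolynomial (Fin n) R) :
    stairMap e (f * X j ^ (n - (j : ℕ))) = stairMap e f * e j.rev := by
  classical
  induction f using MvPolynomial.induction_on' with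
  | monomial α r =>
    rw [X_pow_eq_monomial, monomial_mul, mul_one, stairMap_monomial, stairMap_monomial,
      stairProd, stairProd]
    have hj : 0 < n - (j : ℕ) := by have := j.2; omega
    have h1 : remExp (α + Finsupp.single j (n - (j : ℕ))) = remExp α := by
      ext l
      rw [remExp_apply, remExp_apply, Finsupp.add_apply]
      by_cases hl : l = j
      · subst hl; rw [Finsupp.single_eq_same, Nat.add_mod_right]
      · rw [Finsupp.single_eq_of_ne hl, add_zero]
    have h2 : ∏ l : Fin n, e l.rev ^ ((α + Finsupp.single j (n - (j : ℕ))) l / (n - (l : ℕ)))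
        = (∏ l : Fin n, e l.rev ^ (α l / (n - (l : ℕ)))) * e j.rev := by
      rw [← Finset.mul_prod_erase _ _ (Finset.mem_univ j),
        ← Finset.mul_prod_erase (a := j) _ (fun l : Fin n => e l.rev ^ (α l / (n - (l : ℕ))))
          (Finset.mem_univ j), Finsupp.add_apply, Finsupp.single_eq_same,
        Nat.add_div_right _ hj, pow_succ]
      rw [mul_right_comm]
      congr 2
      refine Finset.prod_congr rfl fun l hl => ?_
      rw [Finsupp.add_apply, Finsupp.single_eq_of_ne (Finset.ne_of_mem_erase hl), add_zero]
    rw [h1, h2]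
    ring
  | add p q hp hq => rw [add_mul, map_add, hp, hq, map_add, add_mul]

theorem stairMap_monomial_of_lt (e : Fin n → MvPolynomial (Fin n) R) {m : Fin n →₀ ℕ}
    (hm : ∀ i : Fin n, m i < n - (i : ℕ)) (r : R) : stairMap e (monomial m r) = monomial m r := by
  have h1 : remExp m = m := by
    ext j
    rw [remExp_apply, Nat.mod_eq_of_lt (hm j)]
  rw [stairMap_monomial, stairProd, h1, Finset.prod_eq_one fun j _ => by
    rw [Nat.div_eq_of_lt (hm j), pow_zero], mul_one, C_mul_monomial, mul_one]

end Staircase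

/-! ### The top-coefficient functional modulo the quantum ideal -/

section TopForm

variable (k : Type*) [CommRing k] [IsDomain k] (n : ℕ)

/-- The `k[q]`-linear automorphism of `k[q][x]` that sends the monomial ideal
`(x₁^n, x₂^{n-1}, …, x_n)` to the quantum ideal. -/
def stairEquiv : XRing k n ≃ₗ[QRing k n] XRing k n :=
  LinearEquiv.ofBijective (stairMap (quantumElem k n))
    ⟨stairMap_injective quantumElem_mem_degLT esymm_mem_degLT quantumElem_sub_esymm_mem_degLT,
      fun f => by
        obtain ⟨d, hd⟩ := exists_mem_degLT f
        obtain ⟨g, -, hg⟩ := exists_stairMap_eq quantumElem_mem_degLT esymm_mem_degLT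
          quantumElem_sub_esymm_mem_degLT d hd
        exact ⟨g, hg⟩⟩

/-- The functional that takes the coefficient of `x^δ` in the normal form modulo the quantum
ideal. -/
def topForm : XRing k n →ₗ[QRing k n] QRing k n :=
  lcoeff (QRing k n) (staircase n) ∘ₗ (stairEquiv k n).symm.toLinearMap

variable {k n}

theorem stairEquiv_apply (f : XRing k n) : stairEquiv k n f = stairMap (quantumElem k n) f := rfl

theorem topForm_stairMap (f : XRing k n) :
    topForm k n (stairMap (quantumElem k n) f) = coeff (staircase n) f := by
  rw [← stairEquiv_apply, topForm, LinearMap.comp_apply, LinearEquiv.coe_coe,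
    LinearEquiv.symm_apply_apply]
  rfl

theorem exists_stairMap_eq' (f : XRing k n) : ∃ g, stairMap (quantumElem k n) g = f :=
  ⟨(stairEquiv k n).symm f, (stairEquiv k n).apply_symm_apply f⟩

theorem topForm_of_mem_quantumIdeal {f : XRing k n} (hf : f ∈ quantumIdeal k n) :
    topForm k n f = 0 := by
  classical
  obtain ⟨c, rfl⟩ := Ideal.mem_span_range_iff_exists_fun.1 hf
  rw [map_sum]
  refine Finset.sum_eq_zero fun i _ => ?_
  obtain ⟨g, hg⟩ := exists_stairMap_eq' (c i)
  have h := stairMap_mul_X_pow (quantumElem k n) i.rev g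
  rw [Fin.rev_rev, hg] at h
  rw [← h, topForm_stairMap, X_pow_eq_monomial, coeff_mul_monomial', if_neg]
  intro hle
  have := hle i.rev
  rw [Finsupp.single_eq_same, staircase_apply] at this
  have := i.rev.2
  omega

theorem topForm_of_mem_degLT {f : XRing k n}
    (hf : f ∈ degLT (Fin n) (QRing k n) (staircase n).degree) : topForm k n f = 0 := by
  obtain ⟨g, hg, rfl⟩ := exists_stairMap_eq quantumElem_mem_degLT esymm_mem_degLT
    quantumElem_sub_esymm_mem_degLT _ hf
  rw [topForm_stairMap]
  exact coeff_zero_of_mem_degLT hg le_rfl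

theorem topForm_monomial_staircase : topForm k n (monomial (staircase n) 1) = 1 := by
  have h := stairMap_monomial_of_lt (quantumElem k n) (m := staircase n)
    (fun i => by rw [staircase_apply]; have := i.2; omega) 1
  rw [← h, topForm_stairMap, coeff_monomial, if_pos rfl]

theorem exists_mem_staircaseSpan (f : XRing k n) :
    ∃ g ∈ staircaseSpan k n, f - g ∈ quantumIdeal k n := by
  obtain ⟨h, rfl⟩ := exists_stairMap_eq' f
  induction h using MvPolynomial.induction_on' with
  | monomial α r =>
    by_cases hα : ∀ j : Fin n, α j < n - (j : ℕ)
    · refine ⟨monomial α r, ?_, ?_⟩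
      · have : monomial α r = r • (monomial α 1 : XRing k n) := by simp [smul_monomial]
        rw [this]
        refine Submodule.smul_mem _ _ (Submodule.subset_span ⟨α, fun j => ?_, rfl⟩)
        have := hα j
        omega
      · rw [stairMap_monomial_of_lt _ hα, sub_self]
        exact zero_mem _
    · push Not at hα
      obtain ⟨j, hj⟩ := hα
      refine ⟨0, zero_mem _, ?_⟩
      have : α = α - Finsupp.single j (n - (j : ℕ)) + Finsupp.single j (n - (j : ℕ)) :=
        (tsub_add_cancel_of_le (Finsupp.single_le_iff.2 hj)).symm
      rw [sub_zero, this, ← mul_one r, ← monomial_mul, ← X_pow_eq_monomial, stairMap_mul_X_pow]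
      exact Ideal.mul_mem_left _ _ (Ideal.subset_span ⟨_, rfl⟩)
  | add p q hp hq =>
    obtain ⟨g, hg, hpg⟩ := hp
    obtain ⟨g', hg', hqg⟩ := hq
    refine ⟨g + g', add_mem hg hg', ?_⟩
    rw [map_add, add_sub_add_comm]
    exact add_mem hpg hqg

theorem staircaseProj_sub_mem (f : XRing k n) : f - staircaseProj f ∈ quantumIdeal k n := by
  classical
  have h := exists_mem_staircaseSpan f
  rw [staircaseProj, dif_pos h]
  exact h.choose_spec.2

omit [IsDomain k] in
theorem prod_prod_xSeq :
    ∏ j ∈ Finset.range n, ∏ i ∈ Finset.range j, xSeq k n i = monomial (staircase n) 1 := by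
  have h : ∏ j ∈ Finset.range n, ∏ i ∈ Finset.range j, xSeq k n i
      = ∏ i ∈ Finset.range n, xSeq k n i ^ (n - 1 - i) := by
    rw [Finset.prod_comm' (t' := Finset.range n) (s' := fun i => Finset.Ico (i + 1) n)]
    · refine Finset.prod_congr rfl fun i _ => ?_
      rw [Finset.prod_const, Nat.card_Ico, Nat.sub_sub, add_comm 1 i]
    · intro i j
      simp only [Finset.mem_range, Finset.mem_Ico]
      omega
  rw [h, Finset.prod_range, monomial_eq, C_1, one_mul, Finsupp.prod_fintype _ _ (by simp)]
  refine Finset.prod_congr rfl fun i _ => ?_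
  rw [xSeq_of_lt k n i.2, staircase_apply]

theorem sum_range_eq_degree_staircase : ∑ j ∈ Finset.range n, j = (staircase n).degree := by
  rw [Finsupp.degree_eq_sum, ← Finset.sum_range_reflect, Finset.sum_range]
  rfl

theorem topForm_prod_xDelta (p : ℕ → QRing k n) :
    topForm k n (∏ j ∈ Finset.range n, xDelta k n j (C (p j))) = 1 := by
  have h := prod_sub_prod_mem_degLT (Finset.range n) (fun j => j)
    (fun j => xDelta k n j (C (p j))) (fun j => ∏ i ∈ Finset.range j, xSeq k n i)
    (fun j _ => xDelta_C_mem_degLT j _)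
    (fun j _ => by
      simpa using prod_mem_degLT (Finset.range j) (fun _ => 1) (xSeq k n)
        (fun i _ => xSeq_mem_degLT k n i))
    (fun j _ => xDelta_C_sub_mem_degLT j _)
  rw [sum_range_eq_degree_staircase] at h
  have h' := topForm_of_mem_degLT h
  rwa [map_sub, prod_prod_xSeq, topForm_monomial_staircase, sub_eq_zero] at h'

end TopForm

/-! ### Coefficientwise application of functionals -/

section Contract

variable {k : Type*} [CommRing k] {n : ℕ} (r : XRing k n →ₗ[QRing k n] QRing k n)

theorem coeff_contract (B : XYRing k n) (m : Fin n →₀ ℕ) :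
    coeff m (contract r B) = r (coeff m B) := by
  classical
  change coeff m (∑ m' ∈ B.support, monomial m' (r (coeff m' B))) = _
  simp only [coeff_sum, coeff_monomial]
  rw [Finset.sum_ite_eq']
  split_ifs with h
  · rfl
  · rw [notMem_support_iff.1 h, map_zero]

theorem contract_add (A B : XYRing k n) : contract r (A + B) = contract r A + contract r B := by
  ext m
  simp only [coeff_contract, coeff_add, map_add]

theorem contract_zero : contract r 0 = 0 := by
  ext m
  simp only [coeff_contract, coeff_zero, map_zero]

theorem contract_sub (A B : XYRing k n) : contract r (A - B) = contract r A - contract r B := by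
  ext m
  simp only [coeff_contract, coeff_sub, map_sub]

theorem contract_sum {ι : Type*} (s : Finset ι) (A : ι → XYRing k n) :
    contract r (∑ i ∈ s, A i) = ∑ i ∈ s, contract r (A i) := by
  ext m
  simp only [coeff_contract, coeff_sum, map_sum]

theorem contract_monomial (m : Fin n →₀ ℕ) (a : XRing k n) :
    contract r (monomial m a) = monomial m (r a) := by
  classical
  ext m'
  simp only [coeff_contract, coeff_monomial]
  split_ifs <;> simp

theorem contract_map_C_mul (g : XRing k n) (B : XYRing k n) :
    contract r (map C g * B) = g * contract r B := by
  induction g using MvPolynomial.induction_on' with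
  | monomial a c =>
    induction B using MvPolynomial.induction_on' with
    | monomial b d =>
      rw [map_monomial, monomial_mul, contract_monomial, contract_monomial, monomial_mul,
        ← smul_eq_C_mul, map_smul, smul_eq_mul]
    | add p q hp hq => rw [mul_add, contract_add, hp, hq, contract_add, mul_add]
  | add p q hp hq => rw [map_add, add_mul, contract_add, hp, hq, add_mul]

theorem contract_C_C_mul (c : QRing k n) (B : XYRing k n) :
    contract r (C (C c) * B) = C c * contract r B := by
  rw [← contract_map_C_mul, map_C]

theorem contract_rename (e : Fin n → Fin n) (B : XYRing k n) :
    contract r (rename e B) = rename e (contract r B) := by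
  induction B using MvPolynomial.induction_on' with
  | monomial b d => rw [rename_monomial, contract_monomial, contract_monomial, rename_monomial]
  | add p q hp hq => rw [map_add, contract_add, hp, hq, contract_add, map_add]

theorem contract_divDiff [IsDomain k] {i j : Fin n} (h : i ≠ j) (B : XYRing k n) :
    contract r (divDiff i j B) = divDiff i j (contract r B) := by
  refine (divDiff_eq_of_mul_eq h ?_).symm
  rw [← contract_map_C_mul, ← contract_rename, ← contract_sub, ← mul_divDiff]
  simp

theorem eval_contract (p : Fin n → QRing k n) (B : XYRing k n) :
    eval p (contract r B) = r (eval (fun i => C (p i)) B) := by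
  induction B using MvPolynomial.induction_on' with
  | monomial b d =>
    rw [contract_monomial, eval_monomial, eval_monomial]
    have : (b.prod fun i e => (C (p i) : XRing k n) ^ e) = C (b.prod fun i e => p i ^ e) := by
      simp [Finsupp.prod]
    rw [this, mul_comm d, ← smul_eq_C_mul, map_smul, smul_eq_mul, mul_comm]
  | add p q hp hq => rw [contract_add, map_add, hp, hq, map_add, map_add]

end Contract

/-! ### The ideal of symmetric polynomials without constant term -/

section SymIdeal

variable {n : ℕ} {R : Type*} [CommRing R]

/-- The ideal generated by the symmetric polynomials without constant term. -/
def symIdeal (n : ℕ) (R : Type*) [CommRing R] : Ideal (MvPolynomial (Fin n) R) :=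
  Ideal.span {f | f.IsSymmetric ∧ eval (fun _ => 0) f = 0}

theorem divDiff_mem_symIdeal [IsDomain R] {i j : Fin n} (h : i ≠ j) {f : MvPolynomial (Fin n) R}
    (hf : f ∈ symIdeal n R) : divDiff i j f ∈ symIdeal n R := by
  refine Submodule.span_induction (p := fun f _ => ∀ g, divDiff i j (g * f) ∈ symIdeal n R)
    ?_ ?_ ?_ ?_ hf 1 |> fun h => by simpa using h
  · rintro s ⟨hs, hs0⟩ g
    rw [mul_comm, divDiff_mul_of_rename_eq h (hs _)]
    exact Ideal.mul_mem_right _ _ (Ideal.subset_span ⟨hs, hs0⟩)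
  · intro g
    rw [mul_zero, divDiff_zero h]
    exact zero_mem _
  · intro a b _ _ ha hb g
    rw [mul_add, divDiff_add h]
    exact add_mem (ha g) (hb g)
  · intro c a _ ha g
    rw [smul_eq_mul, ← mul_assoc]
    exact ha _

theorem eval_zero_of_mem_symIdeal {f : MvPolynomial (Fin n) R} (hf : f ∈ symIdeal n R) :
    eval (fun _ => 0) f = 0 := by
  have : symIdeal n R ≤ RingHom.ker (eval (fun _ : Fin n => (0 : R))) :=
    Ideal.span_le.2 fun _ h => h.2
  exact this hf

theorem X_pow_mem_symIdeal (i : Fin n) : (X i : MvPolynomial (Fin n) R) ^ n ∈ symIdeal n R := by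
  have h := congrArg (Polynomial.eval (-X i)) (prod_C_add_X_eq_sum_esymm R (Fin n))
  rw [Polynomial.eval_prod, Finset.prod_eq_zero (Finset.mem_univ i) (by simp),
    Polynomial.eval_finsetSum, Finset.sum_range_succ', Fintype.card_fin] at h
  simp only [Polynomial.eval_mul, Polynomial.eval_C, Polynomial.eval_pow, Polynomial.eval_X,
    esymm_zero, one_mul, Nat.sub_zero] at h
  have h2 : (-X i : MvPolynomial (Fin n) R) ^ n ∈ symIdeal n R := by
    rw [eq_neg_of_add_eq_zero_right h.symm]
    refine neg_mem (sum_mem fun j _ => Ideal.mul_mem_right _ _ (Ideal.subset_span ⟨?_, ?_⟩))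
    · exact esymm_isSymmetric _ _ _
    · rw [esymm, map_sum]
      refine Finset.sum_eq_zero fun s hs => ?_
      rw [map_prod]
      obtain ⟨a, ha⟩ : s.Nonempty := by
        rw [← Finset.card_pos, (Finset.mem_powersetCard.1 hs).2]
        omega
      exact Finset.prod_eq_zero ha (by simp)
  rw [neg_pow] at h2
  have h3 := Ideal.mul_mem_left _ ((-1) ^ n) h2
  rwa [← mul_assoc, ← mul_pow, neg_one_mul, neg_neg, one_pow, one_mul] at h3

/-- The polynomials of degree less than `d` modulo symmetric polynomials without constant term. -/
def symDegLT (n : ℕ) (R : Type*) [CommRing R] (d : ℕ) : Submodule R (MvPolynomial (Fin n) R) :=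
  (symIdeal n R).restrictScalars R ⊔ degLT (Fin n) R d

theorem C_mul_mem_symDegLT {d : ℕ} (c : R) {f : MvPolynomial (Fin n) R}
    (hf : f ∈ symDegLT n R d) : C c * f ∈ symDegLT n R d := by
  rw [← smul_eq_C_mul]
  exact Submodule.smul_mem _ _ hf

/-- A system of congruences `v l ≡ ∂ (w l)`, where the `w l` are combinations of the `v l`, has
only the trivial solution, because divided differences lower degrees. -/
theorem mem_symIdeal_of_system [IsDomain R] {ι : Type*} (s : Finset ι)
    (v : ι → MvPolynomial (Fin n) R)
    (h : ∀ l ∈ s, ∃ (i j : Fin n) (_ : i ≠ j) (w : MvPolynomial (Fin n) R),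
      v l - divDiff i j w ∈ symIdeal n R ∧
      ∀ d, (∀ l' ∈ s, v l' ∈ symDegLT n R d) → w ∈ symDegLT n R d) :
    ∀ l ∈ s, v l ∈ symIdeal n R := by
  have key : ∀ d, (∀ l ∈ s, v l ∈ symDegLT n R d) → ∀ l ∈ s, v l ∈ symIdeal n R := by
    intro d
    induction d with
    | zero =>
      intro hd l hl
      obtain ⟨a, ha, b, hb, hab⟩ := Submodule.mem_sup.1 (hd l hl)
      rw [← hab, degLT_zero hb, add_zero]
      exact ha
    | succ d ih =>
      refine fun hd => ih fun l hl => ?_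
      obtain ⟨i, j, hij, w, hw, hdeg⟩ := h l hl
      obtain ⟨a, ha, b, hb, hab⟩ := Submodule.mem_sup.1 (hdeg (d + 1) hd)
      have : v l = (v l - divDiff i j w) + divDiff i j a + divDiff i j b := by
        rw [← hab, divDiff_add hij]
        ring
      rw [this]
      exact Submodule.mem_sup.2 ⟨_, add_mem hw (divDiff_mem_symIdeal hij ha), _,
        divDiff_mem_degLT hij hb, rfl⟩
  choose d hd using fun l => exists_mem_degLT (v l)
  exact key (s.sup d) fun l hl =>
    Submodule.mem_sup_right (degLT_mono (Finset.le_sup hl) (hd l))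

end SymIdeal

/-! ### Level products -/

section Levels

variable {k : Type*} [CommRing k] {n : ℕ}

/-- The sequence `q` shifted by one, with value `0` at `0`. -/
def qPrev {S : Type*} [Zero S] (q : ℕ → S) : ℕ → S
  | 0 => 0
  | m + 1 => q m

theorem qDelta_succ {S : Type*} [CommRing S] (x q : ℕ → S) (m : ℕ) (t : S) :
    qDelta x q (m + 1) t =
      (x m + t) * qDelta x q m t + qPrev q m * qDelta x q (m - 1) t := by
  cases m with
  | zero => simp [qDelta, qPrev]
  | succ m => rfl

variable (k n) in
/-- The coefficient `q_{m-1}` of the recursion for `Δ_{m+1}`. -/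
def qCoef (m : ℕ) : QRing k n := qPrev (qSeq k n) m

theorem xDelta_succ (m : ℕ) (t : XRing k n) :
    xDelta k n (m + 1) t =
      (xSeq k n m + t) * xDelta k n m t + C (qCoef k n m) * xDelta k n (m - 1) t := by
  rw [xDelta, qDelta_succ]
  cases m <;> simp [qPrev, qCoef, xDelta]

theorem xyDelta_succ (m : ℕ) (t : XYRing k n) :
    xyDelta k n (m + 1) t =
      (C (xSeq k n m) + t) * xyDelta k n m t + C (C (qCoef k n m)) * xyDelta k n (m - 1) t := by
  rw [xyDelta, qDelta_succ]
  cases m <;> simp [qPrev, qCoef, xyDelta]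

theorem xyDelta_mul_xyDelta (m : ℕ) (t s : XYRing k n) :
    (t - s) * (xyDelta k n m t * xyDelta k n m s) =
      (xyDelta k n (m + 1) t * xyDelta k n m s - xyDelta k n (m + 1) s * xyDelta k n m t)
      + C (C (qCoef k n m)) * (xyDelta k n m t * xyDelta k n (m - 1) s
        - xyDelta k n m s * xyDelta k n (m - 1) t) := by
  rw [xyDelta_succ, xyDelta_succ]; ring

/-- The index of the variable `u_j = y_{n-j}`. -/
def uIdx (n j : ℕ) (h : j < n) : Fin n := ⟨n - 1 - j, by omega⟩

theorem uIdx_injective {i j : ℕ} {hi : i < n} {hj : j < n} (h : uIdx n i hi = uIdx n j hj) :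
    i = j := by
  have := congrArg Fin.val h
  simp only [uIdx] at this
  omega

/-- The variables `u_j`, continued by zeros. -/
def uVar (n : ℕ) (S : Type*) [CommRing S] (j : ℕ) : MvPolynomial (Fin n) S :=
  if h : j < n then X (uIdx n j h) else 0

theorem uVar_of_lt {S : Type*} [CommRing S] {j : ℕ} (h : j < n) :
    uVar n S j = X (uIdx n j h) := dif_pos h

theorem map_uVar {S S' : Type*} [CommRing S] [CommRing S'] (φ : S →+* S') (j : ℕ) :
    map φ (uVar n S j) = uVar n S' j := by
  unfold uVar
  split_ifs <;> simp

/-- The transposition of `u_{j+1}` and `u_j`. -/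
def uSwap (n j : ℕ) (h : j + 1 < n) : Equiv.Perm (Fin n) :=
  Equiv.swap (uIdx n (j + 1) h) (uIdx n j (Nat.lt_of_succ_lt h))

theorem uIdx_succ_ne {j : ℕ} (h : j + 1 < n) :
    uIdx n (j + 1) h ≠ uIdx n j (Nat.lt_of_succ_lt h) := fun e => by
  have := uIdx_injective e
  omega

theorem rename_uSwap_uVar_left {S : Type*} [CommRing S] {j : ℕ} (h : j + 1 < n) :
    rename (uSwap n j h) (uVar n S j) = uVar n S (j + 1) := by
  rw [uVar_of_lt (Nat.lt_of_succ_lt h), uVar_of_lt h, rename_X, uSwap, Equiv.swap_apply_right]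

theorem rename_uSwap_uVar_right {S : Type*} [CommRing S] {j : ℕ} (h : j + 1 < n) :
    rename (uSwap n j h) (uVar n S (j + 1)) = uVar n S j := by
  rw [uVar_of_lt (Nat.lt_of_succ_lt h), uVar_of_lt h, rename_X, uSwap, Equiv.swap_apply_left]

theorem rename_uSwap_uVar_of_ne {S : Type*} [CommRing S] {j i : ℕ} (h : j + 1 < n) (h1 : i ≠ j)
    (h2 : i ≠ j + 1) : rename (uSwap n j h) (uVar n S i) = uVar n S i := by
  by_cases hi : i < n
  · rw [uVar_of_lt hi, rename_X, uSwap, Equiv.swap_apply_of_ne_of_ne]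
    · exact fun e => h2 (uIdx_injective e)
    · exact fun e => h1 (uIdx_injective e)
  · rw [uVar, dif_neg hi, map_zero]

/-- The divided difference with respect to `u_{j+1}` and `u_j`. -/
def uDiff {S : Type*} [CommRing S] (j : ℕ) (h : j + 1 < n) (f : MvPolynomial (Fin n) S) :
    MvPolynomial (Fin n) S :=
  divDiff (uIdx n (j + 1) h) (uIdx n j (Nat.lt_of_succ_lt h)) f

theorem uDiff_eq_of_mul_eq {S : Type*} [CommRing S] [IsDomain S] {j : ℕ} (h : j + 1 < n)
    {f g : MvPolynomial (Fin n) S}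
    (hg : (uVar n S (j + 1) - uVar n S j) * g = f - rename (uSwap n j h) f) :
    uDiff j h f = g := by
  rw [uVar_of_lt h, uVar_of_lt (Nat.lt_of_succ_lt h)] at hg
  exact divDiff_eq_of_mul_eq (uIdx_succ_ne h) hg

theorem mul_uDiff {S : Type*} [CommRing S] {j : ℕ} (h : j + 1 < n)
    (f : MvPolynomial (Fin n) S) :
    (uVar n S (j + 1) - uVar n S j) * uDiff j h f = f - rename (uSwap n j h) f := by
  rw [uVar_of_lt h, uVar_of_lt (Nat.lt_of_succ_lt h)]
  exact mul_divDiff _ _ f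

theorem rename_xyDelta (e : Fin n → Fin n) (m : ℕ) (t : XYRing k n) :
    rename e (xyDelta k n m t) = xyDelta k n m (rename e t) := by
  have := map_qDelta (S := XYRing k n) (S' := XYRing k n)
    (rename e : XYRing k n →ₐ[XRing k n] XYRing k n).toRingHom
    (fun i => C (xSeq k n i)) (fun i => C (C (qSeq k n i))) t m
  simpa [xyDelta] using this

variable (k n) in
/-- The product of the `Δ_{s j}(u_j | x)`. -/
def levelProd (s : ℕ → ℕ) : XYRing k n := ∏ j ∈ Finset.range n, xyDelta k n (s j) (uVar n _ j)

theorem levelProd_eq_mul (s : ℕ → ℕ) {j : ℕ} (h : j < n) :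
    levelProd k n s = (∏ i ∈ (Finset.range n).erase j, xyDelta k n (s i) (uVar n _ i))
      * xyDelta k n (s j) (uVar n _ j) := by
  rw [mul_comm]
  exact (Finset.mul_prod_erase _ _ (Finset.mem_range.2 h)).symm

theorem levelProd_eq_mul_mul (s : ℕ → ℕ) {j : ℕ} (h : j + 1 < n) :
    levelProd k n s =
      (∏ i ∈ ((Finset.range n).erase j).erase (j + 1), xyDelta k n (s i) (uVar n _ i))
      * (xyDelta k n (s (j + 1)) (uVar n _ (j + 1)) * xyDelta k n (s j) (uVar n _ j)) := by
  rw [levelProd_eq_mul s (Nat.lt_of_succ_lt h), ← Finset.mul_prod_erase _ _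
    (Finset.mem_erase.2 ⟨Nat.succ_ne_self j, Finset.mem_range.2 h⟩)]
  ring

/-- Two adjacent equal levels can be separated by a divided difference. -/
theorem levelProd_exchange [IsDomain k] {s s₁ s₂ : ℕ → ℕ} {j c : ℕ} (h : j + 1 < n)
    (hj : s j = c) (hj' : s (j + 1) = c)
    (h₁ : ∀ i, i ≠ j + 1 → s₁ i = s i) (h₁' : s₁ (j + 1) = c + 1)
    (h₂ : ∀ i, i ≠ j → s₂ i = s i) (h₂' : s₂ j = c - 1) :
    levelProd k n s =
      uDiff j h (levelProd k n s₁ + C (C (qCoef k n c)) * levelProd k n s₂) := by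
  refine (uDiff_eq_of_mul_eq h ?_).symm
  rw [levelProd_eq_mul_mul s h, levelProd_eq_mul_mul s₁ h, levelProd_eq_mul_mul s₂ h]
  set A := ∏ i ∈ ((Finset.range n).erase j).erase (j + 1), xyDelta k n (s i) (uVar n _ i) with hA
  have hmem : ∀ i ∈ ((Finset.range n).erase j).erase (j + 1), i ≠ j ∧ i ≠ j + 1 := fun i hi =>
    ⟨Finset.ne_of_mem_erase (Finset.mem_of_mem_erase hi), Finset.ne_of_mem_erase hi⟩
  have e1 : ∏ i ∈ ((Finset.range n).erase j).erase (j + 1), xyDelta k n (s₁ i) (uVar n _ i) = A :=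
    Finset.prod_congr rfl fun i hi => by rw [h₁ i (hmem i hi).2]
  have e2 : ∏ i ∈ ((Finset.range n).erase j).erase (j + 1), xyDelta k n (s₂ i) (uVar n _ i) = A :=
    Finset.prod_congr rfl fun i hi => by rw [h₂ i (hmem i hi).1]
  have hsym : rename (uSwap n j h) A = A := by
    rw [hA, map_prod]
    refine Finset.prod_congr rfl fun i hi => ?_
    rw [rename_xyDelta, rename_uSwap_uVar_of_ne h (hmem i hi).1 (hmem i hi).2]
  rw [e1, e2, hj, hj', h₁ j (Nat.succ_ne_self j).symm, hj, h₁', h₂', h₂ _ (Nat.succ_ne_self j), hj']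
  simp only [map_add, map_mul, rename_C, hsym, rename_xyDelta, rename_uSwap_uVar_left,
    rename_uSwap_uVar_right]
  have := xyDelta_mul_xyDelta (k := k) (n := n) c (uVar n _ (j + 1)) (uVar n _ j)
  linear_combination A * this

theorem topQuantumDoubleSchubert_eq_levelProd :
    topQuantumDoubleSchubert k n = levelProd k n id := by
  cases n with
  | zero => simp [topQuantumDoubleSchubert_eq, levelProd]
  | succ n =>
    rw [topQuantumDoubleSchubert_eq, levelProd, Finset.prod_range_succ', Finset.prod_range]
    have h0 : xyDelta k (n + 1) (id 0) (uVar (n + 1) _ 0) = 1 := rfl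
    rw [h0, mul_one]
    refine Finset.prod_congr rfl fun a _ => ?_
    rw [uVar_of_lt (by have := a.2; omega)]
    have : uIdx (n + 1) ((a : ℕ) + 1) (by have := a.2; omega) =
        (⟨n + 1 - 2 - (a : ℕ), by omega⟩ : Fin (n + 1)) := by
      ext
      simp only [uIdx]
      omega
    rw [this]
    rfl

end Levels

/-! ### The level products under a functional that kills the quantum ideal -/

section Functional

variable {k : Type*} [CommRing k] [IsDomain k] {n : ℕ}
  (r : XRing k n →ₗ[QRing k n] QRing k n)

/-- The functional `r` applied to `g` times a level product. -/
def levelForm (g : XRing k n) (s : ℕ → ℕ) : XRing k n := contract r (C g * levelProd k n s)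

omit [IsDomain k] in
theorem levelForm_add (g g' : XRing k n) (s : ℕ → ℕ) :
    levelForm r (g + g') s = levelForm r g s + levelForm r g' s := by
  rw [levelForm, C_add, add_mul, contract_add]; rfl

omit [IsDomain k] in
theorem levelForm_C_mul (c : QRing k n) (g : XRing k n) (s : ℕ → ℕ) :
    levelForm r (C c * g) s = C c * levelForm r g s := by
  rw [levelForm, C_mul, mul_assoc, contract_C_C_mul]; rfl

theorem uDiff_C_mul {S : Type*} [CommRing S] [IsDomain S] {j : ℕ} (h : j + 1 < n) (c : S)
    (f : MvPolynomial (Fin n) S) : uDiff j h (C c * f) = C c * uDiff j h f :=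
  divDiff_C_mul (uIdx_succ_ne h) c f

theorem levelForm_exchange (g : XRing k n) {s s₁ s₂ : ℕ → ℕ} {j c : ℕ} (h : j + 1 < n)
    (hj : s j = c) (hj' : s (j + 1) = c)
    (h₁ : ∀ i, i ≠ j + 1 → s₁ i = s i) (h₁' : s₁ (j + 1) = c + 1)
    (h₂ : ∀ i, i ≠ j → s₂ i = s i) (h₂' : s₂ j = c - 1) :
    levelForm r g s =
      uDiff j h (levelForm r g s₁ + C (qCoef k n c) * levelForm r g s₂) := by
  have h1 : contract r (C g * uDiff j h (levelProd k n s₁ + C (C (qCoef k n c)) * levelProd k n s₂))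
      = uDiff j h (contract r (C g * (levelProd k n s₁ +
        C (C (qCoef k n c)) * levelProd k n s₂))) := by
    rw [← uDiff_C_mul]
    exact contract_divDiff r (uIdx_succ_ne h) _
  rw [levelForm, levelProd_exchange h hj hj' h₁ h₁' h₂ h₂', h1, mul_add, contract_add,
    mul_left_comm, contract_C_C_mul]
  rfl

/-- Evaluation of polynomials over `A` at an element of a polynomial ring over `A`. -/
def xyEval {σ A : Type*} [CommRing A] (u : MvPolynomial σ A) : Polynomial A →+* MvPolynomial σ A :=
  Polynomial.eval₂RingHom C u

theorem xyEval_C {σ A : Type*} [CommRing A] (u : MvPolynomial σ A) (a : A) :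
    xyEval u (Polynomial.C a) = C a :=
  Polynomial.eval₂_C _ _

theorem xyEval_X {σ A : Type*} [CommRing A] (u : MvPolynomial σ A) :
    xyEval u Polynomial.X = u := Polynomial.eval₂_X _ _

theorem xyEval_sub {σ A : Type*} [CommRing A] (u : MvPolynomial σ A) (a b : Polynomial A) :
    xyEval u (a - b) = xyEval u a - xyEval u b := map_sub _ _ _

omit [IsDomain k] in
theorem contract_mul_xyEval (hr : ∀ f ∈ quantumIdeal k n, r f = 0) (A u : XYRing k n)
    {p : Polynomial (XRing k n)} (hp : ∀ c, p.coeff c ∈ quantumIdeal k n) :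
    contract r (A * xyEval u p) = 0 := by
  rw [p.as_sum_range_C_mul_X_pow, map_sum, Finset.mul_sum, contract_sum]
  refine Finset.sum_eq_zero fun c _ => ?_
  rw [map_mul, map_pow, xyEval_C, xyEval_X, mul_left_comm]
  refine MvPolynomial.ext _ _ fun m => ?_
  rw [coeff_contract, coeff_C_mul, coeff_zero]
  exact hr _ (Ideal.mul_mem_right _ _ (hp c))

omit [IsDomain k] in
theorem xyEval_charDelta (u : XYRing k n) : xyEval u (charDelta k n) = xyDelta k n n u := by
  have h := map_qDelta (S := Polynomial (XRing k n)) (S' := XYRing k n) (xyEval u)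
    (fun i => Polynomial.C (xSeq k n i)) (fun i => Polynomial.C (C (qSeq k n i))) Polynomial.X n
  simp only [xyEval_C, xyEval_X] at h
  exact h

omit [IsDomain k] in
/-- A level product with `Δ_n(u_{n-1})` vanishes modulo symmetric polynomials. -/
theorem levelForm_mem_of_last (hr : ∀ f ∈ quantumIdeal k n, r f = 0) (g : XRing k n) {s : ℕ → ℕ}
    (hn : 0 < n) (hs : s (n - 1) = n) : levelForm r g s ∈ symIdeal n (QRing k n) := by
  have hlt : n - 1 < n := by omega
  have hchar : ∀ A : XYRing k n, contract r (A * xyDelta k n n (uVar n _ (n - 1))) =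
      contract r (A * uVar n _ (n - 1) ^ n) := by
    intro A
    have h1 := contract_mul_xyEval r hr A (uVar n _ (n - 1))
      (p := charDelta k n - Polynomial.X ^ n) fun c => by
        rw [Polynomial.coeff_sub]
        exact charDelta_sub_X_pow_coeff_mem c
    rwa [xyEval_sub, map_pow, xyEval_X, xyEval_charDelta,
      mul_sub A _ _, contract_sub, sub_eq_zero] at h1
  rw [levelForm, levelProd_eq_mul s hlt, hs, ← mul_assoc, hchar, mul_comm,
    ← map_uVar (C : QRing k n →+* XRing k n), ← map_pow, contract_map_C_mul, uVar_of_lt hlt]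
  exact Ideal.mul_mem_right _ _ (X_pow_mem_symIdeal _)

omit [IsDomain k] in
/-- The product `∏_{i<m} (t - u_i)`. -/
def rootProd (n : ℕ) {S : Type*} [CommRing S] (t : S) (m : ℕ) : MvPolynomial (Fin n) S :=
  ∏ i ∈ Finset.range m, (C t - uVar n S i)

theorem rename_rootProd {S : Type*} [CommRing S] (t : S) {m j : ℕ} (h : j + 1 < n)
    (hm : m ≤ j ∨ j + 2 ≤ m) : rename (uSwap n j h) (rootProd n t m) = rootProd n t m := by
  rcases hm with hm | hm
  · rw [rootProd, map_prod]
    refine Finset.prod_congr rfl fun i hi => ?_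
    have hi := Finset.mem_range.1 hi
    rw [map_sub, rename_C, rename_uSwap_uVar_of_ne h (by omega) (by omega)]
  · rw [rootProd, ← Finset.mul_prod_erase _ _ (Finset.mem_range.2 (show j < m by omega)),
      ← Finset.mul_prod_erase _ _ (Finset.mem_erase.2
        ⟨Nat.succ_ne_self j, Finset.mem_range.2 (show j + 1 < m by omega)⟩), map_mul, map_mul,
      map_sub, map_sub, rename_C, rename_uSwap_uVar_left, rename_uSwap_uVar_right, map_prod,
      mul_left_comm]
    congr 2
    refine Finset.prod_congr rfl fun i hi => ?_
    rw [map_sub, rename_C, rename_uSwap_uVar_of_ne h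
      (Finset.ne_of_mem_erase (Finset.mem_of_mem_erase hi)) (Finset.ne_of_mem_erase hi)]

theorem uDiff_mul_of_rename_eq {S : Type*} [CommRing S] [IsDomain S] {j : ℕ} (h : j + 1 < n)
    {a : MvPolynomial (Fin n) S} (ha : rename (uSwap n j h) a = a) (f : MvPolynomial (Fin n) S) :
    uDiff j h (a * f) = a * uDiff j h f :=
  divDiff_mul_of_rename_eq (uIdx_succ_ne h) ha f

theorem uDiff_add {S : Type*} [CommRing S] [IsDomain S] {j : ℕ} (h : j + 1 < n)
    (f g : MvPolynomial (Fin n) S) : uDiff j h (f + g) = uDiff j h f + uDiff j h g :=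
  divDiff_add (uIdx_succ_ne h) f g

theorem uDiff_sub {S : Type*} [CommRing S] [IsDomain S] {j : ℕ} (h : j + 1 < n)
    (f g : MvPolynomial (Fin n) S) : uDiff j h (f - g) = uDiff j h f - uDiff j h g :=
  divDiff_sub (uIdx_succ_ne h) f g

theorem uDiff_mem {S : Type*} [CommRing S] [IsDomain S] {j : ℕ} (h : j + 1 < n)
    {f : MvPolynomial (Fin n) S} (hf : f ∈ symIdeal n S) : uDiff j h f ∈ symIdeal n S :=
  divDiff_mem_symIdeal (uIdx_succ_ne h) hf

theorem uDiff_rootProd_succ_mul {S : Type*} [CommRing S] [IsDomain S] (t : S) {j : ℕ}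
    (h : j + 1 < n) (f : MvPolynomial (Fin n) S) :
    uDiff j h (rootProd n t (j + 1) * f) =
      rootProd n t j * (f + (C t - uVar n S (j + 1)) * uDiff j h f) := by
  have h1 : rootProd n t (j + 1) = rootProd n t j * (C t - uVar n S j) :=
    Finset.prod_range_succ _ _
  rw [h1, mul_assoc, uDiff_mul_of_rename_eq h (rename_rootProd t h (Or.inl le_rfl))]
  congr 1
  refine uDiff_eq_of_mul_eq h ?_
  rw [map_mul, map_sub, rename_C, rename_uSwap_uVar_left, mul_add, mul_left_comm, mul_uDiff]
  ring

end Functional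

/-! ### Multiplication by `Δ_m(t | x)` -/

section Main

variable {k : Type*} [CommRing k] [IsDomain k] {n : ℕ}
  (r : XRing k n →ₗ[QRing k n] QRing k n)

omit [IsDomain k] in
/-- Multiplication by a variable `x` raises or lowers one level. -/
theorem levelForm_xSeq_mul (g : XRing k n) {a : ℕ} (ha : a < n) {s₁ s₂ : ℕ → ℕ}
    (h₁ : ∀ i, i ≠ a → s₁ i = i) (h₁' : s₁ a = a + 1)
    (h₂ : ∀ i, i ≠ a → s₂ i = i) (h₂' : s₂ a = a - 1) :
    levelForm r (xSeq k n a * g) id =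
      levelForm r g s₁ - uVar n _ a * levelForm r g id - C (qCoef k n a) * levelForm r g s₂ := by
  have key : C (xSeq k n a) * levelProd k n id =
      levelProd k n s₁ - uVar n _ a * levelProd k n id
        - C (C (qCoef k n a)) * levelProd k n s₂ := by
    rw [levelProd_eq_mul id ha, levelProd_eq_mul s₁ ha, levelProd_eq_mul s₂ ha, h₁', h₂']
    have e1 : ∏ i ∈ (Finset.range n).erase a, xyDelta k n (s₁ i) (uVar n _ i) =
        ∏ i ∈ (Finset.range n).erase a, xyDelta k n (id i) (uVar n _ i) :=
      Finset.prod_congr rfl fun i hi => by rw [h₁ i (Finset.ne_of_mem_erase hi)]; rfl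
    have e2 : ∏ i ∈ (Finset.range n).erase a, xyDelta k n (s₂ i) (uVar n _ i) =
        ∏ i ∈ (Finset.range n).erase a, xyDelta k n (id i) (uVar n _ i) :=
      Finset.prod_congr rfl fun i hi => by rw [h₂ i (Finset.ne_of_mem_erase hi)]; rfl
    rw [e1, e2, xyDelta_succ]
    simp only [id]
    ring
  have h3 : C (xSeq k n a * g) * levelProd k n id =
      C g * levelProd k n s₁ - map C (uVar n (QRing k n) a) * (C g * levelProd k n id)
        - C (C (qCoef k n a)) * (C g * levelProd k n s₂) := by
    rw [map_uVar, C_mul, mul_comm (C (xSeq k n a)), mul_assoc, key]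
    ring
  rw [levelForm, h3, contract_sub, contract_sub, contract_map_C_mul, contract_C_C_mul]
  rfl

/-- The raised level products vanish if the unraised one is symmetric in the relevant variables. -/
theorem levelForm_raise_mem (hr : ∀ f ∈ quantumIdeal k n, r f = 0) (g : XRing k n) {a : ℕ}
    (ha : a + 1 < n) (hg : uDiff a ha (levelForm r g id) ∈ symIdeal n (QRing k n)) :
    levelForm r g (fun i => if a ≤ i ∧ i < a + 1 then i + 1 else i) ∈ symIdeal n (QRing k n) := by
  let s : ℕ → ℕ → ℕ := fun l i => if a ≤ i ∧ i < l then i + 1 else i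
  have hs0 : levelForm r g (s a) = levelForm r g id := by
    congr 1
    funext i
    exact if_neg (by omega)
  have hsn : levelForm r g (s n) ∈ symIdeal n (QRing k n) := by
    refine levelForm_mem_of_last r hr g (by omega) ?_
    simp only [s]
    rw [if_pos (by omega)]
    omega
  refine mem_symIdeal_of_system (Finset.Icc (a + 1) (n - 1)) (fun l => levelForm r g (s l)) ?_
    (a + 1) (Finset.mem_Icc.2 ⟨le_rfl, by omega⟩)
  intro l hl
  obtain ⟨hl1, hl2⟩ := Finset.mem_Icc.1 hl
  obtain ⟨j, rfl⟩ : ∃ j, l = j + 1 := ⟨l - 1, by omega⟩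
  have hj : j + 1 < n := by omega
  have hex := levelForm_exchange r g (s := s (j + 1)) (s₁ := s (j + 2)) (s₂ := s j) (c := j + 1) hj
    (if_pos (by omega)) (if_neg (by omega))
    (fun i hi => by simp only [s]; congr 1; simp only [eq_iff_iff]; omega)
    (if_pos (by omega))
    (fun i hi => by simp only [s]; congr 1; simp only [eq_iff_iff]; omega)
    (if_neg (by omega))
  refine ⟨_, _, uIdx_succ_ne hj,
    (if j + 1 = n - 1 then 0 else levelForm r g (s (j + 2))) +
      C (qCoef k n (j + 1)) * (if j = a then 0 else levelForm r g (s j)), ?_, ?_⟩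
  · change _ - uDiff j hj _ ∈ _
    rw [hex, ← uDiff_sub, add_sub_add_comm, ← mul_sub, uDiff_add, uDiff_C_mul]
    refine add_mem ?_ (Ideal.mul_mem_left _ _ ?_)
    · split_ifs with h
      · rw [sub_zero, show j + 2 = n by omega]
        exact uDiff_mem _ hsn
      · rw [sub_self]
        exact uDiff_mem _ (zero_mem _)
    · split_ifs with h
      · subst h
        rw [sub_zero, hs0]
        exact hg
      · rw [sub_self]
        exact uDiff_mem _ (zero_mem _)
  · intro d hd
    refine add_mem ?_ (C_mul_mem_symDegLT _ ?_)
    · split_ifs with h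
      · exact zero_mem _
      · exact hd (j + 2) (Finset.mem_Icc.2 ⟨by omega, by omega⟩)
    · split_ifs with h
      · exact zero_mem _
      · exact hd j (Finset.mem_Icc.2 ⟨by omega, by omega⟩)

/-- The lowered level products are computed by lowering the number of linear factors. -/
theorem levelForm_lower_sub_mem (g : XRing k n) (t : QRing k n) (τ : XRing k n) {a : ℕ}
    (ha : a < n) (hτ : ∀ j (h : j + 1 < n), j < a → uDiff j h τ ∈ symIdeal n (QRing k n))
    (hg : levelForm r g id - rootProd n t a * τ ∈ symIdeal n (QRing k n)) (ha0 : 0 < a) :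
    levelForm r g (fun i => if a ≤ i ∧ i ≤ a then i - 1 else i) - rootProd n t (a - 1) * τ
      ∈ symIdeal n (QRing k n) := by
  let s : ℕ → ℕ → ℕ := fun l i => if l ≤ i ∧ i ≤ a then i - 1 else i
  have hs0 : levelForm r g (s (a + 1)) = levelForm r g id := by
    congr 1
    funext i
    exact if_neg (by omega)
  let v : ℕ → XRing k n := fun l => levelForm r g (s l) - rootProd n t (l - 1) * τ
  refine mem_symIdeal_of_system (Finset.Icc 1 a) v ?_ a (Finset.mem_Icc.2 ⟨ha0, le_rfl⟩)
  intro l hl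
  obtain ⟨hl1, hl2⟩ := Finset.mem_Icc.1 hl
  obtain ⟨j, rfl⟩ : ∃ j, l = j + 1 := ⟨l - 1, by omega⟩
  have hj : j + 1 < n := by omega
  have hex := levelForm_exchange r g (s := s (j + 1)) (s₁ := s (j + 2)) (s₂ := s j) (c := j) hj
    (if_neg (by omega)) (if_pos (by omega))
    (fun i hi => by simp only [s]; congr 1; simp only [eq_iff_iff]; omega)
    (if_neg (by omega))
    (fun i hi => by simp only [s]; congr 1; simp only [eq_iff_iff]; omega)
    (if_pos (by omega))
  refine ⟨_, _, uIdx_succ_ne hj,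
    (if j = 0 then 0 else C (qCoef k n j) * v j) + (if j + 1 = a then 0 else v (j + 2)), ?_, ?_⟩
  · change _ - uDiff j hj _ ∈ _
    have h1 : uDiff j hj (v (j + 2)) - uDiff j hj (if j + 1 = a then 0 else v (j + 2))
        ∈ symIdeal n (QRing k n) := by
      split_ifs with h
      · rw [← uDiff_sub, sub_zero]
        refine uDiff_mem _ ?_
        simp only [v]
        rw [show j + 2 = a + 1 by omega, hs0]
        exact hg
      · rw [sub_self]
        exact zero_mem _
    have h2 : uDiff j hj (C (qCoef k n j) * levelForm r g (s j)) -
        uDiff j hj (if j = 0 then 0 else C (qCoef k n j) * v j) ∈ symIdeal n (QRing k n) := by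
      split_ifs with h
      · have : qCoef k n j = 0 := by rw [h]; rfl
        rw [this, C_0, zero_mul, sub_self]
        exact zero_mem _
      · rw [← uDiff_sub, ← mul_sub, uDiff_C_mul]
        refine Ideal.mul_mem_left _ _ ?_
        simp only [v]
        rw [sub_sub_cancel, uDiff_mul_of_rename_eq hj (rename_rootProd t hj (Or.inl (by omega)))]
        exact Ideal.mul_mem_left _ _ (hτ j hj (by omega))
    have h3 : v (j + 1) = uDiff j hj (v (j + 2)) + uDiff j hj (C (qCoef k n j) *
        levelForm r g (s j)) + rootProd n t j * ((C t - uVar n _ (j + 1)) * uDiff j hj τ) := by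
      simp only [v]
      rw [hex, uDiff_add, uDiff_sub, show j + 2 - 1 = j + 1 by omega, uDiff_rootProd_succ_mul,
        Nat.add_sub_cancel]
      ring
    have h4 := add_mem (add_mem h1 h2) (Ideal.mul_mem_left _ (rootProd n t j)
      (Ideal.mul_mem_left _ (C t - uVar n _ (j + 1)) (hτ j hj (by omega))))
    rw [h3, uDiff_add]
    convert h4 using 1
    ring
  · intro d hd
    refine add_mem ?_ ?_
    · split_ifs with h
      · exact zero_mem _
      · exact C_mul_mem_symDegLT _ (hd j (Finset.mem_Icc.2 ⟨by omega, by omega⟩))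
    · split_ifs with h
      · exact zero_mem _
      · exact hd (j + 2) (Finset.mem_Icc.2 ⟨by omega, by omega⟩)

theorem levelForm_mul_xDelta_sub_mem (hr : ∀ f ∈ quantumIdeal k n, r f = 0) (f : XRing k n)
    (t : QRing k n) {b : ℕ} (hb : b < n)
    (hf : ∀ j (h : j + 1 < n), j < b →
      uDiff j h (levelForm r f id) ∈ symIdeal n (QRing k n)) :
    ∀ m ≤ b, levelForm r (f * xDelta k n m (C t)) id - rootProd n t m * levelForm r f id
      ∈ symIdeal n (QRing k n) := by
  intro m
  induction m using Nat.strong_induction_on with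
  | _ m ih =>
    intro hm
    cases m with
    | zero =>
      have : xDelta k n 0 (C t) = 1 := rfl
      rw [this, mul_one, rootProd, Finset.range_zero, Finset.prod_empty, one_mul, sub_self]
      exact zero_mem _
    | succ a =>
      set τ := levelForm r f id with hτ
      have hg := ih a (Nat.lt_succ_self a) (by omega)
      set g := f * xDelta k n a (C t) with hgdef
      have hraise := levelForm_raise_mem r hr g (a := a) (by omega) (by
        have h1 := uDiff_mem (j := a) (by omega) hg
        rw [uDiff_sub, uDiff_mul_of_rename_eq _ (rename_rootProd t _ (Or.inl le_rfl))] at h1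
        have h2 := add_mem h1 (Ideal.mul_mem_left _ (rootProd n t a) (hf a (by omega) (by omega)))
        rwa [sub_add_cancel] at h2)
      have hx := levelForm_xSeq_mul r g (a := a) (by omega)
        (s₁ := fun i => if a ≤ i ∧ i < a + 1 then i + 1 else i)
        (s₂ := fun i => if a ≤ i ∧ i ≤ a then i - 1 else i)
        (fun i hi => if_neg (by omega)) (if_pos (by omega)) (fun i hi => if_neg (by omega))
        (if_pos (by omega))
      have hstep : f * xDelta k n (a + 1) (C t) = xSeq k n a * g + C t * g +
          C (qCoef k n a) * (f * xDelta k n (a - 1) (C t)) := by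
        rw [xDelta_succ, hgdef]
        ring
      have hroot : rootProd n t (a + 1) = rootProd n t a * (C t - uVar n _ a) :=
        Finset.prod_range_succ _ _
      have hlow : C (qCoef k n a) * (levelForm r (f * xDelta k n (a - 1) (C t)) id -
          levelForm r g (fun i => if a ≤ i ∧ i ≤ a then i - 1 else i))
            ∈ symIdeal n (QRing k n) := by
        rcases Nat.eq_zero_or_pos a with h0 | h0
        · have : qCoef k n a = 0 := by rw [h0]; rfl
          rw [this, C_0, zero_mul]
          exact zero_mem _
        · refine Ideal.mul_mem_left _ _ ?_
          have h1 := ih (a - 1) (by omega) (by omega)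
          have h2 := levelForm_lower_sub_mem r g t τ (by omega)
            (fun j h hj => hf j h (by omega)) hg h0
          have h3 := sub_mem h1 h2
          rwa [sub_sub_sub_cancel_right] at h3
      have h5 := add_mem (add_mem hraise hlow)
        (Ideal.mul_mem_left _ (C t - uVar n _ a) hg)
      rw [hstep, levelForm_add, levelForm_add, levelForm_C_mul, levelForm_C_mul, hx, hroot]
      convert h5 using 1
      ring

/-- The generating function of the values of the top-coefficient functional on products of level
products, modulo symmetric polynomials. -/
theorem levelForm_prod_sub_mem [Infinite k] (p : ℕ → QRing k n) (b : ℕ) (hb : b ≤ n) :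
    levelForm (topForm k n) (∏ j ∈ Finset.Ico b n, xDelta k n j (C (p j))) id
      - ∏ j ∈ Finset.Ico b n, rootProd n (p j) j ∈ symIdeal n (QRing k n) := by
  induction hb using Nat.decreasingInduction with
  | self =>
    rw [Finset.Ico_self, Finset.prod_empty, Finset.prod_empty]
    have : Infinite (QRing k n) := Infinite.of_injective (C (σ := Fin (n - 1)) (R := k)) (C_injective _ _)
    have : levelForm (topForm k n) 1 id = 1 := by
      refine MvPolynomial.funext fun a => ?_
      rw [levelForm, eval_contract, map_one, one_mul, map_one, levelProd, map_prod]
      have h := topForm_prod_xDelta (k := k) (n := n)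
        (fun j => if h : j < n then a (uIdx n j h) else 0)
      refine Eq.trans (congrArg _ (Finset.prod_congr rfl fun j hj => ?_)) h
      have hj := Finset.mem_range.1 hj
      have h2 := map_qDelta (S := XYRing k n) (S' := XRing k n)
        (eval fun i => (C (a i) : XRing k n)) (fun i => C (xSeq k n i))
        (fun i => C (C (qSeq k n i))) (uVar n _ j) j
      rw [dif_pos hj]
      simp only [eval_C] at h2
      rw [uVar_of_lt hj, eval_X] at h2
      rw [uVar_of_lt hj]
      exact h2
    rw [this, sub_self]
    exact zero_mem _
  | of_succ b hb ih =>
    have hico : Finset.Ico b n = insert b (Finset.Ico (b + 1) n) :=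
      (Finset.insert_Ico_add_one_left_eq_Ico hb).symm
    rw [hico, Finset.prod_insert (by simp), Finset.prod_insert (by simp), mul_comm (xDelta _ _ _ _)]
    set F := ∏ j ∈ Finset.Ico (b + 1) n, xDelta k n j (C (p j)) with hF
    set Φ := ∏ j ∈ Finset.Ico (b + 1) n, rootProd n (p j) j with hΦ
    have h1 := levelForm_mul_xDelta_sub_mem (topForm k n)
      (fun f hf => topForm_of_mem_quantumIdeal hf) F (p b) hb (fun j h hj => by
        have hsym : rename (uSwap n j h) Φ = Φ := by
          rw [hΦ, map_prod]
          refine Finset.prod_congr rfl fun i hi => rename_rootProd _ _ (Or.inr ?_)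
          have := (Finset.mem_Ico.1 hi).1
          omega
        have h0 : uDiff j h Φ = 0 := divDiff_of_rename_eq (uIdx_succ_ne h) hsym
        have h2 := uDiff_mem h ih
        rwa [uDiff_sub, h0, sub_zero] at h2) b le_rfl
    have h2 := add_mem h1 (Ideal.mul_mem_left _ (rootProd n (p b) b) ih)
    rw [mul_sub] at h2
    convert h2 using 1
    ring

end Main

/-! ### Inversions and reduced words -/

section Inversions

variable {n : ℕ}

theorem coe_simpleTransposition (a : Fin (n - 1)) (i : Fin n) :
    ((simpleTransposition a i : Fin n) : ℕ) =
      if (i : ℕ) = a then (a : ℕ) + 1 else if (i : ℕ) = a + 1 then (a : ℕ) else i := by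
  rw [simpleTransposition, Equiv.swap_apply_def]
  simp only [lo, hi, Fin.ext_iff]
  split_ifs <;> simp_all

theorem lo_ne_hi (a : Fin (n - 1)) : lo a ≠ hi a := fun h => by
  have := congrArg Fin.val h
  simp [lo, hi] at this

theorem simpleTransposition_mul_self (a : Fin (n - 1)) :
    simpleTransposition a * simpleTransposition a = 1 := Equiv.swap_mul_self _ _

theorem simpleTransposition_inv (a : Fin (n - 1)) :
    (simpleTransposition a)⁻¹ = simpleTransposition a := Equiv.swap_inv _ _

theorem simpleTransposition_apply_self (a : Fin (n - 1)) (i : Fin n) :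
    simpleTransposition a (simpleTransposition a i) = i := by
  rw [← Equiv.Perm.mul_apply, simpleTransposition_mul_self, Equiv.Perm.one_apply]

theorem simpleTransposition_lo (a : Fin (n - 1)) : simpleTransposition a (lo a) = hi a :=
  Equiv.swap_apply_left _ _

theorem simpleTransposition_hi (a : Fin (n - 1)) : simpleTransposition a (hi a) = lo a :=
  Equiv.swap_apply_right _ _

/-- The pairs `i < j`. -/
def pairs (n : ℕ) : Finset (Fin n × Fin n) := Finset.univ.filter fun x => x.1 < x.2

theorem mem_pairs {x : Fin n × Fin n} : x ∈ pairs n ↔ (x.1 : ℕ) < x.2 := by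
  rw [pairs, Finset.mem_filter, Fin.lt_def]
  simp

theorem lo_hi_mem_pairs (a : Fin (n - 1)) : (lo a, hi a) ∈ pairs n := by
  simp [mem_pairs, lo, hi]

theorem mem_pairs_erase {a : Fin (n - 1)} {x : Fin n × Fin n} :
    x ∈ (pairs n).erase (lo a, hi a) ↔
      (x.1 : ℕ) < x.2 ∧ ¬ ((x.1 : ℕ) = a ∧ (x.2 : ℕ) = a + 1) := by
  rw [Finset.mem_erase, mem_pairs, and_comm, Ne, Prod.ext_iff, Fin.ext_iff, Fin.ext_iff]
  rfl

@[to_additive]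
theorem prod_pairs {M : Type*} [CommMonoid M] (a : Fin (n - 1)) (f : Fin n × Fin n → M) :
    ∏ x ∈ pairs n, f x = f (lo a, hi a) * ∏ x ∈ (pairs n).erase (lo a, hi a), f x :=
  (Finset.mul_prod_erase _ _ (lo_hi_mem_pairs a)).symm

@[to_additive]
theorem prod_pairs_erase_map {M : Type*} [CommMonoid M] (a : Fin (n - 1)) (f : Fin n × Fin n → M) :
    ∏ x ∈ (pairs n).erase (lo a, hi a), f (simpleTransposition a x.1, simpleTransposition a x.2)
      = ∏ x ∈ (pairs n).erase (lo a, hi a), f x := by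
  refine Finset.prod_nbij' (fun x => (simpleTransposition a x.1, simpleTransposition a x.2))
    (fun x => (simpleTransposition a x.1, simpleTransposition a x.2)) ?_ ?_ ?_ ?_ ?_
  any_goals
    intro x hx
    rw [mem_pairs_erase] at hx ⊢
    simp only [coe_simpleTransposition]
    split_ifs <;> omega
  all_goals intro x _; simp [simpleTransposition_apply_self]

theorem prod_pairs_erase_left {M : Type*} [CommMonoid M] (a : Fin (n - 1)) (f : Fin n × Fin n → M) :
    ∏ x ∈ (pairs n).erase (lo a, hi a), f (simpleTransposition a x.1, x.2)
      = ∏ x ∈ (pairs n).erase (lo a, hi a), f x := by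
  refine Finset.prod_nbij' (fun x => (simpleTransposition a x.1, x.2))
    (fun x => (simpleTransposition a x.1, x.2)) ?_ ?_ ?_ ?_ ?_
  any_goals
    intro x hx
    rw [mem_pairs_erase] at hx ⊢
    simp only [coe_simpleTransposition]
    split_ifs <;> omega
  all_goals intro x _; simp [simpleTransposition_apply_self]

theorem prod_pairs_erase_right {M : Type*} [CommMonoid M] (a : Fin (n - 1))
    (f : Fin n × Fin n → M) :
    ∏ x ∈ (pairs n).erase (lo a, hi a), f (x.1, simpleTransposition a x.2)
      = ∏ x ∈ (pairs n).erase (lo a, hi a), f x := by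
  refine Finset.prod_nbij' (fun x => (x.1, simpleTransposition a x.2))
    (fun x => (x.1, simpleTransposition a x.2)) ?_ ?_ ?_ ?_ ?_
  any_goals
    intro x hx
    rw [mem_pairs_erase] at hx ⊢
    simp only [coe_simpleTransposition]
    split_ifs <;> omega
  all_goals intro x _; simp [simpleTransposition_apply_self]

/-- The number of inversions. -/
def inversions (w : Equiv.Perm (Fin n)) : ℕ := ∑ x ∈ pairs n, if w x.2 < w x.1 then 1 else 0

theorem inversions_mul_add (w : Equiv.Perm (Fin n)) (a : Fin (n - 1)) :
    inversions (w * simpleTransposition a) + (if w (hi a) < w (lo a) then 1 else 0)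
      = inversions w + (if w (lo a) < w (hi a) then 1 else 0) := by
  set f : Fin n × Fin n → ℕ := fun x => if w x.2 < w x.1 then 1 else 0 with hf
  have h1 : inversions (w * simpleTransposition a) =
      ∑ x ∈ pairs n, f (simpleTransposition a x.1, simpleTransposition a x.2) := rfl
  have h2 : inversions w = ∑ x ∈ pairs n, f x := rfl
  rw [h1, h2, sum_pairs a f,
    sum_pairs a fun x => f (simpleTransposition a x.1, simpleTransposition a x.2),
    sum_pairs_erase_map, simpleTransposition_lo, simpleTransposition_hi, hf]
  ring

theorem inversions_mul_of_lt {w : Equiv.Perm (Fin n)} {a : Fin (n - 1)} (h : w (lo a) < w (hi a)) :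
    inversions (w * simpleTransposition a) = inversions w + 1 := by
  have := inversions_mul_add w a
  rwa [if_pos h, if_neg h.asymm, add_zero] at this

theorem inversions_mul_of_gt {w : Equiv.Perm (Fin n)} {a : Fin (n - 1)} (h : w (hi a) < w (lo a)) :
    inversions (w * simpleTransposition a) + 1 = inversions w := by
  have := inversions_mul_add w a
  rwa [if_pos h, if_neg h.asymm, add_zero] at this

theorem lt_or_gt_lo_hi (w : Equiv.Perm (Fin n)) (a : Fin (n - 1)) :
    w (lo a) < w (hi a) ∨ w (hi a) < w (lo a) :=
  lt_or_gt_of_ne fun h => lo_ne_hi a (w.injective h)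

/-- The product of a word. -/
def wordProd (l : List (Fin (n - 1))) : Equiv.Perm (Fin n) := (l.map simpleTransposition).prod

theorem wordProd_append (l l' : List (Fin (n - 1))) :
    wordProd (l ++ l') = wordProd l * wordProd l' := by simp [wordProd]

theorem wordProd_cons (a : Fin (n - 1)) (l : List (Fin (n - 1))) :
    wordProd (a :: l) = simpleTransposition a * wordProd l := by simp [wordProd]

theorem wordProd_reverse (l : List (Fin (n - 1))) : wordProd l.reverse = (wordProd l)⁻¹ := by
  induction l with
  | nil => simp [wordProd]
  | cons a l ih =>
    rw [List.reverse_cons, wordProd_append, ih, wordProd_cons, wordProd_cons, mul_inv_rev]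
    simp [wordProd, simpleTransposition_inv]

theorem inversions_one : inversions (1 : Equiv.Perm (Fin n)) = 0 :=
  Finset.sum_eq_zero fun x hx => if_neg (by
    have := mem_pairs.1 hx
    exact not_lt.2 (le_of_lt this))

theorem inversions_inv_wordProd_le (l : List (Fin (n - 1))) :
    inversions (wordProd l)⁻¹ ≤ l.length := by
  induction l with
  | nil => simp [wordProd, inversions_one]
  | cons a l ih =>
    rw [wordProd_cons, mul_inv_rev, simpleTransposition_inv, List.length_cons]
    rcases lt_or_gt_lo_hi (wordProd l)⁻¹ a with h | h
    · have := inversions_mul_of_lt h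
      omega
    · have := inversions_mul_of_gt h
      omega

theorem inversions_wordProd_le (l : List (Fin (n - 1))) : inversions (wordProd l) ≤ l.length := by
  have := inversions_inv_wordProd_le l.reverse
  rwa [wordProd_reverse, inv_inv, List.length_reverse] at this

theorem eq_one_of_forall_lt {w : Equiv.Perm (Fin n)} (h : ∀ a, w (lo a) < w (hi a)) : w = 1 := by
  cases n with
  | zero => exact Subsingleton.elim _ _
  | succ n =>
    have hm : StrictMono w := Fin.strictMono_iff_lt_succ.2 fun i => h i
    ext i
    have := Subsingleton.elim (hm.orderIsoOfSurjective w w.surjective) (OrderIso.refl _)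
    exact congrArg (fun e : Fin (n + 1) ≃o Fin (n + 1) => ((e i : Fin (n + 1)) : ℕ)) this

theorem exists_wordProd_eq (w : Equiv.Perm (Fin n)) :
    ∃ l : List (Fin (n - 1)), wordProd l = w ∧ l.length = inversions w := by
  induction h : inversions w generalizing w with
  | zero =>
    refine ⟨[], (eq_one_of_forall_lt fun a => (lt_or_gt_lo_hi w a).resolve_right fun ha => ?_).symm,
      rfl⟩
    have := inversions_mul_of_gt ha
    omega
  | succ d ih =>
    obtain ⟨a, ha⟩ : ∃ a, w (hi a) < w (lo a) := by
      by_contra hcon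
      push Not at hcon
      have := eq_one_of_forall_lt fun a => (lt_or_gt_lo_hi w a).resolve_right (hcon a).not_gt
      rw [this, inversions_one] at h
      omega
    have h1 := inversions_mul_of_gt ha
    obtain ⟨l, hl, hlen⟩ := ih (w * simpleTransposition a) (by omega)
    refine ⟨l ++ [a], ?_, by simp [hlen]⟩
    rw [wordProd_append, hl, mul_assoc]
    simp [wordProd, simpleTransposition_mul_self]

theorem IsReducedWord.length_eq {l : List (Fin (n - 1))} {w : Equiv.Perm (Fin n)}
    (h : IsReducedWord l w) : l.length = inversions w := by
  obtain ⟨l', hl', hlen⟩ := exists_wordProd_eq w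
  refine le_antisymm (hlen ▸ h.2 l' hl') ?_
  rw [← h.1]
  exact inversions_wordProd_le l

theorem inversions_revPerm_mul (w : Equiv.Perm (Fin n)) :
    inversions (Fin.revPerm * w) + inversions w = (pairs n).card := by
  rw [inversions, inversions, ← Finset.sum_add_distrib, Finset.card_eq_sum_ones]
  refine Finset.sum_congr rfl fun x hx => ?_
  have hne : w x.1 ≠ w x.2 := fun h => by
    have := mem_pairs.1 hx
    rw [w.injective h] at this
    exact lt_irrefl _ this
  simp only [Equiv.Perm.mul_apply, Fin.revPerm_apply, Fin.rev_lt_rev]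
  rcases lt_or_gt_of_ne hne with h | h
  · rw [if_pos h, if_neg h.asymm]
  · rw [if_pos h, if_neg h.asymm]

theorem inversions_revPerm : inversions (Fin.revPerm : Equiv.Perm (Fin n)) = (pairs n).card := by
  have := inversions_revPerm_mul (1 : Equiv.Perm (Fin n))
  rwa [mul_one, inversions_one, add_zero] at this

end Inversions

/-! ### Iterated divided differences -/

section Words

variable {n : ℕ} {S S' : Type*} [CommRing S] [CommRing S']

/-- The composition of the divided differences along a word. -/
def wordDiff (l : List (Fin (n - 1))) (f : MvPolynomial (Fin n) S) : MvPolynomial (Fin n) S :=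
  l.foldr (fun a g => divDiff (lo a) (hi a) g) f

theorem wordDiff_cons (a : Fin (n - 1)) (l : List (Fin (n - 1))) (f : MvPolynomial (Fin n) S) :
    wordDiff (a :: l) f = divDiff (lo a) (hi a) (wordDiff l f) := rfl

theorem wordDiff_append (l l' : List (Fin (n - 1))) (f : MvPolynomial (Fin n) S) :
    wordDiff (l ++ l') f = wordDiff l (wordDiff l' f) := List.foldr_append

theorem map_wordDiff [IsDomain S'] (φ : S →+* S') (l : List (Fin (n - 1)))
    (f : MvPolynomial (Fin n) S) : map φ (wordDiff l f) = wordDiff l (map φ f) := by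
  induction l with
  | nil => rfl
  | cons a l ih => rw [wordDiff_cons, wordDiff_cons, map_divDiff (lo_ne_hi a), ih]

variable [IsDomain S]

theorem wordDiff_zero (l : List (Fin (n - 1))) :
    wordDiff l (0 : MvPolynomial (Fin n) S) = 0 := by
  induction l with
  | nil => rfl
  | cons a l ih => rw [wordDiff_cons, ih, divDiff_zero (lo_ne_hi a)]

theorem wordDiff_sub (l : List (Fin (n - 1))) (f g : MvPolynomial (Fin n) S) :
    wordDiff l (f - g) = wordDiff l f - wordDiff l g := by
  induction l with
  | nil => rfl
  | cons a l ih => rw [wordDiff_cons, ih, divDiff_sub (lo_ne_hi a)]; rfl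

theorem wordDiff_C_mul (l : List (Fin (n - 1))) (c : S) (f : MvPolynomial (Fin n) S) :
    wordDiff l (C c * f) = C c * wordDiff l f := by
  induction l with
  | nil => rfl
  | cons a l ih => rw [wordDiff_cons, ih, divDiff_C_mul (lo_ne_hi a)]; rfl

theorem wordDiff_mem_degLT (l : List (Fin (n - 1))) {d : ℕ} {f : MvPolynomial (Fin n) S}
    (hf : f ∈ degLT (Fin n) S (d + l.length)) : wordDiff l f ∈ degLT (Fin n) S d := by
  induction l generalizing d with
  | nil => exact hf
  | cons a l ih =>
    refine divDiff_mem_degLT (lo_ne_hi a) (ih ?_)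
    rw [List.length_cons] at hf
    rwa [add_assoc, add_comm 1]

theorem homogeneousComponent_wordDiff (l : List (Fin (n - 1))) (d : ℕ)
    (f : MvPolynomial (Fin n) S) :
    homogeneousComponent d (wordDiff l f) = wordDiff l (homogeneousComponent (d + l.length) f) := by
  induction l generalizing d with
  | nil => rfl
  | cons a l ih =>
    rw [wordDiff_cons, wordDiff_cons, homogeneousComponent_divDiff (lo_ne_hi a), ih,
      List.length_cons, add_assoc, add_comm 1]

theorem wordDiff_mem_symIdeal (l : List (Fin (n - 1))) {f : MvPolynomial (Fin n) S}
    (hf : f ∈ symIdeal n S) : wordDiff l f ∈ symIdeal n S := by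
  induction l with
  | nil => exact hf
  | cons a l ih => exact divDiff_mem_symIdeal (lo_ne_hi a) ih

theorem contract_wordDiff {k : Type*} [CommRing k] [IsDomain k]
    (r : XRing k n →ₗ[QRing k n] QRing k n) (l : List (Fin (n - 1))) (B : XYRing k n) :
    contract r (wordDiff l B) = wordDiff l (contract r B) := by
  induction l with
  | nil => rfl
  | cons a l ih => rw [wordDiff_cons, contract_divDiff r (lo_ne_hi a), ih, wordDiff_cons]

end Words

/-! ### The product of the differences `p_i - X_j` -/

section PairProd

variable {n : ℕ} {S S' : Type*} [CommRing S] [CommRing S']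

/-- The product `∏_{i<j} (p_i - X_j)`. -/
def pairProd (p : Fin n → S) : MvPolynomial (Fin n) S := ∏ x ∈ pairs n, (C (p x.1) - X x.2)

theorem map_pairProd (φ : S →+* S') (p : Fin n → S) :
    map φ (pairProd p) = pairProd fun i => φ (p i) := by
  simp [pairProd, map_prod]

theorem pairProd_sub_comp [IsDomain S] (p : Fin n → S) (a : Fin (n - 1)) :
    pairProd p - pairProd (fun i => p (simpleTransposition a i)) =
      C (p (lo a) - p (hi a)) * divDiff (lo a) (hi a) (pairProd p) := by
  set Q := ∏ x ∈ (pairs n).erase (lo a, hi a), (C (p x.1) - X x.2 : MvPolynomial (Fin n) S) with hQ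
  have h1 : pairProd p = (C (p (lo a)) - X (hi a)) * Q := prod_pairs a _
  have h2 : pairProd (fun i => p (simpleTransposition a i)) = (C (p (hi a)) - X (hi a)) * Q := by
    have := prod_pairs a fun x : Fin n × Fin n =>
      (C (p (simpleTransposition a x.1)) - X x.2 : MvPolynomial (Fin n) S)
    rw [prod_pairs_erase_left a fun x : Fin n × Fin n =>
      (C (p x.1) - X x.2 : MvPolynomial (Fin n) S), simpleTransposition_lo] at this
    exact this
  have h3 : rename (simpleTransposition a) Q = Q := by
    rw [hQ, map_prod]
    simp only [map_sub, rename_C, rename_X]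
    exact prod_pairs_erase_right a fun x : Fin n × Fin n =>
      (C (p x.1) - X x.2 : MvPolynomial (Fin n) S)
  have h4 : divDiff (lo a) (hi a) (pairProd p) = Q := by
    refine divDiff_eq_of_mul_eq (lo_ne_hi a) ?_
    rw [h1]
    change _ = _ - rename (simpleTransposition a) _
    rw [map_mul, h3, map_sub, rename_C, rename_X, simpleTransposition_hi]
    ring
  rw [h4, h1, h2, map_sub]
  ring

theorem pairProd_mem_degLT (p : Fin n → S) :
    pairProd p ∈ degLT (Fin n) S ((pairs n).card + 1) := by
  rw [Finset.card_eq_sum_ones]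
  exact prod_mem_degLT _ _ _ fun x _ =>
    sub_mem (C_mem_degLT _ (by norm_num)) (X_mem_degLT _ (by norm_num))

theorem pairProd_sub_mem_degLT (p p' : Fin n → S) :
    pairProd p - pairProd p' ∈ degLT (Fin n) S (pairs n).card := by
  rw [Finset.card_eq_sum_ones]
  refine prod_sub_prod_mem_degLT _ _ _ _ (fun x _ => ?_) (fun x _ => ?_) fun x _ => ?_
  · exact sub_mem (C_mem_degLT _ (by norm_num)) (X_mem_degLT _ (by norm_num))
  · exact sub_mem (C_mem_degLT _ (by norm_num)) (X_mem_degLT _ (by norm_num))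
  · rw [sub_sub_sub_cancel_right]
    exact sub_mem (C_mem_degLT _ (by norm_num)) (C_mem_degLT _ (by norm_num))

theorem pairProd_zero_isHomogeneous :
    (pairProd (0 : Fin n → S)).IsHomogeneous (pairs n).card := by
  rw [Finset.card_eq_sum_ones]
  refine IsHomogeneous.prod _ _ _ fun x _ => ?_
  simpa using (isHomogeneous_X S x.2).neg

theorem eq_one_of_forall_le {w : Equiv.Perm (Fin n)} (h : ∀ j, j ≤ w j) : w = 1 := by
  have h1 : ∑ j : Fin n, (j : ℕ) = ∑ j : Fin n, (w j : ℕ) :=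
    (Equiv.sum_comp w fun j : Fin n => (j : ℕ)).symm
  have h2 := (Finset.sum_eq_sum_iff_of_le fun j _ => Fin.le_def.1 (h j)).1 h1
  ext j
  exact (h2 j (Finset.mem_univ j)).symm

/-- The product of the `p_{w i} - p_{w j}` over the non-inversions of `w`. -/
def nonInversionProd (p : Fin n → S) (w : Equiv.Perm (Fin n)) : S :=
  ∏ x ∈ pairs n, if w x.1 < w x.2 then p (w x.1) - p (w x.2) else 1

theorem nonInversionProd_mul {p : Fin n → S} {w : Equiv.Perm (Fin n)} {a : Fin (n - 1)}
    (h : w (hi a) < w (lo a)) :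
    nonInversionProd p (w * simpleTransposition a) =
      (p (w (hi a)) - p (w (lo a))) * nonInversionProd p w := by
  set f : Fin n × Fin n → S :=
    fun x => if w x.1 < w x.2 then p (w x.1) - p (w x.2) else 1 with hf
  have h1 : nonInversionProd p (w * simpleTransposition a) =
      ∏ x ∈ pairs n, f (simpleTransposition a x.1, simpleTransposition a x.2) := rfl
  have h2 : nonInversionProd p w = ∏ x ∈ pairs n, f x := rfl
  rw [h1, h2, prod_pairs a f,
    prod_pairs a fun x => f (simpleTransposition a x.1, simpleTransposition a x.2),
    prod_pairs_erase_map, simpleTransposition_lo, simpleTransposition_hi, hf]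
  simp only [if_pos h, if_neg h.asymm, one_mul]

theorem nonInversionProd_revPerm (p : Fin n → S) : nonInversionProd p Fin.revPerm = 1 :=
  Finset.prod_eq_one fun x hx => if_neg (by
    rw [Fin.revPerm_apply, Fin.revPerm_apply, Fin.rev_lt_rev, Fin.lt_def, not_lt]
    exact (mem_pairs.1 hx).le)

theorem eval_pairProd (p : Fin n → S) (w : Equiv.Perm (Fin n)) :
    eval (fun i => p (w i)) (pairProd p) = if w = 1 then nonInversionProd p w else 0 := by
  rw [pairProd, map_prod]
  simp only [map_sub, eval_C, eval_X]
  split_ifs with h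
  · subst h
    exact Finset.prod_congr rfl fun x hx => (if_pos (mem_pairs.1 hx)).symm
  · obtain ⟨j, hj⟩ : ∃ j, w j < j := by
      by_contra hcon
      push Not at hcon
      exact h (eq_one_of_forall_le hcon)
    exact Finset.prod_eq_zero (i := (w j, j)) (mem_pairs.2 hj) (sub_self _)

theorem eval_divDiff (z : Fin n → S) (a : Fin (n - 1)) (f : MvPolynomial (Fin n) S) :
    (z (lo a) - z (hi a)) * eval z (divDiff (lo a) (hi a) f) =
      eval z f - eval (fun i => z (simpleTransposition a i)) f := by
  have h := congrArg (eval z) (mul_divDiff (lo a) (hi a) f)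
  rw [map_mul, map_sub, map_sub, eval_X, eval_X, eval_rename] at h
  exact h

variable [IsDomain S]

theorem eval_wordDiff_pairProd {p : Fin n → S} (hp : Function.Injective p)
    (l : List (Fin (n - 1))) (w : Equiv.Perm (Fin n)) (hl : l.length ≤ inversions w) :
    eval (fun i => p (w i)) (wordDiff l (pairProd p)) =
      if l.length = inversions w ∧ w = (wordProd l)⁻¹ then nonInversionProd p w else 0 := by
  induction l generalizing w with
  | nil =>
    rw [wordDiff, List.foldr_nil, eval_pairProd]
    have h0 : (wordProd [] : Equiv.Perm (Fin n))⁻¹ = 1 := inv_one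
    rw [h0, List.length_nil]
    refine if_congr ⟨fun h => ⟨?_, h⟩, fun h => h.2⟩ rfl rfl
    rw [h, inversions_one]
  | cons a l ih =>
    rw [List.length_cons] at hl ⊢
    have hne : p (w (lo a)) - p (w (hi a)) ≠ 0 :=
      sub_ne_zero.2 fun h => lo_ne_hi a (w.injective (hp h))
    apply mul_left_cancel₀ hne
    rw [wordDiff_cons, eval_divDiff (fun i => p (w i)), ih w (by omega),
      if_neg (fun h => by omega), zero_sub]
    have hinv : (w * simpleTransposition a = (wordProd l)⁻¹) ↔ w = (wordProd (a :: l))⁻¹ := by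
      rw [wordProd_cons, mul_inv_rev, simpleTransposition_inv, ← mul_left_inj (simpleTransposition a),
        mul_assoc w, simpleTransposition_mul_self, mul_one]
    have hih := ih (w * simpleTransposition a)
    rcases lt_or_gt_lo_hi w a with h | h
    · have h1 := inversions_mul_of_lt h
      have h2 := hih (by omega)
      simp only [Equiv.Perm.mul_apply] at h2
      rw [h2, if_neg (fun h3 => by omega), if_neg, mul_zero, neg_zero]
      rintro ⟨-, h3⟩
      have h4 := inversions_inv_wordProd_le l
      rw [← hinv.2 h3] at h4
      omega
    · have h1 := inversions_mul_of_gt h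
      have h2 := hih (by omega)
      simp only [Equiv.Perm.mul_apply] at h2
      rw [h2, nonInversionProd_mul h]
      have : l.length = inversions (w * simpleTransposition a) ↔ l.length + 1 = inversions w := by
        omega
      simp only [hinv, this]
      split_ifs
      · ring
      · simp

theorem eval_zero_wordDiff_pairProd_zero [Infinite S] (l : List (Fin (n - 1))) :
    eval (fun _ => 0) (wordDiff l (pairProd (0 : Fin n → S))) =
      if l.length = (pairs n).card ∧ wordProd l = Fin.revPerm then 1 else 0 := by
  by_cases hl : l.length = (pairs n).card
  · let p : Fin n → S := fun i => Infinite.natEmbedding S i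
    have hp : Function.Injective p := fun i j h => Fin.ext ((Infinite.natEmbedding S).injective h)
    have h1 : wordDiff l (pairProd p) = wordDiff l (pairProd (0 : Fin n → S)) := by
      rw [← sub_eq_zero, ← wordDiff_sub]
      refine degLT_zero (wordDiff_mem_degLT l ?_)
      rw [hl, zero_add]
      exact pairProd_sub_mem_degLT _ _
    have h2 : ∃ c, wordDiff l (pairProd p) = C c := by
      have h3 : wordDiff l (pairProd p) ∈ degLT (Fin n) S 1 :=
        wordDiff_mem_degLT l (by rw [hl, add_comm]; exact pairProd_mem_degLT p)
      refine ⟨coeff 0 (wordDiff l (pairProd p)), MvPolynomial.ext _ _ fun m => ?_⟩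
      rw [coeff_C]
      split_ifs with hm
      · rw [hm]
      · refine coeff_zero_of_mem_degLT h3 (Nat.one_le_iff_ne_zero.2 fun h => hm ?_)
        exact ((Finsupp.degree_eq_zero_iff m).1 h).symm
    obtain ⟨c, hc⟩ := h2
    have h3 := eval_wordDiff_pairProd hp l Fin.revPerm (by rw [inversions_revPerm, hl])
    rw [hc, eval_C, nonInversionProd_revPerm, inversions_revPerm] at h3
    rw [← h1, hc, eval_C, h3]
    refine if_congr (and_congr_right fun _ => ?_) rfl rfl
    have h5 : (Fin.revPerm : Equiv.Perm (Fin n))⁻¹ = Fin.revPerm := by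
      rw [inv_eq_iff_mul_eq_one]
      ext i
      simp
    rw [eq_comm, inv_eq_iff_eq_inv, h5]
  · rw [if_neg fun h => hl h.1]
    have h1 : homogeneousComponent 0 (wordDiff l (pairProd (0 : Fin n → S))) = 0 := by
      rw [homogeneousComponent_wordDiff, zero_add,
        homogeneousComponent_of_mem pairProd_zero_isHomogeneous, if_neg hl, wordDiff_zero]
    rw [homogeneousComponent_zero, C_eq_zero] at h1
    rw [eval_zero', constantCoeff_eq, h1]

end PairProd

/-! ### Orthogonality of the quantum Schubert polynomials -/

section WordValue

variable {n : ℕ} {S S' : Type*} [CommRing S] [CommRing S']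

theorem map_eval_zero (φ : S →+* S') (f : MvPolynomial (Fin n) S) :
    φ (eval (fun _ => 0) f) = eval (fun _ => 0) (map φ f) := by
  rw [eval_zero', eval_zero', constantCoeff_map]

variable [IsDomain S]

variable (S) in
/-- The value at zero of an iterated divided difference of `∏_{i<j} (p_i - X_j)`, as a polynomial
in the `p_i`. -/
def wordValue (l : List (Fin (n - 1))) : MvPolynomial (Fin n) S :=
  eval (fun _ => 0) (wordDiff l (pairProd (X : Fin n → MvPolynomial (Fin n) S)))

theorem eval_wordValue (p : Fin n → S) (l : List (Fin (n - 1))) :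
    eval p (wordValue S l) = eval (fun _ => 0) (wordDiff l (pairProd p)) := by
  rw [wordValue, map_eval_zero, map_wordDiff, map_pairProd]
  simp

theorem divDiff_wordValue (l : List (Fin (n - 1))) (a : Fin (n - 1)) :
    divDiff (lo a) (hi a) (wordValue S l) = wordValue S (l ++ [a]) := by
  refine divDiff_eq_of_mul_eq (lo_ne_hi a) ?_
  have h1 := congrArg (wordDiff l) (pairProd_sub_comp (X : Fin n → MvPolynomial (Fin n) S) a)
  rw [wordDiff_sub, wordDiff_C_mul] at h1
  have h1 := congrArg (eval fun _ => 0) h1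
  rw [map_sub, map_mul, eval_C] at h1
  have h2 : rename (Equiv.swap (lo a) (hi a)) (wordValue S l) = eval (fun _ => 0)
      (wordDiff l (pairProd fun i => (X (simpleTransposition a i) : MvPolynomial (Fin n) S))) := by
    have h3 := map_eval_zero (rename (R := S) (simpleTransposition a)).toRingHom
      (wordDiff l (pairProd (X : Fin n → MvPolynomial (Fin n) S)))
    rw [map_wordDiff, map_pairProd] at h3
    simp only [AlgHom.toRingHom_eq_coe, RingHom.coe_coe, rename_X] at h3
    exact h3
  rw [h2]
  rw [wordValue, wordValue, wordDiff_append]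
  exact h1.symm

theorem wordDiff_wordValue (l a : List (Fin (n - 1))) :
    wordDiff a (wordValue S l) = wordValue S (l ++ a.reverse) := by
  induction a with
  | nil => rw [List.reverse_nil, List.append_nil]; rfl
  | cons c a ih =>
    rw [wordDiff_cons, ih, divDiff_wordValue, List.reverse_cons, List.append_assoc]

end WordValue

section Orthogonality

variable {k : Type*} [CommRing k] [IsDomain k] {n : ℕ}

/-- The coordinates of a point, ordered as the `u_j`, continued by zeros. -/
def uPoint {S : Type*} [CommRing S] (p : Fin n → S) (j : ℕ) : S :=
  if h : j < n then p (uIdx n j h) else 0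

theorem prod_rootProd {S : Type*} [CommRing S] (p : Fin n → S) :
    ∏ j ∈ Finset.range n, rootProd n (uPoint p j) j = pairProd p := by
  simp only [rootProd]
  rw [Finset.prod_sigma', pairProd]
  symm
  refine Finset.prod_bij (fun x _ => ⟨n - 1 - x.1, n - 1 - x.2⟩) ?_ ?_ ?_ ?_
  · intro x hx
    have := mem_pairs.1 hx
    simp only [Finset.mem_sigma, Finset.mem_range]
    omega
  · intro x hx y hy h
    simp only [Sigma.mk.injEq, heq_eq_eq] at h
    ext <;> omega
  · rintro ⟨j, i⟩ h
    simp only [Finset.mem_sigma, Finset.mem_range] at h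
    refine ⟨(uIdx n j h.1, uIdx n i (h.2.trans h.1)), mem_pairs.2 ?_, ?_⟩
    · simp only [uIdx]; omega
    · simp only [uIdx, Sigma.mk.injEq, heq_eq_eq]; omega
  · intro x hx
    have h1 : n - 1 - (x.1 : ℕ) < n := by omega
    have h2 : n - 1 - (x.2 : ℕ) < n := by omega
    rw [uPoint, dif_pos h1, uVar_of_lt h2]
    have e1 : uIdx n _ h1 = x.1 := by ext; simp only [uIdx]; omega
    have e2 : uIdx n _ h2 = x.2 := by ext; simp only [uIdx]; omega
    rw [e1, e2]

omit [IsDomain k] in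
theorem eval_topQuantumDoubleSchubert (p : Fin n → QRing k n) :
    eval (fun i => (C (p i) : XRing k n)) (topQuantumDoubleSchubert k n) =
      ∏ j ∈ Finset.range n, xDelta k n j (C (uPoint p j)) := by
  rw [topQuantumDoubleSchubert_eq_levelProd, levelProd, map_prod]
  refine Finset.prod_congr rfl fun j hj => ?_
  have hj := Finset.mem_range.1 hj
  have h2 := map_qDelta (S := XYRing k n) (S' := XRing k n)
    (eval fun i => (C (p i) : XRing k n)) (fun i => C (xSeq k n i))
    (fun i => C (C (qSeq k n i))) (uVar n _ j) j
  simp only [eval_C] at h2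
  rw [uVar_of_lt hj, eval_X] at h2
  rw [uVar_of_lt hj, uPoint, dif_pos hj]
  exact h2

theorem topForm_eval_mul [Infinite k] (p : Fin n → QRing k n) (b : List (Fin (n - 1))) :
    topForm k n (eval (fun i => (C (p i) : XRing k n)) (topQuantumDoubleSchubert k n) *
      eval (fun _ => 0) (wordDiff b (topQuantumDoubleSchubert k n))) = eval p (wordValue _ b) := by
  set g := eval (fun i => (C (p i) : XRing k n)) (topQuantumDoubleSchubert k n) with hg
  have h1 := levelForm_prod_sub_mem (uPoint p) 0 n.zero_le
  rw [← Finset.range_eq_Ico, ← eval_topQuantumDoubleSchubert, prod_rootProd, levelForm,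
    ← topQuantumDoubleSchubert_eq_levelProd, ← hg] at h1
  have h2 := eval_zero_of_mem_symIdeal (wordDiff_mem_symIdeal b h1)
  rw [wordDiff_sub, map_sub, sub_eq_zero, ← contract_wordDiff, wordDiff_C_mul, eval_contract,
    map_mul, eval_C, C_0] at h2
  rw [h2, eval_wordValue]

theorem contract_topForm_schubert [Infinite k] (b : List (Fin (n - 1))) :
    contract (topForm k n) (C (eval (fun _ => 0) (wordDiff b (topQuantumDoubleSchubert k n))) *
      topQuantumDoubleSchubert k n) = wordValue _ b := by
  refine MvPolynomial.funext fun p => ?_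
  rw [eval_contract, map_mul, eval_C, mul_comm, topForm_eval_mul]

theorem topForm_mul_of_words [Infinite k] (a b : List (Fin (n - 1))) :
    topForm k n (eval (fun _ => 0) (wordDiff a (topQuantumDoubleSchubert k n)) *
      eval (fun _ => 0) (wordDiff b (topQuantumDoubleSchubert k n))) =
      if a.length + b.length = (pairs n).card ∧ wordProd b * (wordProd a)⁻¹ = Fin.revPerm
      then 1 else 0 := by
  have h1 := congrArg (fun f => eval (fun _ => 0) (wordDiff a f)) (contract_topForm_schubert (k := k) b)
  rw [← contract_wordDiff, wordDiff_C_mul, eval_contract, map_mul, eval_C, C_0, wordDiff_wordValue,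
    eval_wordValue] at h1
  have h2 := eval_zero_wordDiff_pairProd_zero (S := QRing k n) (b ++ a.reverse)
  rw [List.length_append, List.length_reverse, wordProd_append, wordProd_reverse,
    add_comm b.length] at h2
  rw [mul_comm, h1, ← h2]
  rfl

/-- The quantum Schubert polynomials are orthonormal up to the longest permutation. -/
theorem topForm_quantumSchubert_mul [Infinite k] (u v : Equiv.Perm (Fin n)) :
    topForm k n (quantumSchubert k u * quantumSchubert k v) =
      if v = Fin.revPerm * u then 1 else 0 := by
  have ha := (exists_isReducedWord (u * Fin.revPerm)).choose_spec
  have hb := (exists_isReducedWord (v * Fin.revPerm)).choose_spec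
  have h := topForm_mul_of_words (k := k) (exists_isReducedWord (u * Fin.revPerm)).choose
    (exists_isReducedWord (v * Fin.revPerm)).choose
  rw [ha.length_eq, hb.length_eq, wordProd, wordProd, ha.1, hb.1, mul_inv_rev,
    mul_assoc, mul_inv_cancel_left] at h
  refine h.trans (if_congr ?_ rfl rfl)
  rw [mul_inv_eq_iff_eq_mul]
  refine ⟨fun h => h.2, fun h => ⟨?_, h⟩⟩
  rw [h, mul_assoc, add_comm, inversions_revPerm_mul]

end Orthogonality

/-! ### The quantum Schubert polynomials as a basis modulo the quantum ideal -/

section Basis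

variable {k : Type*} [CommRing k] [IsDomain k] {n : ℕ}

theorem card_staircase (n : ℕ) :
    Fintype.card ((j : Fin n) → Fin (n - j)) = Fintype.card (Equiv.Perm (Fin n)) := by
  rw [Fintype.card_pi, Fintype.card_perm, Fintype.card_fin, ← Finset.prod_range_add_one_eq_factorial,
    ← Finset.prod_range_reflect, Finset.prod_range]
  refine Finset.prod_congr rfl fun j _ => ?_
  rw [Fintype.card_fin]
  omega

variable (k n) in
/-- The linear combinations of the staircase monomials. -/
def staircaseComb : (((j : Fin n) → Fin (n - j)) → QRing k n) →ₗ[QRing k n] XRing k n :=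
  Fintype.linearCombination (QRing k n) fun s =>
    monomial (Finsupp.equivFunOnFinite.symm fun j => (s j : ℕ)) 1

theorem exists_staircaseComb (f : XRing k n) :
    ∃ c, f - staircaseComb k n c ∈ quantumIdeal k n := by
  obtain ⟨g, hg, hfg⟩ := exists_mem_staircaseSpan f
  suffices g ∈ LinearMap.range (staircaseComb k n) by
    obtain ⟨c, rfl⟩ := this
    exact ⟨c, hfg⟩
  rw [staircaseComb, Fintype.range_linearCombination]
  refine Submodule.span_mono ?_ hg
  rintro _ ⟨m, hm, rfl⟩
  refine ⟨fun j => ⟨m j, by have := hm j; omega⟩, ?_⟩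
  exact congrArg (fun a => (monomial a 1 : XRing k n)) (Finsupp.ext fun j => rfl)

variable (k n) in
/-- The coordinates with respect to the quantum Schubert polynomials. -/
def schubertCoord : XRing k n →ₗ[QRing k n] (Equiv.Perm (Fin n) → QRing k n) :=
  LinearMap.pi fun w =>
    topForm k n ∘ₗ LinearMap.mulRight (QRing k n) (quantumSchubert k (Fin.revPerm * w))

theorem schubertCoord_apply (f : XRing k n) (w : Equiv.Perm (Fin n)) :
    schubertCoord k n f w = topForm k n (f * quantumSchubert k (Fin.revPerm * w)) := rfl

theorem schubertCoord_of_mem {f : XRing k n} (hf : f ∈ quantumIdeal k n) :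
    schubertCoord k n f = 0 :=
  funext fun _ => topForm_of_mem_quantumIdeal (Ideal.mul_mem_right _ _ hf)

variable [Infinite k]

theorem schubertCoord_sum (c : Equiv.Perm (Fin n) → QRing k n) :
    schubertCoord k n (∑ w, C (c w) * quantumSchubert k w) = c := by
  funext v
  rw [schubertCoord_apply, Finset.sum_mul, map_sum, Finset.sum_eq_single v]
  · rw [mul_assoc, ← smul_eq_C_mul, map_smul, topForm_quantumSchubert_mul, if_pos rfl, smul_eq_mul,
      mul_one]
  · intro u _ hu
    rw [mul_assoc, ← smul_eq_C_mul, map_smul, topForm_quantumSchubert_mul,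
      if_neg (fun h => hu (mul_left_cancel h).symm), smul_zero]
  · exact fun h => absurd (Finset.mem_univ v) h

theorem mem_quantumIdeal_of_schubertCoord {f : XRing k n} (hf : schubertCoord k n f = 0) :
    f ∈ quantumIdeal k n := by
  obtain ⟨c, hc⟩ := exists_staircaseComb f
  let e := Fintype.equivOfCardEq (card_staircase n)
  let T : (((j : Fin n) → Fin (n - j)) → QRing k n) →ₗ[QRing k n]
      (((j : Fin n) → Fin (n - j)) → QRing k n) :=
    (LinearMap.funLeft (QRing k n) (QRing k n) e ∘ₗ schubertCoord k n) ∘ₗ staircaseComb k n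
  have hsurj : Function.Surjective T := by
    intro d
    obtain ⟨c', hc'⟩ := exists_staircaseComb (∑ w, C (d (e.symm w)) * quantumSchubert k w)
    refine ⟨c', ?_⟩
    have h1 := schubertCoord_of_mem hc'
    rw [map_sub, schubertCoord_sum, sub_eq_zero] at h1
    funext s
    change schubertCoord k n (staircaseComb k n c') (e s) = d s
    rw [← h1]
    exact congrArg d (e.symm_apply_apply s)
  have hinj := OrzechProperty.injective_of_surjective_endomorphism T hsurj
  have h2 := schubertCoord_of_mem hc
  rw [map_sub, hf, zero_sub, neg_eq_zero] at h2
  have h3 : c = 0 := hinj (by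
    rw [map_zero]
    funext s
    change schubertCoord k n (staircaseComb k n c) (e s) = 0
    rw [h2]
    rfl)
  rwa [h3, map_zero, sub_zero] at hc

theorem sub_schubert_sum_mem (f : XRing k n) :
    f - ∑ w, C (schubertCoord k n f w) * quantumSchubert k w ∈ quantumIdeal k n := by
  refine mem_quantumIdeal_of_schubertCoord ?_
  rw [map_sub, schubertCoord_sum, sub_self]

theorem mem_quantumIdeal_of_topForm_mul {f : XRing k n} (hf : ∀ g, topForm k n (f * g) = 0) :
    f ∈ quantumIdeal k n :=
  mem_quantumIdeal_of_schubertCoord (funext fun _ => hf _)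

end Basis

/-! ### The leading part of the Bezoutian -/

section Leading

theorem add_sub_mem_degLT {σ R : Type*} [CommRing R] {d : ℕ} {a b c : MvPolynomial σ R}
    (h1 : a - c ∈ degLT σ R d) (h2 : b ∈ degLT σ R d) : a + b - c ∈ degLT σ R d := by
  rw [add_sub_right_comm]
  exact add_mem h1 h2

variable {k : Type*} [CommRing k] {n : ℕ}

theorem mixedPoint_of_lt {m : ℕ} {l : Fin n} (h : (l : ℕ) < m) : mixedPoint k n m l = X l :=
  if_pos h

theorem mixedPoint_mem_degLT (m : ℕ) (l : Fin n) :
    mixedPoint k n m l ∈ degLT (Fin n) (XRing k n) ((if (l : ℕ) < m then 1 else 0) + 1) := by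
  unfold mixedPoint
  split_ifs
  · exact X_mem_degLT _ (by norm_num)
  · exact C_mem_degLT _ (by norm_num)

theorem aeval_mixedPoint_mem_degLT (m : ℕ) {d : ℕ} {f : XRing k n}
    (hf : f ∈ degLT (Fin n) (QRing k n) d) :
    aeval (mixedPoint k n m) f ∈ degLT (Fin n) (XRing k n) d :=
  eval₂_mem_degLT (φ := (C : QRing k n →+* XRing k n)) (fun i =>
    degLT_mono (by split_ifs <;> norm_num) (mixedPoint_mem_degLT m i)) hf

theorem prod_mixedPoint_mem_degLT (m : ℕ) (t : Finset (Fin n)) :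
    ∏ l ∈ t, mixedPoint k n m l ∈
      degLT (Fin n) (XRing k n) ((t.filter fun l : Fin n => (l : ℕ) < m).card + 1) := by
  rw [Finset.card_filter]
  exact prod_mem_degLT _ _ _ fun l _ => mixedPoint_mem_degLT m l

theorem aeval_esymm_eq (a : Fin n → XYRing k n) (d : ℕ) :
    aeval a (esymm (Fin n) (QRing k n) d) =
      ∑ t ∈ Finset.univ.powersetCard d, ∏ l ∈ t, a l := by
  simp [esymm, map_sum, map_prod]

theorem card_filter_lt_le (m : ℕ) (t : Finset (Fin n)) :
    (t.filter fun l : Fin n => (l : ℕ) < m).card ≤ m := by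
  have h := Finset.card_le_card_of_injOn (s := t.filter fun l : Fin n => (l : ℕ) < m)
    (t := Finset.range m) (fun l : Fin n => (l : ℕ))
    (fun l hl => Finset.mem_coe.2 (Finset.mem_range.2 (Finset.mem_filter.1 hl).2))
    (fun a _ b _ h => Fin.ext h)
  rwa [Finset.card_range] at h

theorem aeval_mixedPoint_esymm_mem_degLT {m d : ℕ} (h : m ≤ d) :
    aeval (mixedPoint k n m) (esymm (Fin n) (QRing k n) (d + 1))
      ∈ degLT (Fin n) (XRing k n) (d + 1) := by
  rw [aeval_esymm_eq]
  exact sum_mem fun t _ => degLT_mono (by have := card_filter_lt_le m t; omega)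
    (prod_mixedPoint_mem_degLT m t)

theorem aeval_mixedPoint_esymm_succ_sub_mem_degLT (i : Fin n) :
    aeval (mixedPoint k n ((i : ℕ) + 1)) (esymm (Fin n) (QRing k n) ((i : ℕ) + 1))
      - ∏ l ∈ Finset.Iic i, (X l : XYRing k n) ∈ degLT (Fin n) (XRing k n) ((i : ℕ) + 1) := by
  classical
  have hcard : (Finset.Iic i).card = (i : ℕ) + 1 := Fin.card_Iic i
  have hmem : Finset.Iic i ∈ Finset.univ.powersetCard ((i : ℕ) + 1) :=
    Finset.mem_powersetCard.2 ⟨Finset.subset_univ _, hcard⟩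
  have hprod : ∏ l ∈ Finset.Iic i, (X l : XYRing k n) =
      ∏ l ∈ Finset.Iic i, mixedPoint k n ((i : ℕ) + 1) l :=
    Finset.prod_congr rfl fun l hl =>
      (mixedPoint_of_lt (Nat.lt_succ_of_le (Fin.le_def.1 (Finset.mem_Iic.1 hl)))).symm
  rw [aeval_esymm_eq, ← Finset.add_sum_erase _ _ hmem, hprod]
  refine add_sub_mem_degLT (by rw [sub_self]; exact zero_mem _)
    (sum_mem fun t ht => degLT_mono ?_ (prod_mixedPoint_mem_degLT _ t))
  obtain ⟨hne, ht⟩ := Finset.mem_erase.1 ht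
  have htc := (Finset.mem_powersetCard.1 ht).2
  rw [Nat.add_le_add_iff_right, ← Nat.lt_succ_iff]
  refine lt_of_le_of_ne (card_filter_lt_le _ t) fun h => hne ?_
  have h1 : t.filter (fun l : Fin n => (l : ℕ) < (i : ℕ) + 1) = t :=
    Finset.eq_of_subset_of_card_le (Finset.filter_subset _ _) (by rw [htc, h])
  refine Finset.eq_of_subset_of_card_le (fun l hl => ?_) (by rw [htc, hcard])
  rw [← h1] at hl
  exact Finset.mem_Iic.2 (Fin.le_def.2 (Nat.lt_succ_iff.1 (Finset.mem_filter.1 hl).2))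

variable [IsDomain k]

theorem totalDegree_C_X_sub_X (j : Fin n) :
    (C (X j) - X j : XYRing k n).totalDegree = 1 := by
  refine le_antisymm ?_ (Nat.one_le_iff_ne_zero.2 fun h0 => ?_)
  · refine (totalDegree_sub _ _).trans (max_le ?_ ?_)
    · rw [totalDegree_C]; exact zero_le_one
    · rw [totalDegree_X]
  · have h := congrArg (coeff (Finsupp.single j 1)) (totalDegree_eq_zero_iff_eq_C.1 h0)
    rw [coeff_C, if_neg (by simp [eq_comm]), coeff_sub, coeff_C, if_neg (by simp [eq_comm]),
      coeff_X, if_pos rfl, zero_sub, neg_eq_zero] at h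
    exact one_ne_zero h

theorem mem_degLT_of_C_X_sub_X_mul (j : Fin n) {d : ℕ} {g : XYRing k n}
    (h : (C (X j) - X j) * g ∈ degLT (Fin n) (XRing k n) (d + 1)) :
    g ∈ degLT (Fin n) (XRing k n) d :=
  mem_degLT_of_linear_mul (totalDegree_C_X_sub_X j) h

theorem discretePartial_sub (f g : XRing k n) (j : Fin n) :
    discretePartial (f - g) j = discretePartial f j - discretePartial g j := by
  have h0 : (C (X j) - X j : XYRing k n) ≠ 0 := fun h => by
    have := totalDegree_C_X_sub_X (k := k) j
    rw [h, totalDegree_zero] at this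
    exact zero_ne_one this
  apply mul_left_cancel₀ h0
  rw [mul_sub (C (X j) - X j : XYRing k n) (discretePartial f j) (discretePartial g j),
    mul_discretePartial, mul_discretePartial, mul_discretePartial, map_sub, map_sub]
  ring

theorem discretePartial_mem_degLT {d : ℕ} {f : XRing k n}
    (hf : f ∈ degLT (Fin n) (QRing k n) (d + 1)) (j : Fin n) :
    discretePartial f j ∈ degLT (Fin n) (XRing k n) d := by
  refine mem_degLT_of_C_X_sub_X_mul j ?_
  rw [mul_discretePartial]
  exact sub_mem (aeval_mixedPoint_mem_degLT _ hf) (aeval_mixedPoint_mem_degLT _ hf)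

theorem discretePartial_quantumElem_sub_mem (i j : Fin n) :
    discretePartial (quantumElem k n i) j
      - discretePartial (esymm (Fin n) (QRing k n) ((i : ℕ) + 1)) j
      ∈ degLT (Fin n) (XRing k n) i := by
  rw [← discretePartial_sub]
  exact discretePartial_mem_degLT (quantumElem_sub_esymm_mem_degLT i) j

theorem discretePartial_quantumElem_mem (i j : Fin n) :
    discretePartial (quantumElem k n i) j ∈ degLT (Fin n) (XRing k n) ((i : ℕ) + 1) :=
  discretePartial_mem_degLT (quantumElem_mem_degLT i) j

theorem discretePartial_quantumElem_mem_of_lt {i j : Fin n} (h : j < i) :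
    discretePartial (quantumElem k n i) j ∈ degLT (Fin n) (XRing k n) i := by
  rw [← sub_add_cancel (discretePartial (quantumElem k n i) j)
    (discretePartial (esymm (Fin n) (QRing k n) ((i : ℕ) + 1)) j)]
  refine add_mem (discretePartial_quantumElem_sub_mem i j) (mem_degLT_of_C_X_sub_X_mul j ?_)
  rw [mul_discretePartial]
  exact sub_mem (aeval_mixedPoint_esymm_mem_degLT (by omega))
    (aeval_mixedPoint_esymm_mem_degLT (by omega))

theorem discretePartial_quantumElem_self_sub_mem (i : Fin n) :
    discretePartial (quantumElem k n i) i - ∏ l ∈ Finset.Iio i, (X l : XYRing k n)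
      ∈ degLT (Fin n) (XRing k n) i := by
  rw [← sub_add_sub_cancel (discretePartial (quantumElem k n i) i)
    (discretePartial (esymm (Fin n) (QRing k n) ((i : ℕ) + 1)) i)]
  refine add_mem (discretePartial_quantumElem_sub_mem i i) (mem_degLT_of_C_X_sub_X_mul i ?_)
  rw [mul_sub (C (X i) - X i : XYRing k n) (discretePartial _ i), mul_discretePartial]
  have h1 := aeval_mixedPoint_esymm_mem_degLT (k := k) (n := n) (le_refl (i : ℕ))
  have h2 := aeval_mixedPoint_esymm_succ_sub_mem_degLT (k := k) i
  have h3 : C (X i) * ∏ l ∈ Finset.Iio i, (X l : XYRing k n)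
      ∈ degLT (Fin n) (XRing k n) ((i : ℕ) + 1) := by
    refine C_mul_mem_degLT _ ?_
    have := prod_mem_degLT (Finset.Iio i) (fun _ => 1) (fun l => (X l : XYRing k n))
      (fun l _ => X_mem_degLT l (by norm_num))
    simpa using this
  have h4 : ∏ l ∈ Finset.Iic i, (X l : XYRing k n) =
      X i * ∏ l ∈ Finset.Iio i, (X l : XYRing k n) := by
    rw [← Finset.Iio_insert, Finset.prod_insert (by simp)]
  rw [h4] at h2
  convert sub_mem (sub_mem h1 h2) h3 using 1
  ring

theorem bezoutian_sub_mem :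
    bezoutian k n - ∏ i : Fin n, ∏ l ∈ Finset.Iio i, (X l : XYRing k n)
      ∈ degLT (Fin n) (XRing k n) (∑ i : Fin n, (i : ℕ)) := by
  classical
  rw [bezoutian, Matrix.det_apply]
  simp only [Matrix.of_apply]
  rw [← Finset.add_sum_erase Finset.univ _ (Finset.mem_univ (1 : Equiv.Perm (Fin n))),
    Equiv.Perm.sign_one, one_smul]
  refine add_sub_mem_degLT (prod_sub_prod_mem_degLT _ _ _ _ (fun i _ => discretePartial_quantumElem_mem i i)
    (fun i _ => ?_) fun i _ => discretePartial_quantumElem_self_sub_mem i) (sum_mem fun σ hσ => ?_)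
  · have := prod_mem_degLT (Finset.Iio i) (fun _ => 1) (fun l => (X l : XYRing k n))
      (fun l _ => X_mem_degLT l (by norm_num))
    simpa using this
  · obtain ⟨j, hj⟩ : ∃ j, j < σ j := by
      by_contra hcon
      push Not at hcon
      refine Finset.ne_of_mem_erase hσ (inv_eq_one.1 (eq_one_of_forall_le fun j => ?_))
      have := hcon (σ⁻¹ j)
      rwa [← Equiv.Perm.mul_apply, mul_inv_cancel, Equiv.Perm.one_apply] at this
    have h1 := prod_mem_degLT (Finset.univ.erase j) (fun i => (σ i : ℕ))
      (fun i => discretePartial (quantumElem k n (σ i)) i)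
      (fun i _ => discretePartial_quantumElem_mem (σ i) i)
    have h2 := mul_mem_degLT' (discretePartial_quantumElem_mem_of_lt (k := k) hj) h1
    rw [Finset.add_sum_erase _ (fun i => (σ i : ℕ)) (Finset.mem_univ j),
      Finset.mul_prod_erase _ (fun i => discretePartial (quantumElem k n (σ i)) i)
        (Finset.mem_univ j), Equiv.sum_comp σ fun i => (i : ℕ)] at h2
    rw [Units.smul_def]
    exact zsmul_mem h2 _

end Leading

/-! ### The Grothendieck residue -/

section Residue

variable {k : Type*} [CommRing k] {n : ℕ}

/-- The difference of `f(x)` and `f(y)` is a combination of the `x_j - y_j`. -/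
theorem C_sub_map_C_mem (f : XRing k n) :
    (C f - map C f : XYRing k n) ∈
      Ideal.span (Set.range fun j : Fin n => (C (X j) - X j : XYRing k n)) := by
  induction f using MvPolynomial.induction_on with
  | C a => rw [map_C, sub_self]; exact zero_mem _
  | add p q hp hq =>
    have h : (C (p + q) - map C (p + q) : XYRing k n) = (C p - map C p) + (C q - map C q) := by
      rw [C_add, map_add]; ring
    rw [h]
    exact add_mem hp hq
  | mul_X p i hp =>
    have h : (C (p * X i) - map C (p * X i) : XYRing k n) =
        C (X i) * (C p - map C p) + map C p * (C (X i) - X i) := by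
      rw [C_mul, map_mul, map_X]; ring
    rw [h]
    exact add_mem (Ideal.mul_mem_left _ _ hp)
      (Ideal.mul_mem_left _ _ (Ideal.subset_span ⟨i, rfl⟩))

theorem aeval_C_X {σ R : Type*} [CommRing R] (f : MvPolynomial σ R) :
    aeval (fun l => C (X l)) f = (C f : MvPolynomial σ (MvPolynomial σ R)) := by
  induction f using MvPolynomial.induction_on with
  | C a => rw [aeval_C]; rfl
  | add p q hp hq => rw [map_add, hp, hq, C_add]
  | mul_X p i hp => rw [map_mul, aeval_X, hp, C_mul]

theorem aeval_X_eq_map_C {σ R : Type*} [CommRing R] (f : MvPolynomial σ R) :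
    aeval X f = (map C f : MvPolynomial σ (MvPolynomial σ R)) := by
  induction f using MvPolynomial.induction_on with
  | C a => rw [aeval_C, map_C]; rfl
  | add p q hp hq => rw [map_add, hp, hq, map_add]
  | mul_X p i hp => rw [map_mul, aeval_X, hp, map_mul, map_X]

theorem sum_discretePartial_mul (f : XRing k n) :
    ∑ j : Fin n, discretePartial f j * (C (X j) - X j) = (C f - map C f : XYRing k n) := by
  have h1 : ∀ j : Fin n, discretePartial f j * (C (X j) - X j : XYRing k n) =
      aeval (mixedPoint k n j) f - aeval (mixedPoint k n ((j : ℕ) + 1)) f := fun j => by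
    rw [mul_comm, mul_discretePartial]
  have h2 : mixedPoint k n 0 = fun l => C (X l) := funext fun l => if_neg (Nat.not_lt_zero _)
  have h3 : mixedPoint k n n = X := funext fun l => if_pos l.2
  refine (Finset.sum_congr rfl fun j _ => h1 j).trans ?_
  have h4 := Finset.sum_range_sub' (fun j => (aeval (mixedPoint k n j) f : XYRing k n)) n
  rw [Finset.sum_range, h2, h3] at h4
  exact h4.trans (congrArg₂ (fun a b => a - b) (aeval_C_X f) (aeval_X_eq_map_C f))

variable (k n) in
/-- The ideal generated by the quantum elementary polynomials in `x` and in `y`. -/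
def doubleIdeal : Ideal (XYRing k n) :=
  (quantumIdeal k n).map C ⊔ (quantumIdeal k n).map (map C)

theorem det_mul_eq_adjugate_mulVec {A m : Type*} [CommRing A] [Fintype m] [DecidableEq m]
    (D : Matrix m m A) (v : m → A) (j : m) :
    v j * D.det = D.adjugate.mulVec (D.mulVec v) j := by
  rw [Matrix.mulVec_mulVec, Matrix.adjugate_mul, Matrix.smul_mulVec, Matrix.one_mulVec,
    Pi.smul_apply, smul_eq_mul, mul_comm]

theorem mulVec_mem {A m : Type*} [CommRing A] [Fintype m] {I : Ideal A} (D : Matrix m m A)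
    {v : m → A} (j : m) (h : ∀ i, v i ∈ I) : D.mulVec v j ∈ I :=
  sum_mem fun i _ => Ideal.mul_mem_left _ _ (h i)

theorem C_sub_map_C_mem_sup {σ A : Type*} [CommRing A] {I : Ideal (MvPolynomial σ A)}
    {f : MvPolynomial σ A} (hf : f ∈ I) :
    (C f - map C f : MvPolynomial σ (MvPolynomial σ A)) ∈
      I.map (C : MvPolynomial σ A →+* MvPolynomial σ (MvPolynomial σ A)) ⊔ I.map (map C) :=
  sub_mem (Ideal.mem_sup_left (Ideal.mem_map_of_mem _ hf))
    (Ideal.mem_sup_right (Ideal.mem_map_of_mem _ hf))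

theorem C_sub_map_C_mem_doubleIdeal {f : XRing k n} (hf : f ∈ quantumIdeal k n) :
    (C f - map C f : XYRing k n) ∈ doubleIdeal k n :=
  C_sub_map_C_mem_sup hf

theorem mul_bezoutian_mem (j : Fin n) :
    (C (X j) - X j) * bezoutian k n ∈ doubleIdeal k n := by
  set D : Matrix (Fin n) (Fin n) (XYRing k n) :=
    Matrix.of fun i j : Fin n => discretePartial (quantumElem k n i) j with hD
  have h1 : (D.mulVec fun j => (C (X j) - X j : XYRing k n)) =
      fun i => (C (quantumElem k n i) - map C (quantumElem k n i) : XYRing k n) :=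
    funext fun i => sum_discretePartial_mul (quantumElem k n i)
  have h3 := det_mul_eq_adjugate_mulVec D (fun j => (C (X j) - X j : XYRing k n)) j
  rw [h1] at h3
  change _ * D.det ∈ _
  have h4 : ∀ i, (C (quantumElem k n i) - map C (quantumElem k n i) : XYRing k n) ∈
      doubleIdeal k n := fun i => C_sub_map_C_mem_doubleIdeal (Ideal.subset_span ⟨i, rfl⟩)
  have h5 := mulVec_mem D.adjugate j h4
  rwa [← h3] at h5

theorem C_sub_map_C_mul_bezoutian_mem (f : XRing k n) :
    (C f - map C f) * bezoutian k n ∈ doubleIdeal k n := by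
  obtain ⟨c, hc⟩ := Ideal.mem_span_range_iff_exists_fun.1 (C_sub_map_C_mem f)
  rw [← hc, Finset.sum_mul]
  refine sum_mem fun j _ => ?_
  rw [mul_assoc]
  exact Ideal.mul_mem_left _ _ (mul_bezoutian_mem j)

variable [IsDomain k]

variable (k n) in
/-- The top-coefficient functional in the variables `y`. -/
def topFormY : XYRing k n →ₗ[XRing k n] XRing k n :=
  (basisMonomials (Fin n) (XRing k n)).constr (XRing k n)
    fun m => C (topForm k n (monomial m 1))

theorem topFormY_monomial (m : Fin n →₀ ℕ) (a : XRing k n) :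
    topFormY k n (monomial m a) = a * C (topForm k n (monomial m 1)) := by
  have h := (basisMonomials (Fin n) (XRing k n)).constr_basis (XRing k n)
    (fun m => (C (topForm k n (monomial m 1)) : XRing k n)) m
  rw [coe_basisMonomials] at h
  have h1 : (monomial m a : XYRing k n) = a • monomial m 1 := by
    rw [smul_monomial, smul_eq_mul, mul_one]
  rw [h1, map_smul, topFormY, h, smul_eq_mul]

theorem topForm_contract (r : XRing k n →ₗ[QRing k n] QRing k n) (B : XYRing k n) :
    topForm k n (contract r B) = r (topFormY k n B) := by
  induction B using MvPolynomial.induction_on' with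
  | monomial m a =>
    rw [contract_monomial, topFormY_monomial, mul_comm, ← smul_eq_C_mul, map_smul, smul_eq_mul]
    have h : (monomial m (r a) : XRing k n) = r a • monomial m 1 := by
      rw [smul_monomial, smul_eq_mul, mul_one]
    rw [h, map_smul, smul_eq_mul, mul_comm]
  | add p q hp hq => rw [contract_add, map_add, hp, hq, map_add, map_add]

theorem topFormY_of_mem_degLT {B : XYRing k n}
    (hB : B ∈ degLT (Fin n) (XRing k n) (staircase n).degree) : topFormY k n B = 0 := by
  refine degLT_induction (p := fun B => topFormY k n B = 0) (map_zero _)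
    (fun f g hf hg => by rw [map_add, hf, hg, add_zero]) (fun m a hm => ?_) hB
  rw [topFormY_monomial, topForm_of_mem_degLT (monomial_mem_degLT m 1 hm), C_0, mul_zero]

theorem topFormY_bezoutian : topFormY k n (bezoutian k n) = 1 := by
  have h1 : ∏ i : Fin n, ∏ l ∈ Finset.Iio i, (X l : XYRing k n) = monomial (staircase n) 1 := by
    have h := congrArg (map (C : QRing k n →+* XRing k n)) (prod_prod_xSeq (k := k) (n := n))
    rw [map_monomial, C_1, map_prod, Finset.prod_range] at h
    rw [← h]
    refine Finset.prod_congr rfl fun i _ => ?_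
    rw [map_prod]
    refine Finset.prod_bij (fun l _ => (l : ℕ)) (fun l hl => ?_) (fun a _ b _ h => Fin.ext h)
      (fun l hl => ?_) fun l _ => ?_
    · exact Finset.mem_range.2 (Fin.lt_def.1 (Finset.mem_Iio.1 hl))
    · have hl := Finset.mem_range.1 hl
      exact ⟨⟨l, hl.trans i.2⟩, Finset.mem_Iio.2 (Fin.lt_def.2 hl), rfl⟩
    · rw [xSeq_of_lt k n l.2, map_X]
  have h2 := bezoutian_sub_mem (k := k) (n := n)
  rw [h1, ← Finset.sum_range fun i => i, sum_range_eq_degree_staircase] at h2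
  have h3 := topFormY_of_mem_degLT h2
  rw [map_sub, topFormY_monomial, topForm_monomial_staircase, C_1, mul_one, sub_eq_zero] at h3
  exact h3

theorem topForm_contract_of_mem_doubleIdeal {r : XRing k n →ₗ[QRing k n] QRing k n}
    (hr : ∀ f ∈ quantumIdeal k n, r f = 0) {B : XYRing k n} (hB : B ∈ doubleIdeal k n) :
    topForm k n (contract r B) = 0 := by
  obtain ⟨a, ha, b, hb, rfl⟩ := Submodule.mem_sup.1 hB
  rw [contract_add, map_add]
  have h1 : contract r a = 0 := by
    refine MvPolynomial.ext _ _ fun m => ?_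
    rw [coeff_contract, coeff_zero]
    exact hr _ (mem_map_C_iff.1 ha m)
  have h2 : contract r b ∈ quantumIdeal k n := by
    have key : ∀ c, contract r (c * b) ∈ quantumIdeal k n := by
      refine Submodule.span_induction (p := fun b _ => ∀ c, contract r (c * b) ∈ quantumIdeal k n)
        ?_ ?_ ?_ ?_ hb
      · rintro _ ⟨f, hf, rfl⟩ c
        rw [mul_comm, contract_map_C_mul]
        exact Ideal.mul_mem_right _ _ hf
      · intro c
        rw [mul_zero, contract_zero]
        exact zero_mem _
      · intro x y _ _ hx hy c
        rw [mul_add, contract_add]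
        exact add_mem (hx c) (hy c)
      · intro a x _ hx c
        rw [smul_eq_mul, ← mul_assoc]
        exact hx _
    simpa only [one_mul] using key 1
  rw [h1, map_zero, zero_add, topForm_of_mem_quantumIdeal h2]

theorem topForm_mul_contract_bezoutian {r : XRing k n →ₗ[QRing k n] QRing k n}
    (hr : ∀ f ∈ quantumIdeal k n, r f = 0) (h : XRing k n) :
    topForm k n (h * contract r (bezoutian k n)) = r h := by
  have h1 := topForm_contract_of_mem_doubleIdeal hr (C_sub_map_C_mul_bezoutian_mem h)
  rw [sub_mul (C h : XYRing k n), contract_sub, map_sub, contract_map_C_mul, sub_eq_zero,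
    topForm_contract, ← smul_eq_C_mul, map_smul, topFormY_bezoutian, smul_eq_mul, mul_one] at h1
  exact h1.symm

theorem IsGrothendieckResidue.eq_topForm {r : XRing k n →ₗ[QRing k n] QRing k n}
    (hr : IsGrothendieckResidue r) : r = topForm k n := by
  refine LinearMap.ext fun f => ?_
  rw [← topForm_mul_contract_bezoutian hr.1 f, ← sub_eq_zero, ← map_sub, ← mul_sub_one]
  exact topForm_of_mem_quantumIdeal (Ideal.mul_mem_left _ _ hr.2)

theorem isGrothendieckResidue_topForm [Infinite k] : IsGrothendieckResidue (topForm k n) := by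
  refine ⟨fun f => topForm_of_mem_quantumIdeal, mem_quantumIdeal_of_topForm_mul fun g => ?_⟩
  rw [mul_comm, mul_sub_one, map_sub,
    topForm_mul_contract_bezoutian fun f => topForm_of_mem_quantumIdeal, sub_self]

theorem grothendieckResidue_eq [Infinite k] : grothendieckResidue k n = topForm k n := by
  have h : ∃ r : XRing k n →ₗ[QRing k n] QRing k n, IsGrothendieckResidue r :=
    ⟨_, isGrothendieckResidue_topForm⟩
  rw [grothendieckResidue, dif_pos h]
  exact h.choose_spec.eq_topForm

end Residue

/-! ### Change of the coefficient ring -/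

section BaseChange

variable {k k' : Type*} [CommRing k] [CommRing k'] {n : ℕ}

/-- The change of coefficients in `k[q]`. -/
def qMap (n : ℕ) (φ : k →+* k') : QRing k n →+* QRing k' n := map φ

/-- The change of coefficients in `k[q][x]`. -/
def xMap (n : ℕ) (φ : k →+* k') : XRing k n →+* XRing k' n := map (qMap n φ)

variable (φ : k →+* k')

theorem xMap_C (a : QRing k n) : xMap n φ (C a) = C (qMap n φ a) := map_C _ _

theorem qMap_qSeq (i : ℕ) : qMap n φ (qSeq k n i) = qSeq k' n i := by
  unfold qSeq qMap
  split_ifs <;> simp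

theorem xMap_xSeq (i : ℕ) : xMap n φ (xSeq k n i) = xSeq k' n i := by
  unfold xSeq xMap
  split_ifs <;> simp

theorem map_charDelta : (charDelta k n).map (xMap n φ) = charDelta k' n := by
  have h := map_qDelta (S := Polynomial (XRing k n)) (S' := Polynomial (XRing k' n))
    (Polynomial.mapRingHom (xMap n φ)) (fun i => Polynomial.C (xSeq k n i))
    (fun i => Polynomial.C (C (qSeq k n i))) Polynomial.X n
  simp only [Polynomial.coe_mapRingHom, Polynomial.map_C, Polynomial.map_X, xMap_C, xMap_xSeq,
    qMap_qSeq] at h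
  exact h

theorem xMap_quantumElem (i : Fin n) : xMap n φ (quantumElem k n i) = quantumElem k' n i := by
  rw [quantumElem_eq, quantumElem_eq, ← map_charDelta φ, Polynomial.coeff_map]

theorem xMap_mem_quantumIdeal {f : XRing k n} (hf : f ∈ quantumIdeal k n) :
    xMap n φ f ∈ quantumIdeal k' n := by
  obtain ⟨c, rfl⟩ := Ideal.mem_span_range_iff_exists_fun.1 hf
  rw [map_sum]
  refine sum_mem fun i _ => ?_
  rw [map_mul, xMap_quantumElem]
  exact Ideal.mul_mem_left _ _ (Ideal.subset_span ⟨i, rfl⟩)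

theorem map_topQuantumDoubleSchubert :
    map (xMap n φ) (topQuantumDoubleSchubert k n) = topQuantumDoubleSchubert k' n := by
  rw [topQuantumDoubleSchubert_eq_levelProd, topQuantumDoubleSchubert_eq_levelProd, levelProd,
    levelProd, map_prod]
  refine Finset.prod_congr rfl fun j _ => ?_
  have h := map_qDelta (S := XYRing k n) (S' := XYRing k' n) (map (xMap n φ))
    (fun i => C (xSeq k n i)) (fun i => C (C (qSeq k n i))) (uVar n _ j) j
  simp only [map_C, xMap_C, xMap_xSeq, qMap_qSeq, map_uVar] at h
  exact h

theorem xMap_quantumSchubert [IsDomain k'] (w : Equiv.Perm (Fin n)) :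
    xMap n φ (quantumSchubert k w) = quantumSchubert k' w := by
  rw [quantumSchubert, map_eval_zero, quantumDoubleSchubert]
  have h := map_wordDiff (xMap n φ) (exists_isReducedWord (w * Fin.revPerm)).choose
    (topQuantumDoubleSchubert k n)
  rw [map_topQuantumDoubleSchubert] at h
  exact congrArg _ h

end BaseChange

/-! ### The structure constants -/

section StructureConstants

variable {n : ℕ}

theorem structureConstant_spec (u v : Equiv.Perm (Fin n)) :
    quantumSchubert ℤ u * quantumSchubert ℤ v
      - ∑ w, C (structureConstant u v w) * quantumSchubert ℤ w ∈ quantumIdeal ℤ n := by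
  classical
  have h : ∃ c : Equiv.Perm (Fin n) → QRing ℤ n,
      quantumSchubert ℤ u * quantumSchubert ℤ v - ∑ w, C (c w) * quantumSchubert ℤ w
        ∈ quantumIdeal ℤ n := ⟨_, sub_schubert_sum_mem _⟩
  have h1 : ∀ w, structureConstant u v w = h.choose w := fun w => by
    rw [structureConstant, dif_pos h]
  simp only [h1]
  exact h.choose_spec

/-- The structure constants as values of the top-coefficient functional. -/
theorem map_structureConstant {k : Type*} [CommRing k] [IsDomain k] [Infinite k] (φ : ℤ →+* k)
    (u v w : Equiv.Perm (Fin n)) :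
    qMap n φ (structureConstant u v w) =
      topForm k n (quantumSchubert k u * quantumSchubert k v *
        quantumSchubert k (Fin.revPerm * w)) := by
  have h := xMap_mem_quantumIdeal φ (structureConstant_spec u v)
  simp only [map_sub, map_mul, map_sum, xMap_quantumSchubert, xMap_C] at h
  have h1 := schubertCoord_of_mem h
  rw [map_sub, schubertCoord_sum fun w => qMap n φ (structureConstant u v w), sub_eq_zero] at h1
  exact (congrFun h1 w).symm

theorem revPerm_mul_self : (Fin.revPerm : Equiv.Perm (Fin n)) * Fin.revPerm = 1 := by
  ext i
  simp

theorem schubert_mul_sub_mem {k : Type*} [CommRing k] [IsDomain k] [Infinite k] (φ : ℤ →+* k)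
    (u w : Equiv.Perm (Fin n)) :
    quantumSchubert k u * quantumSchubert k w
      - ∑ τ, C (qMap n φ (structureConstant w (Fin.revPerm * τ) (Fin.revPerm * u)))
        * quantumSchubert k τ ∈ quantumIdeal k n := by
  have h := sub_schubert_sum_mem (quantumSchubert k u * quantumSchubert k w)
  have h1 : ∀ τ, qMap n φ (structureConstant w (Fin.revPerm * τ) (Fin.revPerm * u)) =
      schubertCoord k n (quantumSchubert k u * quantumSchubert k w) τ := fun τ => by
    rw [map_structureConstant, schubertCoord_apply, ← mul_assoc (Fin.revPerm), revPerm_mul_self,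
      one_mul, mul_comm _ (quantumSchubert k u), mul_assoc (quantumSchubert k u)]
  simp only [h1]
  exact h

end StructureConstants

/-! ### The potential -/

section Potential

theorem pderiv_exp_subst {σ A : Type*} [CommRing A] [Algebra ℚ A] {s : MvPowerSeries σ A}
    (hs : PowerSeries.HasSubst s) {i : σ} {c : A}
    (hc : MvPowerSeries.pderiv A i s = MvPowerSeries.C c) :
    MvPowerSeries.pderiv A i ((PowerSeries.exp ℚ).subst s) =
      MvPowerSeries.C c * (PowerSeries.exp ℚ).subst s := by
  ext m
  rw [MvPowerSeries.coeff_pderiv, MvPowerSeries.coeff_C_mul, PowerSeries.coeff_subst hs,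
    PowerSeries.coeff_subst hs]
  set f : ℕ → A := fun d => PowerSeries.coeff d (PowerSeries.exp ℚ) •
    MvPowerSeries.coeff (m + Finsupp.single i 1) (s ^ d) with hf
  set g : ℕ → A := fun d => PowerSeries.coeff d (PowerSeries.exp ℚ) •
    MvPowerSeries.coeff m (s ^ d) with hg
  have hfg : ∀ d, f (d + 1) * ((m i : A) + 1) = c * g d := fun d => by
    rw [hf, hg]
    simp only
    rw [smul_mul_assoc, ← MvPowerSeries.coeff_pderiv, MvPowerSeries.pderiv_pow, hc,
      Nat.add_sub_cancel, mul_assoc, mul_comm (s ^ d), ← map_natCast (MvPowerSeries.C (σ := σ)),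
      MvPowerSeries.coeff_C_mul, MvPowerSeries.coeff_C_mul, ← nsmul_eq_mul, ← mul_smul_comm,
      mul_smul_comm, mul_smul_comm, ← Nat.cast_smul_eq_nsmul ℚ, smul_smul]
    congr 1
    rw [PowerSeries.coeff_exp, PowerSeries.coeff_exp, Nat.factorial_succ]
    push_cast
    field_simp
  have h0 : f 0 * ((m i : A) + 1) = 0 := by
    rw [hf]
    simp only
    rw [smul_mul_assoc, ← MvPowerSeries.coeff_pderiv, pow_zero, MvPowerSeries.pderiv_one, map_zero,
      smul_zero]
  have hff : f.support.Finite := PowerSeries.coeff_subst_finite hs _ _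
  have hgf : g.support.Finite := PowerSeries.coeff_subst_finite hs _ _
  obtain ⟨N, hN⟩ := (hff.union hgf).bddAbove
  rw [finsum_eq_sum_of_support_subset f (s := Finset.range (N + 1 + 1)) fun d hd =>
      Finset.mem_coe.2 (Finset.mem_range.2 (by have := hN (Or.inl hd); omega)),
    finsum_eq_sum_of_support_subset g (s := Finset.range (N + 1)) fun d hd =>
      Finset.mem_coe.2 (Finset.mem_range.2 (by have := hN (Or.inr hd); omega)),
    Finset.sum_mul, Finset.sum_range_succ', h0, add_zero, Finset.mul_sum]
  exact Finset.sum_congr rfl fun d _ => hfg d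

variable {n : ℕ}

theorem pderiv_schubertSum (w : Equiv.Perm (Fin n)) :
    MvPowerSeries.pderiv (XRing ℚ n) w (schubertSum n) =
      MvPowerSeries.C (quantumSchubert ℚ w) := by
  classical
  rw [schubertSum, map_sum, Finset.sum_eq_single w]
  · rw [Derivation.leibniz, MvPowerSeries.pderiv_C, MvPowerSeries.pderiv_X_self, smul_zero,
      add_zero, smul_eq_mul, mul_one]
  · intro v _ hv
    rw [Derivation.leibniz, MvPowerSeries.pderiv_C, MvPowerSeries.pderiv_X_of_ne hv, smul_zero,
      smul_zero, add_zero]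
  · exact fun h => absurd (Finset.mem_univ w) h

theorem pderiv_expSchubert (w : Equiv.Perm (Fin n)) :
    MvPowerSeries.pderiv (XRing ℚ n) w (expSchubert n) =
      MvPowerSeries.C (quantumSchubert ℚ w) * expSchubert n :=
  pderiv_exp_subst (hasSubst_schubertSum n) (pderiv_schubertSum w)

theorem coeff_potential (m : Equiv.Perm (Fin n) →₀ ℕ) :
    MvPowerSeries.coeff m (potential n) =
      topForm ℚ n (MvPowerSeries.coeff m (expSchubert n)) := by
  have h : MvPowerSeries.coeff m (potential n) =
      grothendieckResidue ℚ n (staircaseProj (MvPowerSeries.coeff m (expSchubert n))) := rfl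
  rw [h, grothendieckResidue_eq]
  have h1 := topForm_of_mem_quantumIdeal
    (staircaseProj_sub_mem (MvPowerSeries.coeff m (expSchubert n)))
  rw [map_sub, sub_eq_zero] at h1
  exact h1.symm

theorem coeff_pderiv_of_coeff {σ : Type*} {G : MvPowerSeries σ (QRing ℚ n)}
    {E : MvPowerSeries σ (XRing ℚ n)}
    (h : ∀ m, MvPowerSeries.coeff m G = topForm ℚ n (MvPowerSeries.coeff m E)) (i : σ)
    (m : σ →₀ ℕ) :
    MvPowerSeries.coeff m (MvPowerSeries.pderiv (QRing ℚ n) i G) =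
      topForm ℚ n (MvPowerSeries.coeff m (MvPowerSeries.pderiv (XRing ℚ n) i E)) := by
  have h1 : ((m i : XRing ℚ n) + 1) = C ((m i : QRing ℚ n) + 1) := by simp
  rw [MvPowerSeries.coeff_pderiv, MvPowerSeries.coeff_pderiv, h, h1, mul_comm _ (C _),
    ← smul_eq_C_mul, map_smul, smul_eq_mul, mul_comm]

theorem quantumOperator_potential (u w : Equiv.Perm (Fin n)) :
    quantumOperator u w (potential n) = 0 := by
  ext1 m
  have h1 := coeff_pderiv_of_coeff (coeff_potential (n := n))
  have h2 := coeff_pderiv_of_coeff (h1 w) u m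
  rw [pderiv_expSchubert, Derivation.leibniz, MvPowerSeries.pderiv_C, smul_zero,
    add_zero, pderiv_expSchubert, smul_eq_mul, MvPowerSeries.coeff_C_mul,
    MvPowerSeries.coeff_C_mul] at h2
  rw [quantumOperator, map_sub, map_sum, map_zero, h2]
  have h3 : ∀ τ : Equiv.Perm (Fin n), MvPowerSeries.coeff m
      (MvPowerSeries.C (map (Int.castRingHom ℚ)
        (structureConstant w (Fin.revPerm * τ) (Fin.revPerm * u)))
      * MvPowerSeries.pderiv (QRing ℚ n) τ (potential n)) =
      topForm ℚ n (C (qMap n (Int.castRingHom ℚ)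
        (structureConstant w (Fin.revPerm * τ) (Fin.revPerm * u))) * quantumSchubert ℚ τ *
          MvPowerSeries.coeff m (expSchubert n)) := fun τ => by
    rw [MvPowerSeries.coeff_C_mul, h1, pderiv_expSchubert, MvPowerSeries.coeff_C_mul, mul_assoc,
      ← smul_eq_C_mul, map_smul, smul_eq_mul]
    rfl
  rw [Finset.sum_congr rfl fun τ _ => h3 τ, ← map_sum, ← map_sub, ← Finset.sum_mul]
  have h4 := Ideal.mul_mem_right (MvPowerSeries.coeff m (expSchubert n)) _
    (schubert_mul_sub_mem (k := ℚ) (Int.castRingHom ℚ) u w)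
  rw [← topForm_of_mem_quantumIdeal h4]
  congr 1
  ring

end Potential

end FlagPotential

end

theorem corollaryc2p1 (n : ℕ) (u w : Equiv.Perm (Fin n)) :
    FlagPotential.quantumOperator u w (FlagPotential.potential n) = 0 := by
  exact FlagPotential.quantumOperator_potential u w
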